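/- Let $d\ge 1$ and let $\Omega\subset\mathbb R^d$ be a polyhedral domain, that is, an open set with $\Omega=\operatorname{int}\overline\Omega$ whose closure is the union of finitely many closed simplices. Assume that the dual problem is stable: there is $\gamma>0$ such that for every $g\in L^2(\Omega)$ the problem $-\Delta z=g$ in $\Omega$, $z=0$ on $\partial\Omega$, has a weak solution $z\in H^2(\Omega)\cap H^1_0(\Omega)$ with $\gamma\|z\|_{H^2(\Omega)}\le\|g\|_{L^2(\Omega)}$. Fix a polynomial degree $k\ge1$, a penalty parameter $\sigma>0$ and $\mu>0$. For a conforming simplicial triangulation $\mathcal T$ of $\Omega$ (finitely many open $d$-simplices $K$, any two of whose closures meet in a common subsimplex or not at all, with $\bigcup_{K}\overline K=\overline\Omega$) let $h_K$ be the diameter of $K$, $\rho_K$ the radius of the largest ball contained in $K$, and $h(x)=\max_{\overline K\ni x}h_K$. Let $\mathcal E$ be the set of all $(d-1)$-dimensional faces of the elements, $\mathcal E^{\mathrm{int}}\subset\mathcal E$ the set of those shared by two elements, and $h_e$ the diameter of the face $e$ (if $d=1$, where faces are points, $h_e$ is the largest $h_K$ of the elements meeting at $e$). On $e\in\mathcal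 E^{\mathrm{int}}$ shared by $K_1,K_2$ with outward unit normals $n_1,n_2$, put $\{v\}=\tfrac12(v|_{K_1}+v|_{K_2})$, $[v]=v|_{K_1}n_1+v|_{K_2}n_2$ for scalar $v$ and $[v]=v|_{K_1}\cdot n_1+v|_{K_2}\cdot n_2$ for vector-valued $v$; on a boundary face put $\{v\}=v$, $[v]=v\,n$ and $[v]=v\cdot n$, respectively. Let $\mathbb P_k(\mathcal T)$ be the space of functions that are polynomials of total degree at most $k$ on each $K\in\mathcal T$, with no continuity imposed, and let $$\mathcal A_h(w,v)=\sum_{K\in\mathcal T}\int_K\nabla w\cdot\nabla v-\sum_{e\in\mathcal E}\int_e\Big([w]\cdot\{\nabla v\}+[v]\cdot\{\nabla w\}-\frac{\sigma}{h}[w]\cdot[v]\Big).$$ Then there is a constant $C>0$, depending only on $d,\Omega,\gamma,k,\sigma,\mu$ and in particular not on the meshsize, such that the following holds for every conforming simplicial triangulation $\mathcal T$ of $\Omega$ with $\min_{K\in\mathcal T}\rho_K/h_K\ge\mu$ and every $f\in L^2(\Omega)$. If $u\in H^1_0(\Omega)$ is the weak solution of $-\Delta u=f$, and $u_h\in\mathbb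 P_k(\mathcal T)$ is an interior penalty approximation of $u$, i.e. $\mathcal A_h(u_h,v_h)=\int_\Omega f v_h$ for all $v_h\in\mathbb P_k(\mathcal T)$, then $$\|u-u_h\|_{L^2(\Omega)}\le C\Big(\sum_{K\in\mathcal T}h_K^4\|f+\Delta u_h\|_{L^2(K)}^2+\sum_{e\in\mathcal E^{\mathrm{int}}}h_e^3\|[\nabla u_h]\|_{L^2(e)}^2+\sum_{e\in\mathcal E}\sigma h_e\|[u_h]\|_{L^2(e)}^2\Big)^{1/2}.$$ -/

import Mathlib

open MeasureTheory Filter Topology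
open scoped ContDiff Gradient Classical

noncomputable section

namespace IPDG

/-- `ℝ^d` with its Euclidean structure. -/
abbrev Vec (d : ℕ) := EuclideanSpace ℝ (Fin d)

/-- The `L²` norm of a function with respect to the measure `ν`. -/
def l2Norm {X F : Type*} [MeasurableSpace X] [NormedAddCommGroup F]
    (ν : Measure X) (v : X → F) : ℝ :=
  (eLpNorm v 2 ν).toReal

/-! ### Sobolev spaces and weak solutions -/

section Sobolev

variable {d : ℕ}

/-- `φ` is a test function, i.e. an element of `C_c^∞(Ω)`. -/
def IsTest (Ω : Set (Vec d)) (φ : Vec d → ℝ) : Prop :=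
  ContDiff ℝ ∞ φ ∧ HasCompactSupport φ ∧ tsupport φ ⊆ Ω

/-- `v` belongs to `H¹₀(Ω)`, the closure of `C_c^∞(Ω)` in `H¹(Ω)`, and `G` is its weak gradient. -/
def MemH10 (Ω : Set (Vec d)) (v : Vec d → ℝ) (G : Vec d → Vec d) : Prop :=
  MemLp v 2 (volume.restrict Ω) ∧ MemLp G 2 (volume.restrict Ω) ∧
    ∃ φ : ℕ → Vec d → ℝ, (∀ n, IsTest Ω (φ n)) ∧
      Tendsto (fun n => eLpNorm (fun x => φ n x - v x) 2 (volume.restrict Ω)) atTop (𝓝 0) ∧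
      Tendsto (fun n => eLpNorm (fun x => ∇ (φ n) x - G x) 2 (volume.restrict Ω)) atTop (𝓝 0)

/-- `w'` is the weak partial derivative of `w` in the `i`-th coordinate direction on `Ω`. -/
def HasWeakPartial (Ω : Set (Vec d)) (i : Fin d) (w w' : Vec d → ℝ) : Prop :=
  ∀ φ : Vec d → ℝ, IsTest Ω φ →
    ∫ x in Ω, w x * (∇ φ x) i = -∫ x in Ω, w' x * φ x

/-- `z` belongs to `H²(Ω)`, with weak gradient `G` and weak second derivatives `H i j = ∂ⱼ∂ᵢ z`. -/
def MemH2 (Ω : Set (Vec d)) (z : Vec d → ℝ) (G : Vec d → Vec d)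
    (H : Fin d → Fin d → Vec d → ℝ) : Prop :=
  MemLp z 2 (volume.restrict Ω) ∧ MemLp G 2 (volume.restrict Ω) ∧
    (∀ i j, MemLp (H i j) 2 (volume.restrict Ω)) ∧
    (∀ i, HasWeakPartial Ω i z (fun x => G x i)) ∧
    ∀ i j, HasWeakPartial Ω j (fun x => G x i) (H i j)

/-- The `H²(Ω)` norm, expressed through the weak derivatives. -/
def h2Norm (Ω : Set (Vec d)) (z : Vec d → ℝ) (G : Vec d → Vec d)
    (H : Fin d → Fin d → Vec d → ℝ) : ℝ :=
  Real.sqrt (l2Norm (volume.restrict Ω) z ^ 2 + l2Norm (volume.restrict Ω) G ^ 2 +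
    ∑ i, ∑ j, l2Norm (volume.restrict Ω) (H i j) ^ 2)

/-- `u ∈ H¹₀(Ω)`, with weak gradient `G`, is a weak solution of `-Δu = f` in `Ω`, `u = 0` on
`∂Ω`. -/
def IsWeakSolutionWith (Ω : Set (Vec d)) (f u : Vec d → ℝ) (G : Vec d → Vec d) : Prop :=
  MemH10 Ω u G ∧ ∀ (v : Vec d → ℝ) (Gv : Vec d → Vec d), MemH10 Ω v Gv →
    ∫ x in Ω, inner ℝ (G x) (Gv x) = ∫ x in Ω, f x * v x

/-- `u` is a weak solution in `H¹₀(Ω)` of `-Δu = f`. -/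
def IsWeakSolution (Ω : Set (Vec d)) (f u : Vec d → ℝ) : Prop :=
  ∃ G, IsWeakSolutionWith Ω f u G

/-- Stability of the dual problem with constant `γ`: for each `g ∈ L²(Ω)` the problem `-Δz = g`
(the Laplacian is formally self-adjoint) has a solution `z ∈ H²(Ω) ∩ H¹₀(Ω)` with
`γ ‖z‖_{H²(Ω)} ≤ ‖g‖_{L²(Ω)}`. -/
def DualStable (Ω : Set (Vec d)) (γ : ℝ) : Prop :=
  ∀ g : Vec d → ℝ, MemLp g 2 (volume.restrict Ω) →
    ∃ z G H, IsWeakSolutionWith Ω g z G ∧ MemH2 Ω z G H ∧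
      γ * h2Norm Ω z G H ≤ l2Norm (volume.restrict Ω) g

end Sobolev

/-! ### Simplicial meshes -/

/-- The closed simplex spanned by a finite set of vertices. -/
def closedSimplex {d : ℕ} (K : Finset (Vec d)) : Set (Vec d) := convexHull ℝ (K : Set (Vec d))

/-- The open simplex spanned by `d + 1` vertices. -/
def openSimplex {d : ℕ} (K : Finset (Vec d)) : Set (Vec d) := interior (closedSimplex K)

/-- The diameter `h_K`. -/
def simplexDiam {d : ℕ} (K : Finset (Vec d)) : ℝ := Metric.diam (closedSimplex K)

/-- The radius `ρ_K` of the largest ball contained in `K`. -/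
def inradius {d : ℕ} (K : Finset (Vec d)) : ℝ :=
  sSup {r : ℝ | ∃ x, Metric.ball x r ⊆ openSimplex K}

/-- The unit normal to the face `F` of the simplex `K`, pointing out of `K`: the direction of the
component normal to `F` of the vector that leads from the barycentre of `K` to that of `F`. -/
def outerNormal {d : ℕ} (K F : Finset (Vec d)) : Vec d :=
  let w : Vec d := (vectorSpan ℝ (F : Set (Vec d)))ᗮ.starProjection
    (F.centroid ℝ id - K.centroid ℝ id)
  ‖w‖⁻¹ • w

/-- A conforming simplicial mesh in `ℝ^d`. Each element is given by its `d + 1` affinely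
independent vertices, and any two closed elements meet in the (possibly empty) simplex spanned by
their common vertices. -/
structure Mesh (d : ℕ) where
  elems : Finset (Finset (Vec d))
  card_eq : ∀ K ∈ elems, K.card = d + 1
  indep : ∀ K ∈ elems, AffineIndependent ℝ ((↑) : K → Vec d)
  inter_eq : ∀ K ∈ elems, ∀ J ∈ elems,
    closedSimplex K ∩ closedSimplex J = convexHull ℝ ((K : Set (Vec d)) ∩ (J : Set (Vec d)))

namespace Mesh

variable {d : ℕ} (T : Mesh d)

/-- The closed elements cover exactly the closure of `Ω`. -/
def Triangulates (Ω : Set (Vec d)) : Prop :=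
  (⋃ K ∈ T.elems, closedSimplex K) = closure Ω

/-- The shape regularity `μ(T) = inf_K ρ_K / h_K`. -/
def shapeRegularity : ℝ := ⨅ K : T.elems, inradius K.1 / simplexDiam K.1

/-- The meshsize function `h(x)`, the largest `h_K` over the closed elements that contain `x`. -/
def meshsize (x : Vec d) : ℝ :=
  ⨆ K : {K : Finset (Vec d) // K ∈ T.elems ∧ x ∈ closedSimplex K}, simplexDiam K.1

/-- All `(d-1)`-dimensional faces of the elements, interior ones and boundary ones. -/
def faces : Finset (Finset (Vec d)) := T.elems.biUnion fun K => K.powersetCard d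

/-- The elements that have `F` as a face: two for an interior face, one for a boundary face. -/
def neighbours (F : Finset (Vec d)) : Finset T.elems := Finset.univ.filter fun K => F ⊆ K.1

/-- The interior faces, i.e. the common interfaces of two elements. -/
def interiorFaces : Finset (Finset (Vec d)) :=
  T.faces.filter fun F => (T.neighbours F).card = 2

/-- The surface measure on a face. -/
def faceMeasure (F : Finset (Vec d)) : Measure (Vec d) :=
  μHE[d - 1].restrict (closedSimplex F)

/-- The face size `h_e`, i.e. the diameter of the face. In dimension one, where faces are points
and have diameter zero, it is the largest `h_K` of the elements that meet there. -/
def faceSize (F : Finset (Vec d)) : ℝ :=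
  if d = 1 then ⨆ K : T.neighbours F, simplexDiam K.1.1 else Metric.diam (closedSimplex F)

/-- Functions that are defined on each element separately, with one-sided values on its boundary. -/
abbrev Broken (F : Type*) := T.elems → Vec d → F

variable {T}

/-- The average `{v}` on a face; on a boundary face this is `v`. -/
def avg {F : Type*} [AddCommGroup F] [Module ℝ F] (v : T.Broken F) (e : Finset (Vec d))
    (x : Vec d) : F :=
  ((T.neighbours e).card : ℝ)⁻¹ • ∑ K ∈ T.neighbours e, v K x

/-- The (vector) jump `[v] = v|₁ n₁ + v|₂ n₂` of a scalar function; `v n` on a boundary face. -/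
def jump (v : T.Broken ℝ) (e : Finset (Vec d)) (x : Vec d) : Vec d :=
  ∑ K ∈ T.neighbours e, v K x • outerNormal K.1 e

/-- The (scalar) jump `[v] = v|₁ · n₁ + v|₂ · n₂` of a vector field. -/
def vecJump (v : T.Broken (Vec d)) (e : Finset (Vec d)) (x : Vec d) : ℝ :=
  ∑ K ∈ T.neighbours e, inner ℝ (v K x) (outerNormal K.1 e)

/-- The function on `ℝ^d` that agrees with `v K` on each open element `K` (and is `0` elsewhere). -/
def glue (v : T.Broken ℝ) (x : Vec d) : ℝ :=
  ∑ K : T.elems, (openSimplex K.1).indicator (v K) x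

variable (T)

/-- The discontinuous finite element space `P_k(T)`: a polynomial of total degree at most `k` on
each element. -/
def dgSpace (k : ℕ) : Submodule ℝ (T.elems → MvPolynomial (Fin d) ℝ) :=
  Submodule.pi Set.univ fun _ => MvPolynomial.restrictTotalDegree (Fin d) ℝ k

variable {T}

/-- The values of a piecewise polynomial. -/
def val (p : T.elems → MvPolynomial (Fin d) ℝ) : T.Broken ℝ :=
  fun K x => MvPolynomial.eval (fun i => x i) (p K)

/-- The broken gradient of a piecewise polynomial. -/
def grad (p : T.elems → MvPolynomial (Fin d) ℝ) : T.Broken (Vec d) :=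
  fun K x => WithLp.toLp 2 fun i => MvPolynomial.eval (fun j => x j) (MvPolynomial.pderiv i (p K))

/-- The broken Laplacian of a piecewise polynomial. -/
def lap (p : T.elems → MvPolynomial (Fin d) ℝ) : T.Broken ℝ :=
  fun K x => ∑ i, MvPolynomial.eval (fun j => x j)
    (MvPolynomial.pderiv i (MvPolynomial.pderiv i (p K)))

/-- The symmetric interior penalty bilinear form with penalty parameter `σ`. -/
def ipForm (σ : ℝ) (w v : T.elems → MvPolynomial (Fin d) ℝ) : ℝ :=
  (∑ K : T.elems, ∫ x in openSimplex K.1, inner ℝ (grad w K x) (grad v K x)) -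
    ∑ e ∈ T.faces, ∫ x,
      (inner ℝ (jump (val w) e x) (avg (grad v) e x) +
        inner ℝ (jump (val v) e x) (avg (grad w) e x) -
        σ / T.meshsize x * inner ℝ (jump (val w) e x) (jump (val v) e x)) ∂(faceMeasure e)

/-- `p` is an interior penalty approximation of degree `k` to `-Δu = f` in `Ω`, `u = 0` on `∂Ω`. -/
def IsIPSolution (Ω : Set (Vec d)) (f : Vec d → ℝ) (σ : ℝ) (k : ℕ)
    (p : T.elems → MvPolynomial (Fin d) ℝ) : Prop :=
  p ∈ T.dgSpace k ∧ ∀ v ∈ T.dgSpace k, ipForm σ p v = ∫ x in Ω, f x * glue (val v) x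

/-- The element indicator `η_{0,R}² = h_K⁴ ‖f + Δu_h‖²_{L²(K)}`. -/
def elemIndicatorSq (f : Vec d → ℝ) (p : T.elems → MvPolynomial (Fin d) ℝ) (K : T.elems) : ℝ :=
  simplexDiam K.1 ^ 4 *
    l2Norm (volume.restrict (openSimplex K.1)) (fun x => f x + lap p K x) ^ 2

/-- The estimator `(∑_K η_{0,R}² + ∑_e η_{0,J}²)^{1/2}`. The gradient jumps are summed over the
interior faces, the jumps of the values over all faces. -/
def estimator (f : Vec d → ℝ) (σ : ℝ) (p : T.elems → MvPolynomial (Fin d) ℝ) : ℝ :=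
  Real.sqrt ((∑ K : T.elems, elemIndicatorSq f p K) +
    (∑ e ∈ T.interiorFaces,
      T.faceSize e ^ 3 * l2Norm (faceMeasure e) (vecJump (grad p) e) ^ 2) +
    ∑ e ∈ T.faces, σ * T.faceSize e * l2Norm (faceMeasure e) (jump (val p) e) ^ 2)

end Mesh

end IPDG

end

/-! The proof is an Aubin–Nitsche duality argument. Put `g = u - u_h` and let `z ∈ H² ∩ H¹₀` be the
stable solution of `-Δz = g`, so that `‖g‖² = ∫ g u - ∫ g u_h`. Testing the weak equations of `u`
and `z` with each other gives `∫ g u = ∫ f z`. In `∫ g u_h` one may insert `g = -Δz` almost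
everywhere and integrate by parts on each element. Subtracting the discrete equation tested with a
piecewise polynomial `r`, and integrating by parts once more to bring the derivatives onto `u_h`,
leaves the element residuals `(f + Δu_h)(z - r)` and a sum of face terms: this is `error_sq_eq`.

The traces of `z` and `∇z` on an interior face are the same from both sides, and `z` has trace zero
on the boundary. Hence the face terms contain only `[u_h]` against `∇z - ∇r`, `[∇u_h]` against `z -
r` (interior faces only), and `σ/h [u_h]` against `z - r`; see `abs_faceTerm_le`. Coercivity of the
form is never used, so any `σ > 0` is admissible.

As the discrete space is discontinuous, `r` can be chosen on each element separately, as an affine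
function with the right means. Two Poincaré inequalities and the trace inequality bound `z - r` in
`L²(K)`, `z - r` on faces and `∇z - ∇r` on faces by `h_K²`, `h_K^{3/2}` and `h_K^{1/2}` times the
`H²(K)` seminorm of `z` (`exists_affine_approx`). Cauchy–Schwarz over elements and faces, stability
of the dual problem and division by `‖g‖` finish the proof.

The analysis on one simplex rests on viewing it as a cone over a face: integrating along rays gives
the flux of `w(x)(x - a)` through the face opposite to `a`, hence the trace inequality and the
divergence theorem. Sobolev functions are reached by dilation and mollification, and traces are `L²`
limits of smooth restrictions. Conformity of the mesh enters through barycentric coordinates: it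
forces opposite normals, at most two elements per face, and boundary faces outside `Ω`. -/

open MeasureTheory Filter Topology
open scoped ContDiff Gradient Classical

noncomputable section

namespace IPDG

/-! ### Barycentric coordinates on a simplex -/

section Simplex

variable {d : ℕ} {K : Finset (Vec d)}

/-- `K` is the vertex set of a nondegenerate `d`-simplex. -/
structure IsSimplex (K : Finset (Vec d)) : Prop where
  card_eq : K.card = d + 1
  indep : AffineIndependent ℝ ((↑) : K → Vec d)

lemma Mesh.isSimplex (T : Mesh d) {K : Finset (Vec d)} (hK : K ∈ T.elems) : IsSimplex K :=
  ⟨T.card_eq K hK, T.indep K hK⟩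

/-- The affine basis formed by the vertices of a simplex. -/
def IsSimplex.basis (hK : IsSimplex K) : AffineBasis K ℝ (Vec d) where
  toFun := (↑)
  ind' := hK.indep
  tot' := by
    rw [hK.indep.affineSpan_eq_top_iff_card_eq_finrank_add_one]
    simp [hK.card_eq]

/-- The barycentric coordinate of a simplex attached to a vertex. -/
def IsSimplex.coord (hK : IsSimplex K) (a : K) : Vec d →ᵃ[ℝ] ℝ := hK.basis.coord a

namespace IsSimplex

variable (hK : IsSimplex K)

lemma coord_vertex (a b : K) : hK.coord a b = if a = b then 1 else 0 :=
  hK.basis.coord_apply a b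

@[simp] lemma coord_self (a : K) : hK.coord a a = 1 := by simp [coord_vertex]

lemma coord_ne {a b : K} (h : a ≠ b) : hK.coord a b = 0 := by simp [coord_vertex, h]

lemma continuous_coord (a : K) : Continuous (hK.coord a) :=
  (hK.coord a).continuous_of_finiteDimensional

lemma sum_coord (x : Vec d) : ∑ a, hK.coord a x = 1 := hK.basis.sum_coord_apply_eq_one x

lemma sum_coord_smul (x : Vec d) : ∑ a : K, hK.coord a x • (a : Vec d) = x :=
  hK.basis.linear_combination_coord_eq_self x

lemma range_basis : Set.range hK.basis = (K : Set (Vec d)) := by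
  change Set.range ((↑) : K → Vec d) = _
  simp

lemma mem_closedSimplex {x : Vec d} : x ∈ closedSimplex K ↔ ∀ a, 0 ≤ hK.coord a x := by
  rw [closedSimplex, ← hK.range_basis, hK.basis.convexHull_eq_nonneg_coord]; rfl

lemma mem_openSimplex {x : Vec d} : x ∈ openSimplex K ↔ ∀ a, 0 < hK.coord a x := by
  rw [openSimplex, closedSimplex, ← hK.range_basis, hK.basis.interior_convexHull]; rfl

lemma affineMap_ext (hK : IsSimplex K) {f g : Vec d →ᵃ[ℝ] ℝ} (h : ∀ a : K, f a = g a)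
    (x : Vec d) : f x = g x := by
  have : f = g := AffineMap.ext_on hK.basis.tot (by rintro _ ⟨a, rfl⟩; exact h a)
  rw [this]

/-- The zero set of a coordinate is convex, which gives one direction; if the coordinates off `S`
vanish, the barycentric expansion uses vertices of `S` only. Incidence questions about faces thereby
become sign conditions on coordinates. -/
lemma mem_closedSimplex_subset {S : Finset (Vec d)} (hS : S ⊆ K) {x : Vec d} :
    x ∈ closedSimplex S ↔ x ∈ closedSimplex K ∧ ∀ a : K, (a : Vec d) ∉ S → hK.coord a x = 0 := by
  constructor
  · intro hx
    refine ⟨convexHull_mono (Finset.coe_subset.2 hS) hx, fun a ha => ?_⟩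
    have hc : Convex ℝ {y | hK.coord a y = 0} := by
      have := (convex_singleton (𝕜 := ℝ) (0 : ℝ)).affine_preimage (hK.coord a)
      exact this
    refine convexHull_min ?_ hc hx
    intro y hy
    have hyS : y ∈ S := by exact_mod_cast hy
    have hne : a ≠ ⟨y, hS hyS⟩ := by rintro rfl; exact ha hyS
    have h0 := hK.coord_ne hne
    exact h0
  · rintro ⟨hx, h0⟩
    have hpos := hK.mem_closedSimplex.1 hx
    have h1 : ∑ a ∈ Finset.univ.filter (fun a : K => (a : Vec d) ∈ S), hK.coord a x = 1 := by
      rw [← hK.sum_coord x, Finset.sum_filter]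
      exact Finset.sum_congr rfl fun a _ => by
        split_ifs with h
        · rfl
        · exact (h0 a h).symm
    have h2 : ∑ a ∈ Finset.univ.filter (fun a : K => (a : Vec d) ∈ S),
        hK.coord a x • (a : Vec d) = x := by
      conv_rhs => rw [← hK.sum_coord_smul x]
      rw [Finset.sum_filter]
      exact Finset.sum_congr rfl fun a _ => by
        split_ifs with h
        · rfl
        · rw [h0 a h, zero_smul]
    rw [← h2]
    refine (convex_convexHull ℝ _).sum_mem (fun a _ => hpos a) h1 fun a ha => ?_
    exact subset_convexHull ℝ _ (by simpa using ha)

lemma mem_face {a : K} {x : Vec d} :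
    x ∈ closedSimplex (K.erase a) ↔ x ∈ closedSimplex K ∧ hK.coord a x = 0 := by
  rw [hK.mem_closedSimplex_subset (Finset.erase_subset _ _)]
  refine and_congr_right fun _ => ⟨fun h => h a (by simp), fun h b hb => ?_⟩
  have : b = a := by
    by_contra hne
    exact hb (Finset.mem_erase.2 ⟨fun h' => hne (Subtype.ext h'), b.2⟩)
  rw [this, h]

lemma nonempty_openSimplex (hK : IsSimplex K) : (openSimplex K).Nonempty := by
  have hne : Nonempty K := by
    refine Finset.Nonempty.to_subtype (Finset.card_pos.1 ?_)
    rw [hK.card_eq]; omega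
  rw [openSimplex, closedSimplex, interior_convexHull_nonempty_iff_affineSpan_eq_top,
    ← hK.range_basis, hK.basis.tot]

end IsSimplex

lemma isCompact_closedSimplex (K : Finset (Vec d)) : IsCompact (closedSimplex K) :=
  K.finite_toSet.isCompact_convexHull ℝ

lemma convex_closedSimplex (K : Finset (Vec d)) : Convex ℝ (closedSimplex K) :=
  convex_convexHull ℝ _

lemma isOpen_openSimplex (K : Finset (Vec d)) : IsOpen (openSimplex K) := isOpen_interior

lemma convex_openSimplex (K : Finset (Vec d)) : Convex ℝ (openSimplex K) :=
  (convex_closedSimplex K).interior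

lemma openSimplex_subset (K : Finset (Vec d)) : openSimplex K ⊆ closedSimplex K :=
  interior_subset

lemma isBounded_openSimplex (K : Finset (Vec d)) : Bornology.IsBounded (openSimplex K) :=
  (isCompact_closedSimplex K).isBounded.subset (openSimplex_subset K)

/-- A convex set has null frontier, so integrals may be taken over the compact simplex or over its
interior, whichever suits. -/
lemma openSimplex_ae_eq (K : Finset (Vec d)) :
    openSimplex K =ᵐ[volume] closedSimplex K :=
  interior_ae_eq_of_null_frontier ((convex_closedSimplex K).addHaar_frontier volume)

lemma restrict_openSimplex (K : Finset (Vec d)) :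
    (volume : Measure (Vec d)).restrict (openSimplex K) = volume.restrict (closedSimplex K) :=
  Measure.restrict_congr_set (openSimplex_ae_eq K)

lemma dist_le_simplexDiam {x y : Vec d} (hx : x ∈ closedSimplex K) (hy : y ∈ closedSimplex K) :
    dist x y ≤ simplexDiam K :=
  Metric.dist_le_diam_of_mem (isCompact_closedSimplex K).isBounded hx hy

lemma vertex_mem_closedSimplex {a : Vec d} (ha : a ∈ K) : a ∈ closedSimplex K :=
  subset_convexHull ℝ _ (by exact_mod_cast ha)

/-! ### Normals and heights -/

namespace IsSimplex

variable (hK : IsSimplex K)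

lemma sum_centroid (S : Finset (Vec d)) (hS : S.Nonempty) :
    (S.card : ℝ) • S.centroid ℝ id = ∑ x ∈ S, x := by
  rw [Finset.centroid_def, Finset.affineCombination_eq_linear_combination _ _ _
    (Finset.sum_centroidWeights_eq_one_of_nonempty ℝ _ hS)]
  have : (S.card : ℝ) ≠ 0 := by exact_mod_cast hS.card_ne_zero
  simp [Finset.smul_sum, smul_smul, this]

lemma inner_outerNormal_of_mem_vectorSpan (K F : Finset (Vec d)) {v : Vec d}
    (hv : v ∈ vectorSpan ℝ (F : Set (Vec d))) : inner ℝ (outerNormal K F) v = 0 := by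
  simp only [outerNormal, inner_smul_left, mul_eq_zero]
  right
  rw [real_inner_comm]
  exact (Submodule.mem_orthogonal _ _).1 (Submodule.starProjection_apply_mem _ _) v hv

/-- Both sides are affine in `x`, so it suffices to compare them at the vertices. All later geometry
uses the normal only through this identity, which ties it to the coordinate `hK.coord a`. -/
lemma exists_height (hK : IsSimplex K) (hd : 1 ≤ d) (a : K) :
    ‖outerNormal K (K.erase a)‖ = 1 ∧ ∃ h : ℝ, 0 < h ∧
    ∀ x, inner ℝ (outerNormal K (K.erase a)) (x - a) = h * (1 - hK.coord a x) := by
  set F := K.erase (a : Vec d) with hF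
  have hFcard : F.card = d := by rw [hF, Finset.card_erase_of_mem a.2, hK.card_eq]; simp
  have hFne : F.Nonempty := Finset.card_pos.1 (by omega)
  set cF := F.centroid ℝ id with hcF
  set cK := K.centroid ℝ id with hcK
  have hKne : K.Nonempty := ⟨a, a.2⟩
  -- The barycentre of `K` is the mean of `a`, with weight one, and of the barycentre of the face,
  -- with weight `d`. This is the origin of the height `(d + 1) * ‖w‖`.
  have h1 : ((d : ℝ) + 1) • (cF - cK) = cF - a := by
    have e1 := sum_centroid F hFne
    have e2 := sum_centroid K hKne
    rw [← Finset.add_sum_erase _ _ a.2, ← hF, ← e1, hFcard, hK.card_eq] at e2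
    push_cast at e2
    rw [smul_sub, e2, ← hcF, add_smul, one_smul]; abel
  have hcFmem : cF ∈ closedSimplex F := by
    have := Finset.centroid_mem_convexHull (R := ℝ) F hFne
    exact this
  have hcF0 : hK.coord a cF = 0 := (hK.mem_face.1 hcFmem).2
  set V := vectorSpan ℝ (F : Set (Vec d)) with hV
  have hspan : ∀ y ∈ F, y - cF ∈ V := by
    intro y hy
    have h1 : y ∈ affineSpan ℝ (F : Set (Vec d)) := subset_affineSpan ℝ _ (by exact_mod_cast hy)
    have h2 : cF ∈ affineSpan ℝ (F : Set (Vec d)) :=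
      convexHull_subset_affineSpan (𝕜 := ℝ) _ hcFmem
    rw [hV, ← direction_affineSpan]
    exact AffineSubspace.vsub_mem_direction h1 h2
  have hlin : ∀ v ∈ V, (hK.coord a).linear v = 0 := by
    intro v hv
    rw [hV, vectorSpan_def] at hv
    refine (Submodule.span_le (p := LinearMap.ker (hK.coord a).linear)).2 ?_ hv
    rintro _ ⟨x, hx, y, hy, rfl⟩
    have hx0 := (hK.mem_face.1 (vertex_mem_closedSimplex (K := F) (by exact_mod_cast hx))).2
    have hy0 := (hK.mem_face.1 (vertex_mem_closedSimplex (K := F) (by exact_mod_cast hy))).2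
    change (hK.coord a).linear (x -ᵥ y) = 0
    rw [AffineMap.linearMap_vsub, hx0, hy0, vsub_self]
  set w := Vᗮ.starProjection (cF - cK) with hw
  have hdpos : (0 : ℝ) < d + 1 := by positivity
  -- Otherwise `cF - a` would be parallel to the face, where the coordinate of `a` is constant,
  -- although it takes the values `0` at `cF` and `1` at `a`.
  have hwne : w ≠ 0 := by
    intro h0
    have hmem : cF - cK ∈ V := by
      have := Submodule.starProjection_add_starProjection_orthogonal (K := V) (cF - cK)
      rw [← hw, h0, add_zero] at this
      rw [← this]
      exact Submodule.starProjection_apply_mem _ _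
    have : cF - a ∈ V := by rw [← h1]; exact V.smul_mem _ hmem
    have := hlin _ this
    have h3 := (hK.coord a).linearMap_vsub cF (a : Vec d)
    rw [vsub_eq_sub, this, hcF0, hK.coord_self] at h3
    simp at h3
  have hn : outerNormal K F = ‖w‖⁻¹ • w := rfl
  have hwpos : 0 < ‖w‖ := norm_pos_iff.2 hwne
  refine ⟨by rw [hn, norm_smul, norm_inv, norm_norm, inv_mul_cancel₀ hwpos.ne'],
    (d + 1) * ‖w‖, by positivity, ?_⟩
  have hww : inner ℝ w (cF - cK) = ‖w‖ ^ 2 := by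
    have := Submodule.starProjection_inner_eq_zero (K := Vᗮ) (cF - cK) w
      (Submodule.starProjection_apply_mem _ _)
    rw [← hw, inner_sub_left, real_inner_self_eq_norm_sq, sub_eq_zero, real_inner_comm] at this
    exact this
  have hca : inner ℝ (outerNormal K F) (cF - a) = (d + 1) * ‖w‖ := by
    rw [← h1, hn, inner_smul_left, inner_smul_right, hww]
    simp only [conj_trivial]
    field_simp
  let f : Vec d →ᵃ[ℝ] ℝ :=
    ((innerₛₗ ℝ (outerNormal K F)).toAffineMap).comp (AffineMap.id ℝ _ - AffineMap.const ℝ _ (a : Vec d))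
  let g : Vec d →ᵃ[ℝ] ℝ := ((d + 1) * ‖w‖) • (AffineMap.const ℝ _ (1 : ℝ) - hK.coord a)
  have hfg := hK.affineMap_ext (f := f) (g := g) (fun b => by
    simp only [f, g, AffineMap.comp_apply, LinearMap.coe_toAffineMap, AffineMap.coe_sub,
      Pi.sub_apply, AffineMap.id_apply, AffineMap.const_apply, AffineMap.coe_smul, Pi.smul_apply,
      innerₛₗ_apply_apply, smul_eq_mul]
    by_cases hab : a = b
    · subst hab; simp
    · rw [hK.coord_ne hab]
      have hbF : (b : Vec d) ∈ F :=
        Finset.mem_erase.2 ⟨fun h => hab (Subtype.ext h.symm), b.2⟩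
      have : (b : Vec d) - a = ((b : Vec d) - cF) + (cF - a) := by abel
      rw [this, inner_add_right, hca,
        inner_outerNormal_of_mem_vectorSpan K F (hspan _ hbF)]
      ring)
  intro x
  simpa [f, g] using hfg x

/-- The height of a simplex over the face opposite to the vertex `a`. -/
def height (hK : IsSimplex K) (a : K) : ℝ :=
  if h : 1 ≤ d then (hK.exists_height h a).2.choose else 1


lemma norm_outerNormal (hK : IsSimplex K) (hd : 1 ≤ d) (a : K) :
    ‖outerNormal K (K.erase a)‖ = 1 := (hK.exists_height hd a).1

lemma height_pos (hK : IsSimplex K) (hd : 1 ≤ d) (a : K) : 0 < hK.height a := by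
  rw [height, dif_pos hd]; exact (hK.exists_height hd a).2.choose_spec.1

lemma inner_outerNormal (hK : IsSimplex K) (hd : 1 ≤ d) (a : K) (x : Vec d) :
    inner ℝ (outerNormal K (K.erase a)) (x - a) = hK.height a * (1 - hK.coord a x) := by
  rw [height, dif_pos hd]; exact (hK.exists_height hd a).2.choose_spec.2 x

lemma inner_outerNormal_sub (hK : IsSimplex K) (hd : 1 ≤ d) (a : K) (x y : Vec d) :
    inner ℝ (outerNormal K (K.erase a)) (x - y) =
      hK.height a * (hK.coord a y - hK.coord a x) := by
  have : x - y = (x - a) - (y - a) := by abel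
  rw [this, inner_sub_right, hK.inner_outerNormal hd, hK.inner_outerNormal hd]; ring

/-- A vertex is at least as far from the opposite face as the height. -/
lemma height_le_dist (hK : IsSimplex K) (hd : 1 ≤ d) (a : K) {x : Vec d} (hx : hK.coord a x ≤ 0) :
    hK.height a ≤ dist x a := by
  have h1 := hK.inner_outerNormal hd a x
  have h2 := real_inner_le_norm (outerNormal K (K.erase a)) (x - a)
  rw [hK.norm_outerNormal hd, one_mul, h1, ← dist_eq_norm] at h2
  nlinarith [hK.height_pos hd a]

/-- Along a segment of length `2 * s` in the normal direction the coordinate of `a` changes by `2 *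
s / hK.height a`, and it stays in `[0, 1]` inside the simplex. -/
lemma two_mul_le_height_of_ball (hK : IsSimplex K) (hd : 1 ≤ d) {x : Vec d} {r : ℝ}
    (h : Metric.ball x r ⊆ openSimplex K) (a : K) :
    2 * r ≤ hK.height a := by
  by_contra hlt
  push Not at hlt
  have hpos := hK.height_pos hd a
  have hr : 0 < r := by linarith
  set n := outerNormal K (K.erase a)
  have hn : ‖n‖ = 1 := hK.norm_outerNormal hd a
  have hmem : ∀ s : ℝ, |s| < r → x + s • n ∈ closedSimplex K := by
    intro s hs
    refine openSimplex_subset K (h ?_)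
    rw [Metric.mem_ball, dist_eq_norm, add_sub_cancel_left, norm_smul, hn, mul_one]
    exact hs
  set s := hK.height a / 2
  have hs : |s| < r := by rw [abs_of_pos (by positivity)]; simp only [s]; linarith
  have key : ∀ s : ℝ, |s| < r → 2 * s ≤ hK.height a := by
    intro s hs
    have h1 := hK.inner_outerNormal_sub hd a (x + s • n) (x + (-s) • n)
    have e : x + s • n - (x + (-s) • n) = (2 * s) • n := by module
    rw [e, inner_smul_right, real_inner_self_eq_norm_sq, hn] at h1
    have p1 := hK.mem_closedSimplex.1 (hmem s hs) a
    have p2 : hK.coord a (x + (-s) • n) ≤ 1 := by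
      rw [← hK.sum_coord (x + (-s) • n)]
      exact Finset.single_le_sum (f := fun b => hK.coord b (x + (-s) • n))
        (fun b _ => hK.mem_closedSimplex.1 (hmem (-s) (by rwa [abs_neg])) b) (Finset.mem_univ a)
    nlinarith
  have h3 := key ((r + s) / 2) (by
    rw [abs_lt]
    rw [abs_of_pos (by positivity)] at hs
    constructor <;> linarith [show 0 < s by positivity])
  have : s = hK.height a / 2 := rfl
  linarith

/-- Through this bound shape regularity becomes a lower bound for all heights, which is what the
trace inequality needs. -/
lemma two_mul_inradius_le_height (hK : IsSimplex K) (hd : 1 ≤ d) (a : K) :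
    2 * inradius K ≤ hK.height a := by
  have : inradius K ≤ hK.height a / 2 := by
    refine csSup_le ⟨0, 0, by simp⟩ ?_
    rintro r ⟨x, hx⟩
    linarith [hK.two_mul_le_height_of_ball hd hx a]
  linarith

lemma simplexDiam_pos (hK : IsSimplex K) (hd : 1 ≤ d) : 0 < simplexDiam K := by
  have : 1 < K.card := by rw [hK.card_eq]; omega
  obtain ⟨a, ha, b, hb, hab⟩ := Finset.one_lt_card.1 this
  exact (dist_pos.2 hab).trans_le
    (dist_le_simplexDiam (vertex_mem_closedSimplex ha) (vertex_mem_closedSimplex hb))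

end IsSimplex

end Simplex

/-! ### The `L²` norm -/

section L2

variable {X F : Type*} [MeasurableSpace X] [NormedAddCommGroup F] {ν : Measure X}

lemma l2Norm_nonneg (v : X → F) : 0 ≤ l2Norm ν v := ENNReal.toReal_nonneg

lemma l2Norm_eq_norm_toLp {v : X → F} (hv : MemLp v 2 ν) : l2Norm ν v = ‖hv.toLp v‖ :=
  (Lp.norm_toLp v hv).symm

lemma l2Norm_norm (v : X → F) : l2Norm ν (fun x => ‖v x‖) = l2Norm ν v := by
  rw [l2Norm, l2Norm, eLpNorm_norm]

lemma l2Norm_congr {v w : X → F} (h : v =ᵐ[ν] w) : l2Norm ν v = l2Norm ν w := by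
  rw [l2Norm, l2Norm, eLpNorm_congr_ae h]

lemma l2Norm_sub_comm (v w : X → F) :
    l2Norm ν (fun x => v x - w x) = l2Norm ν (fun x => w x - v x) := by
  rw [← l2Norm_norm, ← l2Norm_norm (fun x => w x - v x)]
  simp only [norm_sub_rev]

lemma l2Norm_sq {v : X → F} (hv : MemLp v 2 ν) : l2Norm ν v ^ 2 = ∫ x, ‖v x‖ ^ 2 ∂ν := by
  have h1 := hv.norm
  rw [← l2Norm_norm, l2Norm_eq_norm_toLp h1, ← real_inner_self_eq_norm_sq, L2.inner_def]
  refine integral_congr_ae ?_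
  filter_upwards [h1.coeFn_toLp] with x hx
  rw [hx]; simp [pow_two]

lemma l2Norm_sq_real {v : X → ℝ} (hv : MemLp v 2 ν) : l2Norm ν v ^ 2 = ∫ x, v x ^ 2 ∂ν := by
  rw [l2Norm_sq hv]; simp

lemma integrable_mul_of_memLp {f g : X → ℝ} (hf : MemLp f 2 ν) (hg : MemLp g 2 ν) :
    Integrable (fun x => f x * g x) ν := hf.integrable_mul hg

lemma integral_mul_eq_inner {f g : X → ℝ} (hf : MemLp f 2 ν) (hg : MemLp g 2 ν) :
    ∫ x, f x * g x ∂ν = inner ℝ (hf.toLp f) (hg.toLp g) := by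
  rw [L2.inner_def]
  refine integral_congr_ae ?_
  filter_upwards [hf.coeFn_toLp, hg.coeFn_toLp] with x hx hx'
  rw [hx, hx']; simp [mul_comm]

lemma abs_integral_mul_le {f g : X → ℝ} (hf : MemLp f 2 ν) (hg : MemLp g 2 ν) :
    |∫ x, f x * g x ∂ν| ≤ l2Norm ν f * l2Norm ν g := by
  rw [integral_mul_eq_inner hf hg, l2Norm_eq_norm_toLp hf, l2Norm_eq_norm_toLp hg]
  exact abs_real_inner_le_norm _ _

lemma integral_norm_mul_norm_le {F' : Type*} [NormedAddCommGroup F'] {f : X → F} {g : X → F'}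
    (hf : MemLp f 2 ν) (hg : MemLp g 2 ν) :
    ∫ x, ‖f x‖ * ‖g x‖ ∂ν ≤ l2Norm ν f * l2Norm ν g := by
  rw [← l2Norm_norm f, ← l2Norm_norm g]
  exact (le_abs_self _).trans (abs_integral_mul_le hf.norm hg.norm)

lemma l2Norm_add_le {v w : X → F} (hv : MemLp v 2 ν) (hw : MemLp w 2 ν) :
    l2Norm ν (fun x => v x + w x) ≤ l2Norm ν v + l2Norm ν w := by
  have := norm_add_le (hv.toLp v) (hw.toLp w)
  rw [← MemLp.toLp_add, ← l2Norm_eq_norm_toLp, ← l2Norm_eq_norm_toLp, ← l2Norm_eq_norm_toLp] at this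
  exact this

lemma abs_l2Norm_sub_le {v w : X → F} (hv : MemLp v 2 ν) (hw : MemLp w 2 ν) :
    |l2Norm ν v - l2Norm ν w| ≤ l2Norm ν (fun x => v x - w x) := by
  have := abs_norm_sub_norm_le (hv.toLp v) (hw.toLp w)
  rw [← MemLp.toLp_sub, ← l2Norm_eq_norm_toLp, ← l2Norm_eq_norm_toLp, ← l2Norm_eq_norm_toLp] at this
  exact this

/-- Convergence in `L²`, as convergence of the real-valued norms. -/
lemma tendsto_l2Norm_of_eLpNorm {φ : ℕ → X → F} {v : X → F}
    (h : Tendsto (fun n => eLpNorm (fun x => φ n x - v x) 2 ν) atTop (𝓝 0)) :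
    Tendsto (fun n => l2Norm ν (fun x => φ n x - v x)) atTop (𝓝 0) := by
  have := (ENNReal.tendsto_toReal ENNReal.zero_ne_top).comp h
  exact this

lemma tendsto_l2Norm {φ : ℕ → X → F} {v : X → F} (hφ : ∀ n, MemLp (φ n) 2 ν) (hv : MemLp v 2 ν)
    (h : Tendsto (fun n => l2Norm ν (fun x => φ n x - v x)) atTop (𝓝 0)) :
    Tendsto (fun n => l2Norm ν (φ n)) atTop (𝓝 (l2Norm ν v)) := by
  rw [tendsto_iff_dist_tendsto_zero]
  refine squeeze_zero (fun _ => dist_nonneg) (fun n => ?_) h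
  rw [Real.dist_eq]
  exact abs_l2Norm_sub_le (hφ n) hv

lemma tendsto_integral_mul {φ : ℕ → X → ℝ} {v q : X → ℝ} (hφ : ∀ n, MemLp (φ n) 2 ν)
    (hv : MemLp v 2 ν) (hq : MemLp q 2 ν)
    (h : Tendsto (fun n => l2Norm ν (fun x => φ n x - v x)) atTop (𝓝 0)) :
    Tendsto (fun n => ∫ x, φ n x * q x ∂ν) atTop (𝓝 (∫ x, v x * q x ∂ν)) := by
  rw [tendsto_iff_dist_tendsto_zero]
  have h2 : Tendsto (fun n => l2Norm ν (fun x => φ n x - v x) * l2Norm ν q) atTop (𝓝 0) := by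
    simpa using h.mul_const (l2Norm ν q)
  refine squeeze_zero (fun _ => dist_nonneg) (fun n => ?_) h2
  rw [Real.dist_eq, ← integral_sub (integrable_mul_of_memLp (hφ n) hq)
    (integrable_mul_of_memLp hv hq)]
  have := abs_integral_mul_le ((hφ n).sub hv) hq
  simp only [Pi.sub_apply, sub_mul] at this
  exact this

lemma l2Norm_comp_le {F' : Type*} [NormedAddCommGroup F'] {f : X → F} {g : X → F'}
    (hg : MemLp g 2 ν) (h : ∀ᵐ x ∂ν, ‖f x‖ ≤ ‖g x‖) : l2Norm ν f ≤ l2Norm ν g :=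
  ENNReal.toReal_mono hg.eLpNorm_ne_top (eLpNorm_mono_ae h)

end L2

/-! ### Integration over a simplex as a cone over one of its faces -/

section Cone

variable {d : ℕ} {K : Finset (Vec d)}

namespace IsSimplex

lemma coord_homothety (hK : IsSimplex K) (a b : K) (t : ℝ) (y : Vec d) :
    hK.coord b (AffineMap.homothety (a : Vec d) t y) =
      (1 - t) * hK.coord b a + t * hK.coord b y := by
  rw [AffineMap.homothety_eq_lineMap, AffineMap.apply_lineMap, AffineMap.lineMap_apply_ring']
  ring

lemma coord_le_one (hK : IsSimplex K) (a : K) {x : Vec d} (hx : x ∈ closedSimplex K) :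
    hK.coord a x ≤ 1 := by
  rw [← hK.sum_coord x]
  exact Finset.single_le_sum (f := fun b => hK.coord b x)
    (fun b _ => hK.mem_closedSimplex.1 hx b) (Finset.mem_univ a)

/-- The simplex is a cone with apex `a`: dilating by `t⁻¹` about `a` carries a slice back to the
face. -/
lemma homothety_image_face (hK : IsSimplex K) (a : K) {t : ℝ} (h0 : 0 < t) (h1 : t ≤ 1) :
    AffineMap.homothety (a : Vec d) t '' closedSimplex (K.erase a) =
      closedSimplex K ∩ {y | hK.coord a y = 1 - t} := by
  ext x
  constructor
  · rintro ⟨y, hy, rfl⟩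
    obtain ⟨hyK, hya⟩ := hK.mem_face.1 hy
    refine ⟨hK.mem_closedSimplex.2 fun b => ?_, ?_⟩
    · rw [coord_homothety]
      have := hK.mem_closedSimplex.1 hyK b
      have := hK.mem_closedSimplex.1 (vertex_mem_closedSimplex a.2) b
      have : 0 ≤ 1 - t := by linarith
      positivity
    · simp [coord_homothety, hya]
  · rintro ⟨hx, hxa⟩
    simp only [Set.mem_ofPred_eq] at hxa
    refine ⟨AffineMap.homothety (a : Vec d) t⁻¹ x, hK.mem_face.2 ?_, ?_⟩
    · have ha : hK.coord a (AffineMap.homothety (a : Vec d) t⁻¹ x) = 0 := by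
        rw [coord_homothety, hxa, hK.coord_self]; field_simp; ring
      refine ⟨hK.mem_closedSimplex.2 fun b => ?_, ha⟩
      by_cases hb : b = a
      · rw [hb, ha]
      · rw [coord_homothety, hK.coord_ne hb]
        have := hK.mem_closedSimplex.1 hx b
        rw [mul_zero, zero_add]
        positivity
    · rw [← AffineMap.homothety_mul_apply, mul_inv_cancel₀ h0.ne']; simp

/-- The hyperplanes of the slicing formula, orthogonal to the normal, are level sets of the
coordinate of `a`; the offset vector has the length of the height, so the parameter is exactly `1 -
hK.coord a y`. -/
lemma mem_slice_iff (hK : IsSimplex K) (hd : 1 ≤ d) (a : K) (t : ℝ) (y : Vec d) :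
    y ∈ AffineSubspace.mk' (t • (hK.height a • outerNormal K (K.erase a)) +ᵥ (a : Vec d))
      (Submodule.span ℝ {hK.height a • outerNormal K (K.erase a)})ᗮ ↔ hK.coord a y = 1 - t := by
  have hpos := hK.height_pos hd a
  rw [AffineSubspace.mem_mk', Submodule.mem_orthogonal_singleton_iff_inner_right]
  have e : y -ᵥ (t • (hK.height a • outerNormal K (K.erase a)) +ᵥ (a : Vec d)) =
      (y - a) - (t * hK.height a) • outerNormal K (K.erase a) := by
    rw [vsub_eq_sub, vadd_eq_add, smul_smul]; abel
  rw [e, inner_smul_left, inner_sub_right, hK.inner_outerNormal hd, inner_smul_right,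
    real_inner_self_eq_norm_sq, hK.norm_outerNormal hd]
  simp only [conj_trivial]
  constructor
  · intro h
    have h2 : hK.height a * hK.height a * (1 - hK.coord a y - t) = 0 := by linarith
    rcases mul_eq_zero.1 h2 with h3 | h3
    · exact absurd h3 (by positivity)
    · linarith
  · intro h; rw [h]; ring

/-- Slicing parallel to the face opposite to `a`: the slice at parameter `t` is the face dilated by
`t`, and its surface measure scales by `t ^ (d - 1)`. The factor `hK.height a` is the length of the
slicing vector. -/
theorem volume_inter_eq_lintegral (hK : IsSimplex K) (hd : 1 ≤ d) (a : K) {B : Set (Vec d)}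
    (hB : MeasurableSet B) :
    volume (closedSimplex K ∩ B) = ∫⁻ t in Set.Ioo (0 : ℝ) 1,
      ENNReal.ofReal (hK.height a * t ^ (d - 1)) *
        Mesh.faceMeasure (K.erase a) (AffineMap.homothety (a : Vec d) t ⁻¹' B) := by
  have hpos := hK.height_pos hd a
  set v := hK.height a • outerNormal K (K.erase a) with hv
  have hnv : ‖v‖ = hK.height a := by
    rw [hv, norm_smul, hK.norm_outerNormal hd, mul_one, Real.norm_of_nonneg hpos.le]
  have hv0 : v ≠ 0 := by rw [← norm_pos_iff, hnv]; exact hpos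
  have hmeas : MeasurableSet (closedSimplex K ∩ B) :=
    (isCompact_closedSimplex K).measurableSet.inter hB
  have key := EuclideanGeometry.euclideanHausdorffMeasure_eq_lintegral (a : Vec d) hv0 hmeas
  rw [InnerProductSpace.euclideanHausdorffMeasure_eq_volume] at key
  rw [key, finrank_euclideanSpace, Fintype.card_fin]
  have hslice : ∀ t : ℝ, closedSimplex K ∩ B ∩
      (AffineSubspace.mk' (t • v +ᵥ (a : Vec d)) (Submodule.span ℝ {v})ᗮ : Set (Vec d)) =
      closedSimplex K ∩ B ∩ {y | hK.coord a y = 1 - t} := by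
    intro t; ext y
    exact and_congr_right fun _ => hK.mem_slice_iff hd a t y
  have hout : ∀ t ∉ Set.Icc (0 : ℝ) 1,
      closedSimplex K ∩ B ∩ {y | hK.coord a y = 1 - t} = ∅ := by
    intro t ht
    ext y
    simp only [Set.mem_inter_iff, Set.mem_ofPred_eq, Set.mem_empty_iff_false, iff_false]
    rintro ⟨⟨hy, -⟩, h⟩
    refine ht ⟨?_, ?_⟩
    · linarith [hK.coord_le_one a hy]
    · linarith [hK.mem_closedSimplex.1 hy a]
  have hind : (fun t : ℝ => μHE[d - 1] (closedSimplex K ∩ B ∩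
      (AffineSubspace.mk' (t • v +ᵥ (a : Vec d)) (Submodule.span ℝ {v})ᗮ : Set (Vec d)))) =
      Set.indicator (Set.Icc 0 1)
        (fun t => μHE[d - 1] (closedSimplex K ∩ B ∩ {y | hK.coord a y = 1 - t})) := by
    ext t
    rw [hslice]
    by_cases ht : t ∈ Set.Icc (0 : ℝ) 1
    · rw [Set.indicator_of_mem ht]
    · rw [Set.indicator_of_notMem ht, hout t ht, measure_empty]
  -- The endpoints are dropped, being null, because the homothety can be inverted only for `t ≠ 0`.
  rw [hind, lintegral_indicator measurableSet_Icc, ← restrict_Ioo_eq_restrict_Icc,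
    ← lintegral_const_mul' _ _ enorm_ne_top]
  refine setLIntegral_congr_fun measurableSet_Ioo fun t ht => ?_
  have himg : closedSimplex K ∩ B ∩ {y | hK.coord a y = 1 - t} =
      AffineMap.homothety (a : Vec d) t ''
        (AffineMap.homothety (a : Vec d) t ⁻¹' B ∩ closedSimplex (K.erase a)) := by
    rw [Set.inter_comm (_ ⁻¹' B), Set.image_inter_preimage, hK.homothety_image_face a ht.1 ht.2.le]
    ext y; simp only [Set.mem_inter_iff]; tauto
  have hcont : Measurable (AffineMap.homothety (a : Vec d) t) :=
    (AffineMap.homothety_continuous (a : Vec d) t).measurable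
  simp only
  rw [himg, euclideanHausdorffMeasure_homothety_image _ _ ht.1.ne', Mesh.faceMeasure,
    Measure.restrict_apply (hcont hB), ← ofReal_norm, hnv, ENNReal.ofReal_mul hpos.le,
    mul_assoc]
  congr 2
  ext
  have := ht.1.le
  rw [Real.coe_toNNReal _ (by positivity)]
  simp [abs_of_nonneg this]

/-- A face of infinite measure would, by the cone formula, give the compact simplex infinite volume.
-/
lemma isFiniteMeasure_faceMeasure (hK : IsSimplex K) (hd : 1 ≤ d) (a : K) :
    IsFiniteMeasure (Mesh.faceMeasure (K.erase (a : Vec d))) := by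
  refine ⟨lt_top_iff_ne_top.2 fun htop => ?_⟩
  have h := hK.volume_inter_eq_lintegral hd a MeasurableSet.univ
  have hfin : volume (closedSimplex K ∩ Set.univ) < ⊤ := by
    rw [Set.inter_univ]; exact (isCompact_closedSimplex K).measure_lt_top
  have : ∫⁻ t in Set.Ioo (0 : ℝ) 1, ENNReal.ofReal (hK.height a * t ^ (d - 1)) *
        Mesh.faceMeasure (K.erase a) (AffineMap.homothety (a : Vec d) t ⁻¹' Set.univ) = ⊤ := by
    have : ∀ t ∈ Set.Ioo (0 : ℝ) 1, ENNReal.ofReal (hK.height a * t ^ (d - 1)) *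
        Mesh.faceMeasure (K.erase a) (AffineMap.homothety (a : Vec d) t ⁻¹' Set.univ) = ⊤ := by
      intro t ht
      rw [Set.preimage_univ, htop, ENNReal.mul_top]
      have := hK.height_pos hd a
      have := ht.1
      simp only [ne_eq, ENNReal.ofReal_eq_zero, not_le]
      positivity
    rw [setLIntegral_congr_fun measurableSet_Ioo this]
    simp
  rw [h, this] at hfin
  exact lt_irrefl _ hfin

/-- The hyperplane passes through `a`, so it is invariant under homotheties about `a`. Its null
volume in the simplex then factors as a positive integral in `t` times the measure of its part of
the face, and the latter must vanish. -/
lemma face_ae_notMem_hyperplane (hK : IsSimplex K) (hd : 1 ≤ d) (a b : K) (hab : b ≠ a) :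
    ∀ᵐ x ∂(Mesh.faceMeasure (K.erase (a : Vec d))), hK.coord b x ≠ 0 := by
  have hB : IsClosed {x | hK.coord b x = 0} :=
    isClosed_eq (hK.continuous_coord b) continuous_const
  have hnull : volume {x | hK.coord b x = 0} = 0 := by
    let s : AffineSubspace ℝ (Vec d) := (AffineSubspace.mk' (0 : ℝ) ⊥).comap (hK.coord b)
    have hs : (s : Set (Vec d)) = {x | hK.coord b x = 0} := by
      ext x; simp [s, AffineSubspace.mem_mk']
    rw [← hs]
    refine Measure.addHaar_affineSubspace _ _ fun htop => ?_
    have : (b : Vec d) ∈ s := by rw [htop]; trivial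
    have : (b : Vec d) ∈ (s : Set (Vec d)) := this
    rw [hs] at this
    simp at this
  have h := hK.volume_inter_eq_lintegral hd a hB.measurableSet
  rw [measure_mono_null Set.inter_subset_right hnull] at h
  have hpre : ∀ t ∈ Set.Ioo (0 : ℝ) 1, ENNReal.ofReal (hK.height a * t ^ (d - 1)) *
      Mesh.faceMeasure (K.erase a) (AffineMap.homothety (a : Vec d) t ⁻¹' {x | hK.coord b x = 0}) =
      ENNReal.ofReal (hK.height a * t ^ (d - 1)) *
        Mesh.faceMeasure (K.erase a) {x | hK.coord b x = 0} := by
    intro t ht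
    congr 2
    ext x
    simp [coord_homothety, hK.coord_ne hab, ht.1.ne']
  rw [setLIntegral_congr_fun measurableSet_Ioo hpre, lintegral_mul_const _ (by fun_prop)] at h
  rcases mul_eq_zero.1 h.symm with h | h
  · exfalso
    rw [lintegral_eq_zero_iff (by fun_prop)] at h
    have h2 : ∀ᵐ t ∂(volume.restrict (Set.Ioo (0 : ℝ) 1)), False := by
      filter_upwards [h, ae_restrict_mem measurableSet_Ioo] with t ht ht'
      have := hK.height_pos hd a
      have := ht'.1
      simp only [Pi.zero_apply, ENNReal.ofReal_eq_zero] at ht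
      have : 0 < hK.height a * t ^ (d - 1) := by positivity
      linarith
    rw [ae_iff] at h2
    simp at h2
  · rw [ae_iff]; simpa using h

/-- The density of the cone coordinate. -/
def coneMeasure (hK : IsSimplex K) (a : K) : Measure ℝ :=
  (volume.restrict (Set.Ioo (0 : ℝ) 1)).withDensity
    fun t => ENNReal.ofReal (hK.height a * t ^ (d - 1))

lemma continuous_homothety_prod (a : Vec d) :
    Continuous fun p : ℝ × Vec d => AffineMap.homothety a p.1 p.2 := by
  simp only [AffineMap.homothety_apply, vsub_eq_sub, vadd_eq_add]
  fun_prop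

/-- The cone formula as a change of variables for measures, so that Fubini applies. -/
theorem restrict_eq_map_cone (hK : IsSimplex K) (hd : 1 ≤ d) (a : K) :
    (volume : Measure (Vec d)).restrict (closedSimplex K) =
      ((hK.coneMeasure a).prod (Mesh.faceMeasure (K.erase a))).map
        fun p : ℝ × Vec d => AffineMap.homothety (a : Vec d) p.1 p.2 := by
  have := hK.isFiniteMeasure_faceMeasure hd a
  have hm := (continuous_homothety_prod (a : Vec d)).measurable
  ext B hB
  rw [Measure.restrict_apply hB, Set.inter_comm, hK.volume_inter_eq_lintegral hd a hB,
    Measure.map_apply hm hB, Measure.prod_apply (hm hB), coneMeasure,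
    lintegral_withDensity_eq_lintegral_mul _ (by fun_prop)
      (measurable_measure_prodMk_left (hm hB))]
  rfl

theorem integral_eq_cone (hK : IsSimplex K) (hd : 1 ≤ d) (a : K) {g : Vec d → ℝ}
    (hg : Continuous g) :
    ∫ x in closedSimplex K, g x = ∫ y, (∫ t in (0 : ℝ)..1, hK.height a * t ^ (d - 1) *
      g (AffineMap.homothety (a : Vec d) t y)) ∂(Mesh.faceMeasure (K.erase a)) := by
  have := hK.isFiniteMeasure_faceMeasure hd a
  have hm := (continuous_homothety_prod (a : Vec d)).measurable
  have hint : Integrable g (volume.restrict (closedSimplex K)) :=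
    hg.continuousOn.integrableOn_compact (isCompact_closedSimplex K)
  have : SFinite (hK.coneMeasure a) := by unfold coneMeasure; infer_instance
  rw [hK.restrict_eq_map_cone hd a] at hint ⊢
  rw [integral_map hm.aemeasurable hg.aestronglyMeasurable, integral_prod_symm]
  · refine integral_congr_ae (Eventually.of_forall fun y => ?_)
    simp only
    rw [coneMeasure, integral_withDensity_eq_integral_toReal_smul (by fun_prop) (by simp),
      intervalIntegral.integral_of_le zero_le_one, integral_Ioc_eq_integral_Ioo]
    refine setIntegral_congr_fun measurableSet_Ioo fun t ht => ?_
    have := hK.height_pos hd a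
    have := ht.1
    simp only [smul_eq_mul]
    rw [ENNReal.toReal_ofReal (by positivity)]
  · exact (integrable_map_measure hg.aestronglyMeasurable hm.aemeasurable).1 hint

/-- The divergence theorem for the radial field `w(x) (x - a)`, which is tangential to all faces
but the one opposite to `a`. -/
theorem integral_radial (hK : IsSimplex K) (hd : 1 ≤ d) (a : K) {w : Vec d → ℝ}
    (hw : ContDiff ℝ 1 w) :
    ∫ x in closedSimplex K, (d * w x + inner ℝ (∇ w x) (x - a)) =
      hK.height a * ∫ y, w y ∂(Mesh.faceMeasure (K.erase a)) := by
  have hfd : Continuous (fderiv ℝ w) := hw.continuous_fderiv one_ne_zero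
  have hc : Continuous fun x => (d * w x + inner ℝ (∇ w x) (x - a)) := by
    simp only [inner_gradient_left]
    have := hw.continuous
    fun_prop
  rw [hK.integral_eq_cone hd a hc, ← integral_const_mul]
  refine integral_congr_ae (Eventually.of_forall fun y => ?_)
  simp only [inner_gradient_left]
  -- Along each ray the integrand, weight included, is the derivative of `t ^ d * w` times the
  -- height, so only the endpoint `t = 1` on the face contributes; at `t = 0` the factor `t ^ d`
  -- vanishes because `1 ≤ d`.
  have hder : ∀ t : ℝ, HasDerivAt
      (fun t : ℝ => hK.height a * (t ^ d * w (AffineMap.homothety (a : Vec d) t y)))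
      (hK.height a * t ^ (d - 1) * (d * w (AffineMap.homothety (a : Vec d) t y) +
        fderiv ℝ w (AffineMap.homothety (a : Vec d) t y)
          (AffineMap.homothety (a : Vec d) t y - a))) t := by
    intro t
    have h1 : HasDerivAt (fun t : ℝ => AffineMap.homothety (a : Vec d) t y) (y - a) t := by
      simp only [AffineMap.homothety_apply, vsub_eq_sub, vadd_eq_add]
      simpa using ((hasDerivAt_id t).smul_const (y - (a : Vec d))).add_const (a : Vec d)
    have h2 := ((hw.differentiable one_ne_zero) _).hasFDerivAt.comp_hasDerivAt t h1
    have h3 := ((hasDerivAt_pow d t).mul h2).const_mul (hK.height a)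
    convert! h3 using 1
    have e : AffineMap.homothety (a : Vec d) t y - a = t • (y - a) := by
      simp [AffineMap.homothety_apply]
    rw [e, map_smul, smul_eq_mul]
    have : t ^ d = t ^ (d - 1) * t := by rw [← pow_succ]; congr 1; omega
    simp only [Function.comp_apply]
    rw [this]; ring
  rw [intervalIntegral.integral_eq_sub_of_hasDerivAt (fun t _ => hder t)]
  · have : (0 : ℝ) ^ d = 0 := zero_pow (by omega)
    simp [this]
  · refine Continuous.intervalIntegrable ?_ _ _
    have hh : Continuous fun t : ℝ => AffineMap.homothety (a : Vec d) t y := by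
      simp only [AffineMap.homothety_apply, vsub_eq_sub, vadd_eq_add]
      fun_prop
    have := hw.continuous
    fun_prop

lemma sum_linear_coord (hK : IsSimplex K) (ξ : Vec d) : ∑ a, (hK.coord a).linear ξ = 0 := by
  have h (a : K) : (hK.coord a).linear ξ = hK.coord a ξ - hK.coord a 0 := by
    have := (hK.coord a).linearMap_vsub ξ 0
    simpa using this
  simp only [h, Finset.sum_sub_distrib, hK.sum_coord, sub_self]

/-- Together with `sum_linear_coord` this writes a constant field as `ξ = -∑ a, (hK.coord a).linear
ξ • (x - a)`, a combination of radial fields each of which has flux through one face only. -/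
lemma sum_linear_coord_smul (hK : IsSimplex K) (ξ : Vec d) :
    ∑ a : K, (hK.coord a).linear ξ • (a : Vec d) = ξ := by
  have h (a : K) : (hK.coord a).linear ξ = hK.coord a ξ - hK.coord a 0 := by
    have := (hK.coord a).linearMap_vsub ξ 0
    simpa using this
  simp only [h, sub_smul, Finset.sum_sub_distrib, hK.sum_coord_smul, sub_zero]

lemma inner_outerNormal_eq_linear (hK : IsSimplex K) (hd : 1 ≤ d) (a : K) (ξ : Vec d) :
    inner ℝ (outerNormal K (K.erase a)) ξ = -(hK.height a * (hK.coord a).linear ξ) := by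
  have h := hK.inner_outerNormal_sub hd a ξ 0
  have h2 := (hK.coord a).linearMap_vsub ξ 0
  simp only [vsub_eq_sub, sub_zero] at h h2
  rw [h, h2]; ring

/-- The divergence theorem on a simplex. -/
theorem integral_gradient (hK : IsSimplex K) (hd : 1 ≤ d) (ξ : Vec d) {w : Vec d → ℝ}
    (hw : ContDiff ℝ 1 w) :
    ∫ x in closedSimplex K, inner ℝ (∇ w x) ξ =
      ∑ a : K, inner ℝ (outerNormal K (K.erase a)) ξ *
        ∫ y, w y ∂(Mesh.faceMeasure (K.erase (a : Vec d))) := by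
  have hfd : Continuous (fderiv ℝ w) := hw.continuous_fderiv one_ne_zero
  have hwc := hw.continuous
  have h1 (a : K) : inner ℝ (outerNormal K (K.erase a)) ξ *
        ∫ y, w y ∂(Mesh.faceMeasure (K.erase (a : Vec d))) =
      ∫ x in closedSimplex K,
        -(hK.coord a).linear ξ * (d * w x + inner ℝ (∇ w x) (x - a)) := by
    rw [hK.inner_outerNormal_eq_linear hd, integral_const_mul, hK.integral_radial hd a hw]
    ring
  simp only [h1]
  rw [← integral_finsetSum]
  · refine integral_congr_ae (Eventually.of_forall fun x => ?_)
    simp only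
    -- The radial fields are recombined: the coefficients sum to zero, so the terms with `d * w x`
    -- and with `x` drop out.
    have e1 : ∑ a : K, -(hK.coord a).linear ξ * (d * w x + inner ℝ (∇ w x) (x - a)) =
        -(∑ a : K, (hK.coord a).linear ξ) * (d * w x + inner ℝ (∇ w x) x) +
          inner ℝ (∇ w x) (∑ a : K, (hK.coord a).linear ξ • (a : Vec d)) := by
      rw [inner_sum, ← Finset.sum_neg_distrib, Finset.sum_mul, ← Finset.sum_add_distrib]
      refine Finset.sum_congr rfl fun a _ => ?_
      rw [inner_sub_right, inner_smul_right]; ring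
    rw [e1, hK.sum_linear_coord, hK.sum_linear_coord_smul]
    ring
  · intro a _
    refine ContinuousOn.integrableOn_compact (isCompact_closedSimplex K)
      (Continuous.continuousOn ?_)
    simp only [inner_gradient_left]
    fun_prop

end IsSimplex

end Cone

/-! ### Smooth functions on a simplex: trace and Poincaré inequalities -/

section SmoothEstimates

variable {d : ℕ} {K : Finset (Vec d)}

lemma memLp_closedSimplex {F : Type*} [NormedAddCommGroup F] {g : Vec d → F}
    (K : Finset (Vec d)) (hg : Continuous g) :
    MemLp g 2 (volume.restrict (closedSimplex K)) := by
  have : IsFiniteMeasure ((volume : Measure (Vec d)).restrict (closedSimplex K)) :=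
    ⟨by rw [Measure.restrict_apply_univ]; exact (isCompact_closedSimplex K).measure_lt_top⟩
  obtain ⟨C, hC⟩ := (isCompact_closedSimplex K).exists_bound_of_continuousOn hg.continuousOn
  refine MemLp.of_bound
    (hg.continuousOn.aestronglyMeasurable_of_isCompact (isCompact_closedSimplex K)
      (isCompact_closedSimplex K).measurableSet) C ?_
  filter_upwards [ae_restrict_mem (isCompact_closedSimplex K).measurableSet] with x hx
  exact hC x hx

lemma memLp_openSimplex {F : Type*} [NormedAddCommGroup F] {g : Vec d → F}
    (K : Finset (Vec d)) (hg : Continuous g) :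
    MemLp g 2 (volume.restrict (openSimplex K)) := by
  rw [restrict_openSimplex]; exact memLp_closedSimplex K hg

lemma ae_mem_faceMeasure (F : Finset (Vec d)) :
    ∀ᵐ x ∂(Mesh.faceMeasure F), x ∈ closedSimplex F :=
  ae_restrict_mem (isCompact_closedSimplex F).measurableSet

lemma memLp_faceMeasure (hK : IsSimplex K) (hd : 1 ≤ d) (a : K) {F : Type*}
    [NormedAddCommGroup F] {g : Vec d → F} (hg : Continuous g) :
    MemLp g 2 (Mesh.faceMeasure (K.erase (a : Vec d))) := by
  have := hK.isFiniteMeasure_faceMeasure hd a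
  have hc := isCompact_closedSimplex (K.erase (a : Vec d))
  obtain ⟨C, hC⟩ := hc.exists_bound_of_continuousOn hg.continuousOn
  refine MemLp.of_bound (hg.continuousOn.aestronglyMeasurable_of_isCompact hc hc.measurableSet) C ?_
  filter_upwards [ae_mem_faceMeasure _] with x hx
  exact hC x hx

lemma continuous_gradient {w : Vec d → ℝ} (hw : ContDiff ℝ 1 w) : Continuous (∇ w) := by
  have h : Continuous (fderiv ℝ w) := hw.continuous_fderiv one_ne_zero
  exact (InnerProductSpace.toDual ℝ (Vec d)).symm.continuous.comp h

lemma inner_gradient_mul {w q : Vec d → ℝ} (hw : ContDiff ℝ 1 w) (hq : ContDiff ℝ 1 q)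
    (x v : Vec d) : inner ℝ (∇ (fun y => w y * q y) x) v =
      w x * inner ℝ (∇ q x) v + q x * inner ℝ (∇ w x) v := by
  simp only [inner_gradient_left]
  rw [fderiv_fun_mul (hw.differentiable one_ne_zero x) (hq.differentiable one_ne_zero x)]
  simp

namespace IsSimplex

/-- The trace inequality for smooth functions. -/
theorem trace_le_of_contDiff (hK : IsSimplex K) (hd : 1 ≤ d) (a : K) {w : Vec d → ℝ}
    (hw : ContDiff ℝ 1 w) :
    hK.height a * l2Norm (Mesh.faceMeasure (K.erase (a : Vec d))) w ^ 2 ≤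
      d * l2Norm (volume.restrict (openSimplex K)) w ^ 2 +
        2 * simplexDiam K * (l2Norm (volume.restrict (openSimplex K)) w *
          l2Norm (volume.restrict (openSimplex K)) (∇ w)) := by
  rw [restrict_openSimplex]
  set ν := (volume : Measure (Vec d)).restrict (closedSimplex K) with hν
  have hwL := memLp_closedSimplex K hw.continuous
  have hgL := memLp_closedSimplex K (continuous_gradient hw)
  -- The radial identity for `w²` has the squared face norm on the right; on the left `‖x - a‖` is
  -- at most the diameter.
  have h := hK.integral_radial hd a (hw.mul hw)
  rw [l2Norm_sq_real (memLp_faceMeasure hK hd a hw.continuous)]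
  simp only [pow_two]
  rw [← h]
  have hi1 : Integrable (fun x => w x * w x) ν := hwL.integrable_mul hwL
  have hi2 : Integrable (fun x => ‖w x‖ * ‖∇ w x‖) ν := hwL.norm.integrable_mul hgL.norm
  have hle : ∀ᵐ x ∂ν, (d * (w x * w x) + inner ℝ (∇ (fun y => w y * w y) x) (x - a)) ≤
      d * (w x * w x) + 2 * simplexDiam K * (‖w x‖ * ‖∇ w x‖) := by
    filter_upwards [ae_restrict_mem (isCompact_closedSimplex K).measurableSet] with x hx
    rw [inner_gradient_mul hw hw]
    have h1 : w x * inner ℝ (∇ w x) (x - a) ≤ ‖w x‖ * (‖∇ w x‖ * simplexDiam K) := by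
      refine (le_abs_self _).trans ?_
      rw [abs_mul]
      refine mul_le_mul le_rfl ((abs_real_inner_le_norm _ _).trans ?_) (abs_nonneg _) (abs_nonneg _)
      refine mul_le_mul_of_nonneg_left ?_ (norm_nonneg _)
      rw [← dist_eq_norm]
      exact dist_le_simplexDiam hx (vertex_mem_closedSimplex a.2)
    linarith
  have hint : Integrable (fun x => d * (w x * w x) + inner ℝ (∇ (fun y => w y * w y) x) (x - a))
      ν := by
    refine ContinuousOn.integrableOn_compact (isCompact_closedSimplex K)
      (Continuous.continuousOn ?_)
    have := continuous_gradient (hw.mul hw)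
    have := hw.continuous
    fun_prop
  refine (integral_mono_ae hint ((hi1.const_mul _).add (hi2.const_mul _)) hle).trans ?_
  have e : ∫ x, ((fun x => (d : ℝ) * (w x * w x)) + fun x => 2 * simplexDiam K * (‖w x‖ * ‖∇ w x‖)) x ∂ν =
      d * ∫ x, w x * w x ∂ν + 2 * simplexDiam K * ∫ x, ‖w x‖ * ‖∇ w x‖ ∂ν := by
    simp only [Pi.add_apply]
    rw [integral_add (hi1.const_mul _) (hi2.const_mul _), integral_const_mul, integral_const_mul]
  have e2 := l2Norm_sq_real hwL
  simp only [pow_two] at e2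
  rw [e, e2]
  have := integral_norm_mul_norm_le hwL hgL
  have : 0 ≤ simplexDiam K := Metric.diam_nonneg
  gcongr

end IsSimplex

/-- The variance of `g` over the unit interval is nonnegative. -/
lemma sq_integral_le {g : ℝ → ℝ} (hg : Continuous g) :
    (∫ t in (0 : ℝ)..1, g t) ^ 2 ≤ ∫ t in (0 : ℝ)..1, g t ^ 2 := by
  set m := ∫ t in (0 : ℝ)..1, g t with hm
  have h0 : 0 ≤ ∫ t in (0 : ℝ)..1, (g t - m) ^ 2 :=
    intervalIntegral.integral_nonneg zero_le_one fun t _ => sq_nonneg _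
  have e : ∫ t in (0 : ℝ)..1, (g t - m) ^ 2 = (∫ t in (0 : ℝ)..1, g t ^ 2) - 2 * m * m + m ^ 2 := by
    have : ∀ t, (g t - m) ^ 2 = (g t ^ 2 - 2 * m * g t) + m ^ 2 := fun t => by ring
    simp only [this]
    rw [intervalIntegral.integral_add, intervalIntegral.integral_sub,
      intervalIntegral.integral_const_mul, intervalIntegral.integral_const]
    · simp [← hm]
    all_goals exact Continuous.intervalIntegrable (by fun_prop) _ _
  nlinarith

lemma sq_sub_le_of_contDiff {w : Vec d → ℝ} (hw : ContDiff ℝ 1 w) (x y : Vec d) :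
    (w x - w y) ^ 2 ≤ dist x y ^ 2 * ∫ t in (0 : ℝ)..1, ‖∇ w (y + t • (x - y))‖ ^ 2 := by
  have hg := continuous_gradient hw
  have hder : ∀ t : ℝ, HasDerivAt (fun t : ℝ => w (y + t • (x - y)))
      (inner ℝ (∇ w (y + t • (x - y))) (x - y)) t := by
    intro t
    have h1 : HasDerivAt (fun t : ℝ => y + t • (x - y)) (x - y) t := by
      simpa using ((hasDerivAt_id t).smul_const (x - y)).const_add y
    have h2 := ((hw.differentiable one_ne_zero) _).hasFDerivAt.comp_hasDerivAt t h1
    rw [inner_gradient_left]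
    exact h2
  have hc : Continuous fun t : ℝ => inner ℝ (∇ w (y + t • (x - y))) (x - y) := by
    have : Continuous fun t : ℝ => ∇ w (y + t • (x - y)) := hg.comp (by fun_prop)
    fun_prop
  have hftc := intervalIntegral.integral_eq_sub_of_hasDerivAt (fun t _ => hder t)
    (hc.intervalIntegrable 0 1)
  have e : w x - w y = ∫ t in (0 : ℝ)..1, inner ℝ (∇ w (y + t • (x - y))) (x - y) := by
    rw [hftc]; simp
  rw [e]
  refine (sq_integral_le hc).trans ?_
  rw [← intervalIntegral.integral_const_mul]
  have hc2 : Continuous fun t : ℝ => ∇ w (y + t • (x - y)) := hg.comp (by fun_prop)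
  refine intervalIntegral.integral_mono_on zero_le_one
    (Continuous.intervalIntegrable (by fun_prop) _ _)
    (Continuous.intervalIntegrable (by fun_prop) _ _) fun t _ => ?_
  rw [dist_eq_norm, ← mul_pow, ← sq_abs]
  have := abs_real_inner_le_norm (∇ w (y + t • (x - y))) (x - y)
  rw [mul_comm] at this
  gcongr

lemma lintegral_comp_dilation {g : Vec d → ENNReal} (hg : Measurable g) {t : ℝ} (ht : 0 < t)
    (z : Vec d) :
    ∫⁻ x, g (t • x + z) = ENNReal.ofReal ((t ^ d)⁻¹) * ∫⁻ x, g x := by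
  have h1 : ∫⁻ x, g (t • x + z) = ∫⁻ x, g (x + z) ∂((volume : Measure (Vec d)).map (t • ·)) := by
    rw [lintegral_map (by fun_prop) (by fun_prop)]
  rw [h1, Measure.map_addHaar_smul _ ht.ne', lintegral_smul_measure, lintegral_add_right_eq_self]
  simp only [finrank_euclideanSpace, Fintype.card_fin, smul_eq_mul]
  rw [abs_of_pos (by positivity)]

lemma inv_pow_le_two_pow {t : ℝ} (ht : 1 / 2 ≤ t) : (t ^ d)⁻¹ ≤ 2 ^ d := by
  rw [← inv_pow]
  have : t⁻¹ ≤ 2 := by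
    rw [inv_le_comm₀ (by linarith) (by norm_num)]; linarith
  have : 0 ≤ t⁻¹ := inv_nonneg.2 (by linarith)
  gcongr

/-- By convexity, contracting towards a point of `s` keeps `s` inside itself; the Jacobian `t⁻ᵈ` is
at most `2 ^ d`. -/
lemma setLIntegral_dilation_le {s : Set (Vec d)} (hs : Convex ℝ s) (hm : MeasurableSet s)
    {g : Vec d → ENNReal} (hg : Measurable g) {t : ℝ} (ht : 1 / 2 ≤ t) (ht1 : t ≤ 1)
    {y : Vec d} (hy : y ∈ s) :
    ∫⁻ x in s, g (t • x + (1 - t) • y) ≤ ENNReal.ofReal (2 ^ d) * ∫⁻ x in s, g x := by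
  calc ∫⁻ x in s, g (t • x + (1 - t) • y)
      ≤ ∫⁻ x in s, s.indicator g (t • x + (1 - t) • y) := by
        refine setLIntegral_mono' hm fun x hx => ?_
        rw [Set.indicator_of_mem]
        exact hs hx hy (by linarith) (by linarith) (by ring)
    _ ≤ ∫⁻ x, s.indicator g (t • x + (1 - t) • y) := setLIntegral_le_lintegral _ _
    _ = ENNReal.ofReal ((t ^ d)⁻¹) * ∫⁻ x, s.indicator g x :=
        lintegral_comp_dilation (hg.indicator hm) (by linarith) _
    _ ≤ _ := by
        rw [lintegral_indicator hm]
        gcongr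
        exact inv_pow_le_two_pow ht

/-- For `t ≥ 1/2` the integration in `x` is done first, for `t ≤ 1/2` the one in `y`. The variable
in question then has coefficient at least `1/2`, and the Jacobian does not degenerate near either
end of the segment. -/
lemma lintegral_segment_le {s : Set (Vec d)} (hs : Convex ℝ s) (hm : MeasurableSet s)
    {g : Vec d → ENNReal} (hg : Measurable g) {t : ℝ} (ht : t ∈ Set.Icc (0 : ℝ) 1) :
    ∫⁻ x in s, ∫⁻ y in s, g (y + t • (x - y)) ≤
      ENNReal.ofReal (2 ^ d) * (∫⁻ x in s, g x) * volume s := by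
  have hmeas : Measurable fun p : Vec d × Vec d => g (p.2 + t • (p.1 - p.2)) :=
    hg.comp (by fun_prop)
  have hconst : ∀ f : Vec d → ENNReal,
      (∀ y ∈ s, f y ≤ ENNReal.ofReal (2 ^ d) * (∫⁻ x in s, g x)) →
      ∫⁻ y in s, f y ≤ ENNReal.ofReal (2 ^ d) * (∫⁻ x in s, g x) * volume s := by
    intro f hf
    refine (setLIntegral_mono' hm hf).trans ?_
    rw [setLIntegral_const]
  rcases le_total (1 / 2) t with h | h
  · rw [lintegral_lintegral_swap hmeas.aemeasurable]
    refine hconst _ fun y hy => ?_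
    have := setLIntegral_dilation_le hs hm hg h ht.2 hy
    have e : ∀ x, y + t • (x - y) = t • x + (1 - t) • y := fun x => by module
    simpa only [e] using this
  · refine hconst _ fun x hx => ?_
    have := setLIntegral_dilation_le hs hm hg (t := 1 - t) (by linarith) (by linarith [ht.1]) hx
    have e : ∀ y, y + t • (x - y) = (1 - t) • y + (1 - (1 - t)) • x := fun y => by module
    simpa only [e] using this

/-- The Poincaré inequality on a simplex for smooth functions, in the form of a variance bound. -/
theorem poincare_of_contDiff (K : Finset (Vec d)) {w : Vec d → ℝ} (hw : ContDiff ℝ 1 w) :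
    volume.real (openSimplex K) * l2Norm (volume.restrict (openSimplex K)) w ^ 2 -
        (∫ x in openSimplex K, w x) ^ 2 ≤
      2 ^ d * simplexDiam K ^ 2 * volume.real (openSimplex K) *
        l2Norm (volume.restrict (openSimplex K)) (∇ w) ^ 2 := by
  rw [measureReal_def, measure_congr (openSimplex_ae_eq K), ← measureReal_def,
    restrict_openSimplex]
  set s := closedSimplex K with hs
  have hsc : IsCompact s := isCompact_closedSimplex K
  have hconv : Convex ℝ s := convex_closedSimplex K
  have hwc := hw.continuous
  have hgc := continuous_gradient hw
  have : IsFiniteMeasure ((volume : Measure (Vec d)).restrict s) :=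
    ⟨by rw [Measure.restrict_apply_univ]; exact hsc.measure_lt_top⟩
  rw [l2Norm_sq_real (memLp_closedSimplex K hwc), l2Norm_sq (memLp_closedSimplex K hgc)]
  set ν := (volume : Measure (Vec d)).restrict s with hν
  have hint : ∀ g : Vec d → ℝ, Continuous g → Integrable g ν := fun g hg =>
    hg.continuousOn.integrableOn_compact hsc
  set V := volume.real s with hV
  have hVν : ν.real Set.univ = V := by rw [hν, measureReal_restrict_apply_univ]
  have hin : ∀ x, ∫ y, (w x - w y) ^ 2 ∂ν =
      (V * w x ^ 2 - 2 * (∫ y, w y ∂ν) * w x) + ∫ y, w y ^ 2 ∂ν := by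
    intro x
    have e : ∀ y, (w x - w y) ^ 2 = (w x ^ 2 - 2 * w x * w y) + w y ^ 2 := fun y => by ring
    simp only [e]
    rw [integral_add (hint _ (by fun_prop)) (hint _ (by fun_prop)),
      integral_sub (hint _ (by fun_prop)) (hint _ (by fun_prop)), integral_const_mul,
      integral_const, hVν, smul_eq_mul]
    ring
  -- The variance as a double integral of squared differences, which can be estimated along
  -- segments.
  have hdouble : ∫ x, ∫ y, (w x - w y) ^ 2 ∂ν ∂ν =
      2 * (V * (∫ y, w y ^ 2 ∂ν) - (∫ y, w y ∂ν) ^ 2) := by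
    simp only [hin]
    rw [integral_add (hint _ (by fun_prop)) (hint _ (by fun_prop)),
      integral_sub (hint _ (by fun_prop)) (hint _ (by fun_prop)), integral_const_mul,
      integral_const_mul, integral_const, hVν, smul_eq_mul]
    ring
  have hcx : Continuous fun x => ∫ y, (w x - w y) ^ 2 ∂ν := by simp only [hin]; fun_prop
  set D := simplexDiam K
  set g : Vec d → ENNReal := fun x => ENNReal.ofReal (‖∇ w x‖ ^ 2) with hg
  have hgm : Measurable g := by
    have := hgc.measurable
    fun_prop
  have hGint : Integrable (fun x => ‖∇ w x‖ ^ 2) ν := hint _ (by fun_prop)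
  have hpt : ∀ x ∈ s, ∀ y ∈ s, ENNReal.ofReal ((w x - w y) ^ 2) ≤
      ENNReal.ofReal (D ^ 2) * ∫⁻ t in Set.Ioc (0 : ℝ) 1, g (y + t • (x - y)) := by
    intro x hx y hy
    have hc2 : Continuous fun t : ℝ => ‖∇ w (y + t • (x - y))‖ ^ 2 := by
      have : Continuous fun t : ℝ => ∇ w (y + t • (x - y)) := hgc.comp (by fun_prop)
      fun_prop
    have h1 := sq_sub_le_of_contDiff hw x y
    have h2 : dist x y ≤ D := dist_le_simplexDiam hx hy
    rw [hg, ← ofReal_integral_eq_lintegral_ofReal, ← ENNReal.ofReal_mul (sq_nonneg _)]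
    · refine ENNReal.ofReal_le_ofReal (h1.trans ?_)
      rw [intervalIntegral.integral_of_le zero_le_one]
      have : 0 ≤ ∫ t in Set.Ioc (0 : ℝ) 1, ‖∇ w (y + t • (x - y))‖ ^ 2 :=
        integral_nonneg fun t => sq_nonneg _
      gcongr
    · exact (hc2.integrableOn_Icc).mono_set Set.Ioc_subset_Icc_self
    · exact Eventually.of_forall fun t => sq_nonneg _
  have hm3 : Measurable fun p : (Vec d × Vec d) × ℝ => g (p.1.2 + p.2 • (p.1.1 - p.1.2)) :=
    hgm.comp (by fun_prop)
  -- The estimate is carried out in `ENNReal`, where the exchanges of integrals need only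
  -- measurability.
  have hbound : ENNReal.ofReal (∫ x, ∫ y, (w x - w y) ^ 2 ∂ν ∂ν) ≤
      ENNReal.ofReal (D ^ 2 * (2 ^ d * (∫ x, ‖∇ w x‖ ^ 2 ∂ν) * V)) := by
    rw [ofReal_integral_eq_lintegral_ofReal (hint _ hcx)
      (Eventually.of_forall fun x => integral_nonneg fun y => sq_nonneg _)]
    calc ∫⁻ x, ENNReal.ofReal (∫ y, (w x - w y) ^ 2 ∂ν) ∂ν
        = ∫⁻ x, ∫⁻ y, ENNReal.ofReal ((w x - w y) ^ 2) ∂ν ∂ν := by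
          refine lintegral_congr fun x => ?_
          rw [ofReal_integral_eq_lintegral_ofReal (hint _ (by fun_prop))
            (Eventually.of_forall fun y => sq_nonneg _)]
      _ ≤ ∫⁻ x, ∫⁻ y, ENNReal.ofReal (D ^ 2) *
            (∫⁻ t in Set.Ioc (0 : ℝ) 1, g (y + t • (x - y))) ∂ν ∂ν := by
          refine setLIntegral_mono' hsc.measurableSet fun x hx => ?_
          exact setLIntegral_mono' hsc.measurableSet fun y hy => hpt x hx y hy
      _ = ENNReal.ofReal (D ^ 2) * ∫⁻ x, ∫⁻ y,
            (∫⁻ t in Set.Ioc (0 : ℝ) 1, g (y + t • (x - y))) ∂ν ∂ν := by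
          rw [← lintegral_const_mul' _ _ ENNReal.ofReal_ne_top]
          refine lintegral_congr fun x => ?_
          rw [lintegral_const_mul' _ _ ENNReal.ofReal_ne_top]
      _ = ENNReal.ofReal (D ^ 2) * ∫⁻ t in Set.Ioc (0 : ℝ) 1, ∫⁻ x, ∫⁻ y,
            g (y + t • (x - y)) ∂ν ∂ν := by
          congr 1
          have h1 : ∀ x, ∫⁻ y, (∫⁻ t in Set.Ioc (0 : ℝ) 1, g (y + t • (x - y))) ∂ν =
              ∫⁻ t in Set.Ioc (0 : ℝ) 1, ∫⁻ y, g (y + t • (x - y)) ∂ν := fun x =>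
            lintegral_lintegral_swap
              (hgm.comp (by fun_prop : Measurable fun p : Vec d × ℝ =>
                p.1 + p.2 • (x - p.1))).aemeasurable
          simp only [h1]
          refine lintegral_lintegral_swap (Measurable.aemeasurable ?_)
          have hm3' : Measurable fun q : (Vec d × ℝ) × Vec d =>
              g (q.2 + q.1.2 • (q.1.1 - q.2)) := hgm.comp (by fun_prop)
          exact hm3'.lintegral_prod_right'
      _ ≤ ENNReal.ofReal (D ^ 2) * ∫⁻ t in Set.Ioc (0 : ℝ) 1,
            ENNReal.ofReal (2 ^ d) * (∫⁻ x, g x ∂ν) * volume s := by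
          gcongr ENNReal.ofReal (D ^ 2) * ?_
          refine setLIntegral_mono' measurableSet_Ioc fun t ht => ?_
          exact lintegral_segment_le hconv hsc.measurableSet hgm ⟨ht.1.le, ht.2⟩
      _ = ENNReal.ofReal (D ^ 2 * (2 ^ d * (∫ x, ‖∇ w x‖ ^ 2 ∂ν) * V)) := by
          have hnn : 0 ≤ ∫ x, ‖∇ w x‖ ^ 2 ∂ν := integral_nonneg fun x => sq_nonneg _
          rw [setLIntegral_const, ENNReal.ofReal_mul (sq_nonneg _),
            ENNReal.ofReal_mul (by positivity), ENNReal.ofReal_mul (by positivity), hg,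
            ofReal_integral_eq_lintegral_ofReal hGint (Eventually.of_forall fun x => sq_nonneg _),
            hV, ofReal_measureReal hsc.measure_lt_top.ne]
          simp
  rw [hdouble] at hbound
  have hnn : 0 ≤ ∫ x, ‖∇ w x‖ ^ 2 ∂ν := integral_nonneg fun x => sq_nonneg _
  have hVnn : 0 ≤ V := measureReal_nonneg
  have hR : 0 ≤ D ^ 2 * (2 ^ d * (∫ x, ‖∇ w x‖ ^ 2 ∂ν) * V) := by positivity
  have := (ENNReal.ofReal_le_ofReal_iff hR).1 hbound
  nlinarith

end SmoothEstimates

/-! ### Approximation of weakly differentiable functions by smooth functions -/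

section Density

open ContinuousLinearMap

variable {d : ℕ}

lemma gradient_apply (φ : Vec d → ℝ) (x : Vec d) (i : Fin d) :
    (∇ φ x) i = fderiv ℝ φ x (EuclideanSpace.single i 1) := by
  rw [← inner_gradient_left, EuclideanSpace.inner_single_right]; simp

/-- A mollification of `v`, composed with a dilation with centre `c` and factor `s`. -/
def dilatedMollify (η : ContDiffBump (0 : Vec d)) (c : Vec d) (s : ℝ) (v : Vec d → ℝ)
    (x : Vec d) : ℝ :=
  (convolution (η.normed volume) v (lsmul ℝ ℝ) volume) (s • x + (1 - s) • c)

lemma contDiff_dilatedMollify (η : ContDiffBump (0 : Vec d)) (c : Vec d) (s : ℝ)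
    {v : Vec d → ℝ} (hv : LocallyIntegrable v) : ContDiff ℝ ∞ (dilatedMollify η c s v) := by
  have h : ContDiff ℝ ∞ (convolution (η.normed volume) v (lsmul ℝ ℝ) volume) :=
    η.hasCompactSupport_normed.contDiff_convolution_left _ (η.contDiff_normed (n := ⊤)) hv
  exact h.comp (by fun_prop)

lemma convolutionExistsAt_normed (η : ContDiffBump (0 : Vec d)) {v : Vec d → ℝ}
    (hv : LocallyIntegrable v) (x : Vec d) :
    ConvolutionExistsAt (η.normed volume) v x (lsmul ℝ ℝ) volume :=
  η.hasCompactSupport_normed.convolutionExists_left _ η.continuous_normed hv x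

lemma dilatedMollify_sub (η : ContDiffBump (0 : Vec d)) (c : Vec d) (s : ℝ) {v g : Vec d → ℝ}
    (hv : LocallyIntegrable v) (hg : LocallyIntegrable g) (x : Vec d) :
    dilatedMollify η c s (fun y => v y - g y) x =
      dilatedMollify η c s v x - dilatedMollify η c s g x := by
  simp only [dilatedMollify, convolution_def]
  rw [← integral_sub]
  · refine integral_congr_ae (Eventually.of_forall fun t => ?_)
    simp [mul_sub]
  · exact convolutionExistsAt_normed η hv _
  · exact convolutionExistsAt_normed η hg _

/-- Jensen's inequality for the probability density `η.normed volume`, obtained from Hölder by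
splitting the density as a product of two square roots. -/
lemma enorm_convolution_sq_le (η : ContDiffBump (0 : Vec d)) {v : Vec d → ℝ}
    (hv : Measurable v) (x : Vec d) :
    ‖convolution (η.normed volume) v (lsmul ℝ ℝ) volume x‖ₑ ^ 2 ≤
      ∫⁻ t, ENNReal.ofReal (η.normed volume t) * ‖v (x - t)‖ₑ ^ 2 := by
  set ρ : Vec d → ENNReal := fun t => ENNReal.ofReal (η.normed volume t) with hρ
  have hρm : Measurable ρ := by
    have := (η.continuous_normed (μ := volume)).measurable
    fun_prop
  have hρ1 : ∫⁻ t, ρ t = 1 := by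
    rw [hρ, ← ofReal_integral_eq_lintegral_ofReal η.integrable_normed
      (Eventually.of_forall fun t => η.nonneg_normed t), η.integral_normed]
    simp
  have hvm : Measurable fun t => ‖v (x - t)‖ₑ := by fun_prop
  have h1 : ‖convolution (η.normed volume) v (lsmul ℝ ℝ) volume x‖ₑ ≤
      ∫⁻ t, ρ t * ‖v (x - t)‖ₑ := by
    rw [convolution_def]
    refine (enorm_integral_le_lintegral_enorm _).trans (le_of_eq (lintegral_congr fun t => ?_))
    rw [lsmul_apply, smul_eq_mul, enorm_mul, Real.enorm_of_nonneg (η.nonneg_normed t)]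
  have h2 := ENNReal.lintegral_mul_le_Lp_mul_Lq volume Real.HolderConjugate.two_two
    (f := fun t => ρ t ^ (1 / 2 : ℝ)) (g := fun t => ρ t ^ (1 / 2 : ℝ) * ‖v (x - t)‖ₑ)
    (by fun_prop) (by fun_prop)
  have e1 : ∀ t, ((fun t => ρ t ^ (1 / 2 : ℝ)) * fun t => ρ t ^ (1 / 2 : ℝ) * ‖v (x - t)‖ₑ) t =
      ρ t * ‖v (x - t)‖ₑ := by
    intro t
    simp only [Pi.mul_apply]
    rw [← mul_assoc, ← ENNReal.rpow_add_of_nonneg _ _ (by norm_num) (by norm_num)]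
    norm_num
  have e2 : ∀ t, (ρ t ^ (1 / 2 : ℝ)) ^ (2 : ℝ) = ρ t := by
    intro t; rw [← ENNReal.rpow_mul]; norm_num
  have e3 : ∀ t, (ρ t ^ (1 / 2 : ℝ) * ‖v (x - t)‖ₑ) ^ (2 : ℝ) = ρ t * ‖v (x - t)‖ₑ ^ 2 := by
    intro t
    rw [ENNReal.mul_rpow_of_nonneg _ _ (by norm_num), e2]
    norm_num
  simp only [e1, e2, e3, hρ1, ENNReal.one_rpow, one_mul] at h2
  calc _ ≤ (∫⁻ t, ρ t * ‖v (x - t)‖ₑ) ^ 2 := by gcongr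
    _ ≤ ((∫⁻ t, ρ t * ‖v (x - t)‖ₑ ^ 2) ^ (1 / 2 : ℝ)) ^ 2 := by gcongr
    _ = _ := by
      rw [← ENNReal.rpow_natCast, ← ENNReal.rpow_mul]; norm_num; rfl

lemma eLpNorm_two_sq {F : Type*} [NormedAddCommGroup F] {X : Type*} [MeasurableSpace X]
    (ν : Measure X) (v : X → F) : eLpNorm v 2 ν ^ 2 = ∫⁻ x, ‖v x‖ₑ ^ 2 ∂ν := by
  have := eLpNorm_nnreal_pow_eq_lintegral (μ := ν) (f := v) (p := 2) (by norm_num)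
  simpa using this

/-- The bound is uniform in the bump and in `s ≥ 1/2`; this uniformity carries convergence from
continuous functions over to all of `L²`. -/
lemma eLpNorm_dilatedMollify_le (η : ContDiffBump (0 : Vec d)) (c : Vec d) {s : ℝ}
    (hs : 1 / 2 ≤ s) {v : Vec d → ℝ} (hv : Measurable v) :
    eLpNorm (dilatedMollify η c s v) 2 volume ≤ ENNReal.ofReal (2 ^ d) * eLpNorm v 2 volume := by
  have hρ1 : ∫⁻ t, ENNReal.ofReal (η.normed volume t) = 1 := by
    rw [← ofReal_integral_eq_lintegral_ofReal η.integrable_normed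
      (Eventually.of_forall fun t => η.nonneg_normed t), η.integral_normed]
    simp
  have hρm : Measurable (η.normed (volume : Measure (Vec d))) := η.continuous_normed.measurable
  have hsq : eLpNorm (dilatedMollify η c s v) 2 volume ^ 2 ≤
      ENNReal.ofReal (2 ^ d) * eLpNorm v 2 volume ^ 2 := by
    rw [eLpNorm_two_sq, eLpNorm_two_sq]
    calc ∫⁻ x, ‖dilatedMollify η c s v x‖ₑ ^ 2
        ≤ ∫⁻ x, ∫⁻ t, ENNReal.ofReal (η.normed volume t) *
            ‖v (s • x + (1 - s) • c - t)‖ₑ ^ 2 :=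
          lintegral_mono fun x => enorm_convolution_sq_le η hv _
      _ = ∫⁻ t, ∫⁻ x, ENNReal.ofReal (η.normed volume t) *
            ‖v (s • x + (1 - s) • c - t)‖ₑ ^ 2 := by
          refine lintegral_lintegral_swap (Measurable.aemeasurable ?_)
          have : Measurable fun p : Vec d × Vec d => v (s • p.1 + (1 - s) • c - p.2) :=
            hv.comp (by fun_prop)
          have : Measurable fun p : Vec d × Vec d => η.normed volume p.2 := hρm.comp measurable_snd
          fun_prop
      _ = ∫⁻ t, ENNReal.ofReal (η.normed volume t) *
            (ENNReal.ofReal ((s ^ d)⁻¹) * ∫⁻ x, ‖v x‖ₑ ^ 2) := by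
          refine lintegral_congr fun t => ?_
          rw [lintegral_const_mul' _ _ ENNReal.ofReal_ne_top]
          congr 1
          have := lintegral_comp_dilation (g := fun x => ‖v x‖ₑ ^ 2) (by fun_prop)
            (t := s) (by linarith) ((1 - s) • c - t)
          rw [← this]
          simp only [add_sub_assoc]
      _ = ENNReal.ofReal ((s ^ d)⁻¹) * ∫⁻ x, ‖v x‖ₑ ^ 2 := by
          rw [lintegral_mul_const _ (by fun_prop), hρ1, one_mul]
      _ ≤ _ := by
          gcongr
          exact inv_pow_le_two_pow hs
  -- The square root of `2 ^ d` is replaced by the larger `2 ^ d`, which avoids roots.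
  have hone : (1 : ENNReal) ≤ ENNReal.ofReal (2 ^ d) := by
    rw [← ENNReal.ofReal_one]
    exact ENNReal.ofReal_le_ofReal (one_le_pow₀ (by norm_num))
  refine (ENNReal.pow_le_pow_left_iff two_ne_zero).1 (hsq.trans ?_)
  rw [mul_pow]
  gcongr
  rw [pow_two]
  exact le_mul_of_one_le_left' hone

/-- Density argument: `v` is replaced by a continuous `g` with compact support, for which uniform
continuity gives uniform convergence; on the bounded set `U` this implies convergence in `L²`. -/
lemma tendsto_dilatedMollify {U : Set (Vec d)} (hU : MeasurableSet U)
    (hb : Bornology.IsBounded U) (c : Vec d) {η : ℕ → ContDiffBump (0 : Vec d)} {s : ℕ → ℝ}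
    (hη : Tendsto (fun n => (η n).rOut) atTop (𝓝 0)) (hs : Tendsto s atTop (𝓝 1))
    (hs2 : ∀ n, 1 / 2 ≤ s n) {v : Vec d → ℝ} (hvm : Measurable v)
    (hv : MemLp v 2 volume) :
    Tendsto (fun n => eLpNorm (fun x => dilatedMollify (η n) c (s n) v x - v x) 2
      (volume.restrict U)) atTop (𝓝 0) := by
  have hvl : LocallyIntegrable v := hv.locallyIntegrable (by norm_num)
  set M : ENNReal := volume.restrict U Set.univ ^ ((2 : ENNReal).toReal)⁻¹ with hM
  have hMtop : M ≠ ⊤ := by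
    rw [hM, Measure.restrict_apply_univ]
    exact ENNReal.rpow_ne_top_of_nonneg (by norm_num) hb.measure_lt_top.ne
  -- The three contributions come from smoothing `v - g` (factor `2 ^ d`), from `g` itself (`δ` for
  -- mollification and `δ` for dilation, times `M`), and from `g - v` (factor `1`).
  have main : ∀ δ : ℝ, 0 < δ → ∀ᶠ n in atTop,
      eLpNorm (fun x => dilatedMollify (η n) c (s n) v x - v x) 2 (volume.restrict U) ≤
        ENNReal.ofReal ((2 ^ d + M.toReal * 2 + 1) * δ) := by
    intro δ hδ
    obtain ⟨g, hgc, hvg, hg, hgL⟩ := hv.exists_hasCompactSupport_eLpNorm_sub_le (by norm_num)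
      (ε := ENNReal.ofReal δ) (by simpa using hδ)
    have hgl : LocallyIntegrable g := hg.locallyIntegrable
    have hgu := hgc.uniformContinuous_of_continuous hg
    obtain ⟨θ, hθ, hgθ⟩ := Metric.uniformContinuous_iff.1 hgu δ hδ
    obtain ⟨R, hR0, hR⟩ := hb.exists_pos_norm_le
    have hd1 : ∀ᶠ n in atTop, (η n).rOut < θ := hη.eventually (gt_mem_nhds hθ)
    have hd2 : ∀ᶠ n in atTop, |s n - 1| * (R + ‖c‖) < θ := by
      have : Tendsto (fun n => |s n - 1| * (R + ‖c‖)) atTop (𝓝 0) := by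
        have h := ((hs.sub_const 1).abs).mul_const (R + ‖c‖)
        simpa using h
      exact this.eventually (gt_mem_nhds hθ)
    filter_upwards [hd1, hd2] with n h1 h2
    set S := dilatedMollify (η n) c (s n) with hS
    have hcont : ∀ f : Vec d → ℝ, LocallyIntegrable f → Continuous (S f) := fun f hf =>
      (contDiff_dilatedMollify (η n) c (s n) hf).continuous
    have t1 : eLpNorm (fun x => S v x - S g x) 2 (volume.restrict U) ≤
        ENNReal.ofReal (2 ^ d) * ENNReal.ofReal δ := by
      have e : (fun x => S v x - S g x) = S (fun y => v y - g y) := by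
        ext x; exact (dilatedMollify_sub _ _ _ hvl hgl x).symm
      rw [e]
      refine (eLpNorm_mono_measure _ Measure.restrict_le_self).trans ?_
      refine (eLpNorm_dilatedMollify_le _ _ (hs2 n) (hvm.sub hg.measurable)).trans ?_
      gcongr
    have t2 : eLpNorm (fun x => S g x - g x) 2 (volume.restrict U) ≤
        M * ENNReal.ofReal (2 * δ) := by
      refine eLpNorm_le_of_ae_bound ?_
      filter_upwards [ae_restrict_mem hU] with x hx
      set x₀ := s n • x + (1 - s n) • c with hx₀
      have b1 : dist (S g x) (g x₀) ≤ δ :=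
        ContDiffBump.dist_normed_convolution_le hg.aestronglyMeasurable
          fun y hy => (hgθ ((Metric.mem_ball.1 hy).trans h1)).le
      have b2 : dist (g x₀) (g x) ≤ δ := by
        refine (hgθ (lt_of_le_of_lt ?_ h2)).le
        have e : x₀ - x = (s n - 1) • (x - c) := by rw [hx₀]; module
        rw [dist_eq_norm, e, norm_smul, Real.norm_eq_abs]
        gcongr
        exact (norm_sub_le _ _).trans (by gcongr; exact hR x hx)
      rw [← dist_eq_norm]
      linarith [dist_triangle (S g x) (g x₀) (g x)]
    have t3 : eLpNorm (fun x => g x - v x) 2 (volume.restrict U) ≤ ENNReal.ofReal δ := by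
      refine (eLpNorm_mono_measure _ Measure.restrict_le_self).trans ?_
      have := eLpNorm_sub_comm g v 2 (volume : Measure (Vec d))
      calc _ = eLpNorm (g - v) 2 volume := rfl
        _ ≤ _ := by rw [this]; exact hvg
    have e : (fun x => S v x - v x) =
        ((fun x => S v x - S g x) + fun x => S g x - g x) + fun x => g x - v x := by
      ext x; simp
    have hvs : AEStronglyMeasurable v (volume.restrict U) := hvm.aestronglyMeasurable
    have m1 : AEStronglyMeasurable (fun x => S v x - S g x) (volume.restrict U) :=
      ((hcont v hvl).sub (hcont g hgl)).aestronglyMeasurable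
    have m2 : AEStronglyMeasurable (fun x => S g x - g x) (volume.restrict U) :=
      ((hcont g hgl).sub hg).aestronglyMeasurable
    have m3 : AEStronglyMeasurable (fun x => g x - v x) (volume.restrict U) :=
      hg.aestronglyMeasurable.sub hvs
    rw [e]
    refine (eLpNorm_add_le (m1.add m2) m3 (by norm_num)).trans ?_
    refine (add_le_add ((eLpNorm_add_le m1 m2 (by norm_num)).trans (add_le_add t1 t2)) t3).trans ?_
    have hM' : M = ENNReal.ofReal M.toReal := (ENNReal.ofReal_toReal hMtop).symm
    have hMn : 0 ≤ M.toReal := ENNReal.toReal_nonneg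
    rw [hM', ← ENNReal.ofReal_mul (by positivity), ← ENNReal.ofReal_mul (by positivity),
      ← ENNReal.ofReal_add (by positivity) (by positivity),
      ← ENNReal.ofReal_add (by positivity) (by positivity), ← hM']
    refine ENNReal.ofReal_le_ofReal (le_of_eq ?_)
    ring
  rw [ENNReal.tendsto_nhds_zero]
  intro ε hε
  rcases eq_or_ne ε ⊤ with rfl | hεt
  · simp
  have hMn : 0 ≤ M.toReal := ENNReal.toReal_nonneg
  have hA : 0 < (2 : ℝ) ^ d + M.toReal * 2 + 1 := by positivity
  have hε' : 0 < ε.toReal := ENNReal.toReal_pos hε.ne' hεt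
  filter_upwards [main (ε.toReal / (2 ^ d + M.toReal * 2 + 1)) (by positivity)] with n hn
  refine hn.trans (le_of_eq ?_)
  rw [mul_div_cancel₀ _ hA.ne', ENNReal.ofReal_toReal hεt]

/-- Mollification commutes with weak differentiation away from the boundary. -/
lemma gradient_dilatedMollify {U : Set (Vec d)} (hU : IsOpen U) {w g w' g' : Vec d → ℝ}
    {i : Fin d} (hweak : HasWeakPartial U i w g)
    (hw' : w' =ᵐ[volume] U.indicator w) (hg' : g' =ᵐ[volume] U.indicator g)
    (hwl : LocallyIntegrable w') (η : ContDiffBump (0 : Vec d)) (c : Vec d) (s : ℝ) {x : Vec d}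
    (hx : Metric.closedBall (s • x + (1 - s) • c) η.rOut ⊆ U) :
    (∇ (dilatedMollify η c s w') x) i = s * dilatedMollify η c s g' x := by
  set x₀ := s • x + (1 - s) • c with hx₀
  set e : Vec d := EuclideanSpace.single i 1 with he
  set ρ := η.normed (volume : Measure (Vec d)) with hρ
  have hρc : ContDiff ℝ ∞ ρ := η.contDiff_normed (n := ⊤)
  have hρ1 : ContDiff ℝ 1 ρ := hρc.of_le (by norm_num)
  have hcs : HasCompactSupport ρ := η.hasCompactSupport_normed
  have hD := hcs.hasFDerivAt_convolution_left (lsmul ℝ ℝ) hρ1 hwl x₀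
  have hlin : HasFDerivAt (fun y : Vec d => s • y + (1 - s) • c)
      (s • ContinuousLinearMap.id ℝ (Vec d)) x :=
    ((hasFDerivAt_id x).const_smul s).add_const _
  have hcomp := HasFDerivAt.comp x hD hlin
  have hfd : fderiv ℝ (dilatedMollify η c s w') x =
      (convolution (fderiv ℝ ρ) w' (precompL (Vec d) (lsmul ℝ ℝ)) volume x₀).comp
        (s • ContinuousLinearMap.id ℝ (Vec d)) := hcomp.fderiv
  rw [gradient_apply, hfd]
  simp only [coe_comp, Function.comp_apply, smul_apply, coe_id', id_eq, map_smul, smul_eq_mul]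
  congr 1
  have hex : ConvolutionExistsAt (fderiv ℝ ρ) w' x₀ (precompL (Vec d) (lsmul ℝ ℝ)) volume :=
    (hcs.fderiv ℝ).convolutionExists_left _ (hρ1.continuous_fderiv one_ne_zero) hwl x₀
  have h1 : (convolution (fderiv ℝ ρ) w' (precompL (Vec d) (lsmul ℝ ℝ)) volume x₀) e =
      ∫ y, fderiv ℝ ρ (x₀ - y) e * w' y := by
    rw [convolution_def, ContinuousLinearMap.integral_apply hex]
    rw [← integral_sub_left_eq_self _ volume x₀]
    refine integral_congr_ae (Eventually.of_forall fun y => ?_)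
    simp
  have h2 : dilatedMollify η c s g' x = ∫ y, ρ (x₀ - y) * g' y := by
    rw [dilatedMollify, convolution_def, ← hx₀, ← integral_sub_left_eq_self _ volume x₀]
    refine integral_congr_ae (Eventually.of_forall fun y => ?_)
    simp [hρ]
  have hind : ∀ (F f f' : Vec d → ℝ), f' =ᵐ[volume] U.indicator f →
      ∫ y, F y * f' y = ∫ y in U, F y * f y := by
    intro F f f' hf
    rw [← integral_indicator hU.measurableSet]
    refine integral_congr_ae ?_
    filter_upwards [hf] with y hy
    rw [hy]
    by_cases hyU : y ∈ U <;> simp [hyU]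
  -- The reflected kernel is an admissible test function because the ball around `x₀` lies in `U`;
  -- the sign from the reflection cancels the sign in the weak derivative.
  have hψ : IsTest U fun y => ρ (x₀ - y) := by
    have hts : tsupport (fun y => ρ (x₀ - y)) ⊆ Metric.closedBall x₀ η.rOut := by
      refine closure_minimal ?_ Metric.isClosed_closedBall
      intro y hy
      have : x₀ - y ∈ Function.support ρ := hy
      rw [hρ, η.support_normed_eq] at this
      rw [Metric.mem_closedBall, dist_comm, dist_eq_norm]
      simpa using (mem_ball_zero_iff.1 this).le
    refine ⟨hρc.comp (by fun_prop), ?_, hts.trans hx⟩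
    exact HasCompactSupport.of_support_subset_isCompact (isCompact_closedBall x₀ η.rOut)
      (subset_closure.trans hts)
  have hw := hweak _ hψ
  have hgrad : ∀ y, (∇ (fun y => ρ (x₀ - y)) y) i = -fderiv ℝ ρ (x₀ - y) e := by
    intro y
    rw [gradient_apply]
    have hc : HasFDerivAt (fun y => ρ (x₀ - y))
        ((fderiv ℝ ρ (x₀ - y)).comp (-ContinuousLinearMap.id ℝ (Vec d))) y :=
      HasFDerivAt.comp y ((hρ1.differentiable one_ne_zero _).hasFDerivAt)
        ((hasFDerivAt_id y).const_sub x₀)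
    rw [hc.fderiv]
    simp [he]
  rw [h1, h2, hind _ _ _ hw', hind _ _ _ hg']
  simp only [hgrad, mul_neg, integral_neg, neg_inj] at hw
  simp only [mul_comm] at hw ⊢
  exact hw

lemma norm_le_sum_abs (v : Vec d) : ‖v‖ ≤ ∑ i, ‖v i‖ := by
  have h : v = ∑ i, v i • EuclideanSpace.single i (1 : ℝ) := by
    ext j; simp [Finset.sum_apply, Pi.single_apply]
  conv_lhs => rw [h]
  refine (norm_sum_le _ _).trans (le_of_eq (Finset.sum_congr rfl fun i _ => ?_))
  rw [norm_smul]; simp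

/-- Functions with a weak gradient in `L²` on a bounded convex open set are limits in `H¹` of
smooth functions. -/
theorem exists_contDiff_tendsto {U : Set (Vec d)} (hU : IsOpen U) (hconv : Convex ℝ U)
    (hb : Bornology.IsBounded U) (hne : U.Nonempty) {w : Vec d → ℝ} {G : Vec d → Vec d}
    (hw : MemLp w 2 (volume.restrict U)) (hG : MemLp G 2 (volume.restrict U))
    (hweak : ∀ i, HasWeakPartial U i w fun x => G x i) :
    ∃ φ : ℕ → Vec d → ℝ, (∀ n, ContDiff ℝ ∞ (φ n)) ∧
      Tendsto (fun n => eLpNorm (fun x => φ n x - w x) 2 (volume.restrict U)) atTop (𝓝 0) ∧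
      Tendsto (fun n => eLpNorm (fun x => ∇ (φ n) x - G x) 2 (volume.restrict U))
        atTop (𝓝 0) := by
  obtain ⟨c, hc⟩ := hne
  obtain ⟨r, hr, hball⟩ := Metric.isOpen_iff.1 hU c hc
  have hGi : ∀ i, MemLp (fun x => G x i) 2 (volume.restrict U) := fun i =>
    hG.mono ((EuclideanSpace.proj i).continuous.comp_aestronglyMeasurable hG.1)
      (Eventually.of_forall fun x => PiLp.norm_apply_le _ i)
  -- Extension by zero, with a measurable representative, so that the convolutions are defined on
  -- the whole space.
  have hext : ∀ f : Vec d → ℝ, MemLp f 2 (volume.restrict U) → ∃ f' : Vec d → ℝ,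
      Measurable f' ∧ MemLp f' 2 volume ∧ f' =ᵐ[volume] U.indicator f := by
    intro f hf
    have hf1 : MemLp (U.indicator f) 2 volume := (memLp_indicator_iff_restrict hU.measurableSet).2 hf
    exact ⟨hf1.1.mk _, hf1.1.stronglyMeasurable_mk.measurable,
      (memLp_congr_ae hf1.1.ae_eq_mk).1 hf1, hf1.1.ae_eq_mk.symm⟩
  obtain ⟨w', hw'm, hw'L, hw'⟩ := hext w hw
  choose g' hg'm hg'L hg' using fun i => hext _ (hGi i)
  have hcongr : ∀ {f f' : Vec d → ℝ}, f' =ᵐ[volume] U.indicator f →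
      f' =ᵐ[volume.restrict U] f := by
    intro f f' h
    filter_upwards [ae_restrict_of_ae h, ae_restrict_mem hU.measurableSet] with x hx hxU
    rw [hx, Set.indicator_of_mem hxU]
  set ε : ℕ → ℝ := fun n => 1 / ((n : ℝ) + 2) with hε
  have hε0 : ∀ n, 0 < ε n := fun n => by simp only [hε]; positivity
  have hε2 : ∀ n, ε n ≤ 1 / 2 := fun n => by
    simp only [hε]
    exact one_div_le_one_div_of_le (by norm_num) (by linarith [(Nat.cast_nonneg n : (0 : ℝ) ≤ n)])
  have hεt : Tendsto ε atTop (𝓝 0) := by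
    have h := (tendsto_one_div_add_atTop_nhds_zero_nat (𝕜 := ℝ)).comp (tendsto_add_atTop_nat 1)
    refine h.congr fun n => ?_
    simp only [hε, Function.comp_apply]; push_cast; ring_nf
  let η : ℕ → ContDiffBump (0 : Vec d) := fun n =>
    ⟨ε n * r / 4, ε n * r / 2, by have := hε0 n; positivity, by have := hε0 n; nlinarith [mul_pos this hr]⟩
  have hηt : Tendsto (fun n => (η n).rOut) atTop (𝓝 0) := by
    have : Tendsto (fun n => ε n * r / 2) atTop (𝓝 0) := by
      simpa using (hεt.mul_const r).div_const 2
    exact this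
  set s : ℕ → ℝ := fun n => 1 - ε n with hs
  have hst : Tendsto s atTop (𝓝 1) := by simpa using hεt.const_sub 1
  have hs2 : ∀ n, 1 / 2 ≤ s n := fun n => by simp only [hs]; linarith [hε2 n]
  -- Contraction towards `c` makes room for mollification: a point `y` of the small ball equals `s n
  -- • x + ε n • (c + (ε n)⁻¹ • e)`, a convex combination of `x` and a point of the ball around `c`
  -- contained in `U`.
  have hsub : ∀ n, ∀ x ∈ U, Metric.closedBall (s n • x + (1 - s n) • c) (η n).rOut ⊆ U := by
    intro n x hx y hy
    have hε0n := hε0 n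
    set e := y - (s n • x + (1 - s n) • c) with he
    have hen : ‖e‖ ≤ ε n * r / 2 := by rw [he, ← dist_eq_norm]; exact hy
    have hmem : c + (ε n)⁻¹ • e ∈ U := by
      refine hball ?_
      rw [Metric.mem_ball, dist_eq_norm, add_sub_cancel_left, norm_smul, norm_inv,
        Real.norm_of_nonneg hε0n.le, inv_mul_lt_iff₀ hε0n]
      nlinarith [mul_pos hε0n hr]
    have := hconv hx hmem (a := s n) (b := ε n) (by linarith [hs2 n]) hε0n.le (by simp [hs])
    have e2 : s n • x + ε n • (c + (ε n)⁻¹ • e) = y := by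
      rw [smul_add, smul_inv_smul₀ hε0n.ne', he]
      simp only [hs]; module
    rwa [e2] at this
  refine ⟨fun n => dilatedMollify (η n) c (s n) w', fun n => contDiff_dilatedMollify _ _ _
    (hw'L.locallyIntegrable (by norm_num)), ?_, ?_⟩
  · refine (tendsto_dilatedMollify hU.measurableSet hb c hηt hst hs2 hw'm hw'L).congr fun n => ?_
    refine eLpNorm_congr_ae ?_
    filter_upwards [hcongr hw'] with x hx
    rw [hx]
  · have hcomp : ∀ i, Tendsto (fun n => eLpNorm (fun x =>
        s n * dilatedMollify (η n) c (s n) (g' i) x - g' i x) 2 (volume.restrict U))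
        atTop (𝓝 0) := by
      intro i
      have hgl : LocallyIntegrable (g' i) := (hg'L i).locallyIntegrable (by norm_num)
      have h1 := tendsto_dilatedMollify hU.measurableSet hb c hηt hst hs2 (hg'm i) (hg'L i)
      have h2 : Tendsto (fun n => ENNReal.ofReal (ε n) * eLpNorm (g' i) 2 (volume.restrict U))
          atTop (𝓝 0) := by
        have hfin : eLpNorm (g' i) 2 (volume.restrict U) ≠ ⊤ :=
          ((hg'L i).restrict U).eLpNorm_ne_top
        have := ENNReal.Tendsto.mul_const (ENNReal.tendsto_ofReal hεt) (Or.inr hfin)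
        simpa using this
      refine tendsto_of_tendsto_of_tendsto_of_le_of_le tendsto_const_nhds (by simpa using h1.add h2)
        (fun n => zero_le) fun n => ?_
      -- The factor `s n` from the chain rule is harmless: the difference is `s n` times the
      -- mollification error minus `ε n • g' i`.
      have e : (fun x => s n * dilatedMollify (η n) c (s n) (g' i) x - g' i x) =
          (s n • fun x => dilatedMollify (η n) c (s n) (g' i) x - g' i x) +
            (-ε n) • g' i := by
        ext x; simp only [hs, Pi.add_apply, Pi.smul_apply, smul_eq_mul]; ring
      have m1 : AEStronglyMeasurable (fun x => dilatedMollify (η n) c (s n) (g' i) x - g' i x)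
          (volume.restrict U) :=
        (contDiff_dilatedMollify _ _ _ hgl).continuous.aestronglyMeasurable.sub
          (hg'm i).aestronglyMeasurable
      simp only
      rw [e]
      refine (eLpNorm_add_le (m1.const_smul _) ((hg'm i).aestronglyMeasurable.const_smul _)
        (by norm_num)).trans ?_
      rw [eLpNorm_const_smul, eLpNorm_const_smul, enorm_neg, Real.enorm_of_nonneg (hε0 n).le,
        Real.enorm_of_nonneg (by linarith [hs2 n])]
      gcongr
      refine mul_le_of_le_one_left' ?_
      rw [ENNReal.ofReal_le_one]
      simp only [hs]; linarith [hε0 n]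
    have hsum : Tendsto (fun n => ∑ i, eLpNorm (fun x =>
        s n * dilatedMollify (η n) c (s n) (g' i) x - g' i x) 2 (volume.restrict U))
        atTop (𝓝 0) := by
      have := tendsto_finsetSum Finset.univ fun i _ => hcomp i
      simpa using this
    refine tendsto_of_tendsto_of_tendsto_of_le_of_le tendsto_const_nhds hsum (fun n => zero_le)
      fun n => ?_
    have m : ∀ i, AEStronglyMeasurable (fun x =>
        s n * dilatedMollify (η n) c (s n) (g' i) x - g' i x) (volume.restrict U) := fun i =>
      (((contDiff_dilatedMollify _ _ _ ((hg'L i).locallyIntegrable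
        (by norm_num))).continuous.const_mul (s n)).aestronglyMeasurable).sub
          (hg'm i).aestronglyMeasurable
    have step : eLpNorm (fun x => ∇ (dilatedMollify (η n) c (s n) w') x - G x) 2
        (volume.restrict U) ≤ eLpNorm (∑ i, fun x =>
          ‖s n * dilatedMollify (η n) c (s n) (g' i) x - g' i x‖) 2 (volume.restrict U) := by
      refine eLpNorm_mono_ae_real ?_
      have hall : ∀ᵐ x ∂(volume.restrict U), ∀ i, g' i x = G x i :=
        ae_all_iff.2 fun i => hcongr (hg' i)
      filter_upwards [hall, ae_restrict_mem hU.measurableSet] with x hx hxU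
      refine (norm_le_sum_abs _).trans (le_of_eq ?_)
      rw [Finset.sum_apply]
      refine Finset.sum_congr rfl fun i _ => ?_
      rw [PiLp.sub_apply, gradient_dilatedMollify hU (hweak i) hw' (hg' i)
        (hw'L.locallyIntegrable (by norm_num)) _ _ _ (hsub n x hxU), hx i]
    refine step.trans ((eLpNorm_sum_le (fun i _ => (m i).norm) (by norm_num)).trans ?_)
    refine Finset.sum_le_sum fun i _ => ?_
    rw [eLpNorm_norm]

end Density

/-! ### Weakly differentiable functions on a simplex -/

section Local

variable {d : ℕ} {K : Finset (Vec d)}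

/-- Lebesgue measure on the element `K`. -/
abbrev elemMeasure (K : Finset (Vec d)) : Measure (Vec d) := volume.restrict (openSimplex K)

instance (K : Finset (Vec d)) : IsFiniteMeasure (elemMeasure K) :=
  ⟨by rw [Measure.restrict_apply_univ]; exact (isBounded_openSimplex K).measure_lt_top⟩

/-- The smooth functions `φ n` converge to `w` in `H¹(K)`, and `G` is the weak gradient of `w`. -/
structure H1Limit (K : Finset (Vec d)) (φ : ℕ → Vec d → ℝ) (w : Vec d → ℝ) (G : Vec d → Vec d) :
    Prop where
  contDiff : ∀ n, ContDiff ℝ 1 (φ n)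
  memLp : MemLp w 2 (elemMeasure K)
  memLp_grad : MemLp G 2 (elemMeasure K)
  tendsto : Tendsto (fun n => l2Norm (elemMeasure K) fun x => φ n x - w x) atTop (𝓝 0)
  tendsto_grad : Tendsto (fun n => l2Norm (elemMeasure K) fun x => ∇ (φ n) x - G x) atTop (𝓝 0)

/-- The functions `φ n` converge to `τ` in `L²(ν)`; for the surface measure `ν` of a face, this
means that `τ` is the trace of the limit of the `φ n`. -/
structure TraceLimit (ν : Measure (Vec d)) (φ : ℕ → Vec d → ℝ) (τ : Vec d → ℝ) : Prop where
  memLp : MemLp τ 2 ν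
  tendsto : Tendsto (fun n => l2Norm ν fun x => φ n x - τ x) atTop (𝓝 0)

namespace H1Limit

variable {φ : ℕ → Vec d → ℝ} {w : Vec d → ℝ} {G : Vec d → Vec d}

lemma memLp_approx (h : H1Limit K φ w G) (n : ℕ) : MemLp (φ n) 2 (elemMeasure K) :=
  memLp_openSimplex K (h.contDiff n).continuous

lemma memLp_grad_approx (h : H1Limit K φ w G) (n : ℕ) : MemLp (∇ (φ n)) 2 (elemMeasure K) :=
  memLp_openSimplex K (continuous_gradient (h.contDiff n))

lemma gradient_sub {f g : Vec d → ℝ} (hf : ContDiff ℝ 1 f) (hg : ContDiff ℝ 1 g) (x : Vec d) :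
    ∇ (fun y => f y - g y) x = ∇ f x - ∇ g x := by
  simp only [gradient]
  rw [fderiv_fun_sub (hf.differentiable one_ne_zero x) (hg.differentiable one_ne_zero x), map_sub]

lemma sub (h : H1Limit K φ w G) {q : Vec d → ℝ} (hq : ContDiff ℝ 1 q) :
    H1Limit K (fun n x => φ n x - q x) (fun x => w x - q x) (fun x => G x - ∇ q x) where
  contDiff n := (h.contDiff n).sub hq
  memLp := h.memLp.sub (memLp_openSimplex K hq.continuous)
  memLp_grad := h.memLp_grad.sub (memLp_openSimplex K (continuous_gradient hq))
  tendsto := by simpa using h.tendsto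
  tendsto_grad := by
    simp only [gradient_sub (h.contDiff _) hq]
    simpa using h.tendsto_grad

/-- The traces of an approximating sequence converge on every face. -/
theorem exists_trace (h : H1Limit K φ w G) (hK : IsSimplex K) (hd : 1 ≤ d) (a : K) :
    ∃ τ, TraceLimit (Mesh.faceMeasure (K.erase (a : Vec d))) φ τ := by
  set ν := Mesh.faceMeasure (K.erase (a : Vec d))
  have hmem : ∀ n, MemLp (φ n) 2 ν := fun n => memLp_faceMeasure hK hd a (h.contDiff n).continuous
  set D := simplexDiam K
  have hD : 0 ≤ D := Metric.diam_nonneg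
  have hht := hK.height_pos hd a
  set b : ℕ → ℝ := fun n => l2Norm (elemMeasure K) (fun x => φ n x - w x) +
    l2Norm (elemMeasure K) (fun x => ∇ (φ n) x - G x) with hb
  have hbt : Tendsto b atTop (𝓝 0) := by simpa using h.tendsto.add h.tendsto_grad
  set C := (d + 2 * D) / hK.height a with hC
  have hC0 : 0 ≤ C := by positivity
  -- The trace inequality for differences makes the restrictions to the face a Cauchy sequence; `b
  -- n` bounds both the `L²` and the gradient part of the error.
  have key : ∀ n m, l2Norm ν (fun x => φ n x - φ m x) ≤ Real.sqrt C * (b n + b m) := by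
    intro n m
    have hd1 : ContDiff ℝ 1 fun x => φ n x - φ m x := (h.contDiff n).sub (h.contDiff m)
    have ht := hK.trace_le_of_contDiff hd a hd1
    have hw1 : MemLp (fun x => φ n x - w x) 2 (elemMeasure K) := (h.memLp_approx n).sub h.memLp
    have hw2 : MemLp (fun x => w x - φ m x) 2 (elemMeasure K) := h.memLp.sub (h.memLp_approx m)
    have hg1 : MemLp (fun x => ∇ (φ n) x - G x) 2 (elemMeasure K) :=
      (h.memLp_grad_approx n).sub h.memLp_grad
    have hg2 : MemLp (fun x => G x - ∇ (φ m) x) 2 (elemMeasure K) :=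
      h.memLp_grad.sub (h.memLp_grad_approx m)
    have e1 : l2Norm (elemMeasure K) (fun x => φ n x - φ m x) ≤ b n + b m := by
      have := l2Norm_add_le hw1 hw2
      simp only [sub_add_sub_cancel] at this
      rw [l2Norm_sub_comm w] at this
      have p1 := l2Norm_nonneg (ν := elemMeasure K) fun x => ∇ (φ n) x - G x
      have p2 := l2Norm_nonneg (ν := elemMeasure K) fun x => ∇ (φ m) x - G x
      simp only [hb]; linarith
    have e2 : l2Norm (elemMeasure K) (∇ fun x => φ n x - φ m x) ≤ b n + b m := by
      have := l2Norm_add_le hg1 hg2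
      simp only [sub_add_sub_cancel] at this
      rw [l2Norm_sub_comm G] at this
      have e : (∇ fun x => φ n x - φ m x) = fun x => ∇ (φ n) x - ∇ (φ m) x := by
        ext1 x; exact gradient_sub (h.contDiff n) (h.contDiff m) x
      rw [e]
      have p1 := l2Norm_nonneg (ν := elemMeasure K) fun x => φ n x - w x
      have p2 := l2Norm_nonneg (ν := elemMeasure K) fun x => φ m x - w x
      simp only [hb]; linarith
    have n1 := l2Norm_nonneg (ν := elemMeasure K) fun x => φ n x - φ m x
    have n2 := l2Norm_nonneg (ν := elemMeasure K) (∇ fun x => φ n x - φ m x)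
    have hbn : 0 ≤ b n + b m := n1.trans e1
    have h3 : hK.height a * l2Norm ν (fun x => φ n x - φ m x) ^ 2 ≤
        (d + 2 * D) * (b n + b m) ^ 2 := by
      refine ht.trans ?_
      have h4 : l2Norm (elemMeasure K) (fun x => φ n x - φ m x) *
          l2Norm (elemMeasure K) (∇ fun x => φ n x - φ m x) ≤ (b n + b m) * (b n + b m) :=
        mul_le_mul e1 e2 n2 hbn
      have h5 : l2Norm (elemMeasure K) (fun x => φ n x - φ m x) ^ 2 ≤ (b n + b m) ^ 2 := by gcongr
      calc _ ≤ d * (b n + b m) ^ 2 + 2 * D * ((b n + b m) * (b n + b m)) := by gcongr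
        _ = _ := by ring
    have h4 : l2Norm ν (fun x => φ n x - φ m x) ^ 2 ≤ (Real.sqrt C * (b n + b m)) ^ 2 := by
      rw [mul_pow, Real.sq_sqrt hC0, hC, div_mul_eq_mul_div, le_div_iff₀ hht, mul_comm]
      exact h3
    exact (sq_le_sq₀ (l2Norm_nonneg _) (by positivity)).1 h4
  have hcau : CauchySeq fun n => (hmem n).toLp (φ n) := by
    rw [Metric.cauchySeq_iff]
    intro ε hε
    have hs : 0 ≤ Real.sqrt C := Real.sqrt_nonneg _
    have : ∀ᶠ n in atTop, b n < ε / (2 * Real.sqrt C + 1) := hbt.eventually (gt_mem_nhds (by positivity))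
    obtain ⟨N, hN⟩ := eventually_atTop.1 this
    refine ⟨N, fun n hn m hm => ?_⟩
    rw [dist_eq_norm, ← MemLp.toLp_sub, ← l2Norm_eq_norm_toLp]
    refine (key n m).trans_lt ?_
    have h1 := hN n hn
    have h2 := hN m hm
    have hpos : 0 < 2 * Real.sqrt C + 1 := by positivity
    rw [lt_div_iff₀ hpos] at h1 h2
    by_contra hcon
    push Not at hcon
    have hb0 : ∀ n, 0 ≤ b n := fun n => add_nonneg (l2Norm_nonneg _) (l2Norm_nonneg _)
    nlinarith [hb0 n, hb0 m]
  obtain ⟨τ, hτ⟩ := cauchySeq_tendsto_of_complete hcau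
  refine ⟨τ, Lp.memLp τ, ?_⟩
  rw [tendsto_iff_norm_sub_tendsto_zero] at hτ
  refine hτ.congr fun n => ?_
  have hm : MemLp (fun x => φ n x - τ x) 2 ν := (hmem n).sub (Lp.memLp τ)
  rw [l2Norm_eq_norm_toLp hm]
  congr 1
  have : hm.toLp _ = (hmem n).toLp (φ n) - (Lp.memLp τ).toLp τ := MemLp.toLp_sub _ _
  rw [this, Lp.toLp_coeFn]

/-- The trace and the interior limit come from the same sequence, so the smooth inequality passes to
the limit term by term. -/
theorem trace_le (h : H1Limit K φ w G) (hK : IsSimplex K) (hd : 1 ≤ d) (a : K) {τ : Vec d → ℝ}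
    (hτ : TraceLimit (Mesh.faceMeasure (K.erase (a : Vec d))) φ τ) :
    hK.height a * l2Norm (Mesh.faceMeasure (K.erase (a : Vec d))) τ ^ 2 ≤
      d * l2Norm (elemMeasure K) w ^ 2 +
        2 * simplexDiam K * (l2Norm (elemMeasure K) w * l2Norm (elemMeasure K) G) := by
  have t1 := tendsto_l2Norm (fun n => memLp_faceMeasure hK hd a (h.contDiff n).continuous)
    hτ.memLp hτ.tendsto
  have t2 := tendsto_l2Norm h.memLp_approx h.memLp h.tendsto
  have t3 := tendsto_l2Norm h.memLp_grad_approx h.memLp_grad h.tendsto_grad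
  exact le_of_tendsto_of_tendsto' ((t1.pow 2).const_mul _)
    (((t2.pow 2).const_mul _).add ((t2.mul t3).const_mul _))
    fun n => hK.trace_le_of_contDiff hd a (h.contDiff n)

/-- The Poincaré inequality for functions with mean zero. -/
theorem poincare (h : H1Limit K φ w G) (hK : IsSimplex K) (h0 : ∫ x in openSimplex K, w x = 0) :
    l2Norm (elemMeasure K) w ≤ 2 ^ d * simplexDiam K * l2Norm (elemMeasure K) G := by
  have t2 := tendsto_l2Norm h.memLp_approx h.memLp h.tendsto
  have t3 := tendsto_l2Norm h.memLp_grad_approx h.memLp_grad h.tendsto_grad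
  have t4 : Tendsto (fun n => ∫ x in openSimplex K, φ n x) atTop (𝓝 (∫ x in openSimplex K, w x)) := by
    have := tendsto_integral_mul h.memLp_approx h.memLp (memLp_const (1 : ℝ)) h.tendsto
    simpa using this
  have hlim := le_of_tendsto_of_tendsto' (((t2.pow 2).const_mul _).sub (t4.pow 2))
    ((t3.pow 2).const_mul _) fun n => poincare_of_contDiff K (h.contDiff n)
  rw [h0] at hlim
  have hV : 0 < volume.real (openSimplex K) := by
    rw [measureReal_def]
    exact ENNReal.toReal_pos ((isOpen_openSimplex K).measure_pos _ hK.nonempty_openSimplex).ne'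
      (isBounded_openSimplex K).measure_lt_top.ne
  have hD : 0 ≤ simplexDiam K := Metric.diam_nonneg
  set V := volume.real (openSimplex K)
  set A := l2Norm (elemMeasure K) w
  set B := l2Norm (elemMeasure K) G
  have hB : 0 ≤ B := l2Norm_nonneg _
  have h1 : A ^ 2 ≤ 2 ^ d * simplexDiam K ^ 2 * B ^ 2 := by
    have : V * A ^ 2 ≤ V * (2 ^ d * simplexDiam K ^ 2 * B ^ 2) := by linarith
    exact le_of_mul_le_mul_left this hV
  refine (sq_le_sq₀ (l2Norm_nonneg _) (by positivity)).1 (h1.trans ?_)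
  -- Again the root of `2 ^ d` is bounded by `2 ^ d`.
  have h2 : (1 : ℝ) ≤ 2 ^ d := one_le_pow₀ (by norm_num)
  calc (2 : ℝ) ^ d * simplexDiam K ^ 2 * B ^ 2 ≤ (2 ^ d * 2 ^ d) * simplexDiam K ^ 2 * B ^ 2 := by
        gcongr
        nlinarith
    _ = _ := by ring

lemma memLp_apply {X : Type*} [MeasurableSpace X] {ν : Measure X} {v : X → Vec d}
    (hv : MemLp v 2 ν) (i : Fin d) : MemLp (fun x => v x i) 2 ν := MemLp.eval_piLp hv i

/-- The divergence theorem for weakly differentiable functions. -/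
theorem integral_by_parts (h : H1Limit K φ w G) (hK : IsSimplex K) (hd : 1 ≤ d)
    {τ : K → Vec d → ℝ} (hτ : ∀ a : K, TraceLimit (Mesh.faceMeasure (K.erase (a : Vec d))) φ (τ a))
    {q : Vec d → ℝ} (hq : ContDiff ℝ 1 q) (i : Fin d) :
    (∫ x in openSimplex K, G x i * q x) + ∫ x in openSimplex K, w x * (∇ q x) i =
      ∑ a : K, outerNormal K (K.erase a) i *
        ∫ x, τ a x * q x ∂(Mesh.faceMeasure (K.erase (a : Vec d))) := by
  have hqL := memLp_openSimplex K hq.continuous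
  have hgqL : MemLp (fun x => (∇ q x) i) 2 (elemMeasure K) :=
    memLp_apply (memLp_openSimplex K (continuous_gradient hq)) i
  have hgi : Tendsto (fun n => l2Norm (elemMeasure K) fun x => (∇ (φ n) x) i - G x i)
      atTop (𝓝 0) := by
    refine squeeze_zero (fun n => l2Norm_nonneg _) (fun n => ?_) h.tendsto_grad
    refine l2Norm_comp_le ((h.memLp_grad_approx n).sub h.memLp_grad)
      (Eventually.of_forall fun x => ?_)
    exact PiLp.norm_apply_le (∇ (φ n) x - G x) i
  have t1 := tendsto_integral_mul (fun n => memLp_apply (h.memLp_grad_approx n) i)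
    (memLp_apply h.memLp_grad i) hqL hgi
  have t2 := tendsto_integral_mul h.memLp_approx h.memLp hgqL h.tendsto
  have t3 : Tendsto (fun n => ∑ a : K, outerNormal K (K.erase a) i *
        ∫ x, φ n x * q x ∂(Mesh.faceMeasure (K.erase (a : Vec d)))) atTop
      (𝓝 (∑ a : K, outerNormal K (K.erase a) i *
        ∫ x, τ a x * q x ∂(Mesh.faceMeasure (K.erase (a : Vec d))))) := by
    refine tendsto_finsetSum _ fun a _ => Tendsto.const_mul _ ?_
    exact tendsto_integral_mul (fun n => memLp_faceMeasure hK hd a (h.contDiff n).continuous)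
      (hτ a).memLp (memLp_faceMeasure hK hd a hq.continuous) (hτ a).tendsto
  refine tendsto_nhds_unique (t1.add t2) (t3.congr fun n => ?_)
  -- For the smooth approximants this is the divergence theorem applied to the product with `q`, in
  -- the direction of the `i`-th unit vector.
  have hdiv := hK.integral_gradient hd (EuclideanSpace.single i 1) ((h.contDiff n).mul hq)
  rw [← restrict_openSimplex] at hdiv
  simp only [inner_gradient_mul (h.contDiff n) hq] at hdiv
  simp only [EuclideanSpace.inner_single_right, conj_trivial, one_mul] at hdiv
  rw [← hdiv, integral_add, add_comm]
  · simp only [mul_comm]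
  · exact integrable_mul_of_memLp (h.memLp_approx n) hgqL
  · exact integrable_mul_of_memLp hqL (memLp_apply (h.memLp_grad_approx n) i)

end H1Limit

lemma TraceLimit.sub {ν : Measure (Vec d)} {φ : ℕ → Vec d → ℝ} {τ q : Vec d → ℝ}
    (h : TraceLimit ν φ τ) (hq : MemLp q 2 ν) :
    TraceLimit ν (fun n x => φ n x - q x) (fun x => τ x - q x) where
  memLp := h.memLp.sub hq
  tendsto := by simpa using h.tendsto

lemma l2Norm_sq_eq_sum {X : Type*} [MeasurableSpace X] {ν : Measure X} {v : X → Vec d}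
    (hv : MemLp v 2 ν) : l2Norm ν v ^ 2 = ∑ i, l2Norm ν (fun x => v x i) ^ 2 := by
  rw [l2Norm_sq hv]
  simp only [l2Norm_sq_real (H1Limit.memLp_apply hv _), EuclideanSpace.norm_sq_eq,
    Real.norm_eq_abs, sq_abs]
  rw [integral_finsetSum]
  intro i _
  exact (H1Limit.memLp_apply hv i).integrable_sq

lemma gradient_affine (α : ℝ) (m x : Vec d) : ∇ (fun y : Vec d => α + inner ℝ m y) x = m := by
  refine HasGradientAt.gradient ?_
  rw [hasGradientAt_iff_hasFDerivAt]
  exact ((InnerProductSpace.toDual ℝ (Vec d) m).hasFDerivAt).const_add α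

/-- The seminorm of `H²(K)`. -/
def h2Semi (K : Finset (Vec d)) (H : Fin d → Fin d → Vec d → ℝ) : ℝ :=
  Real.sqrt (∑ i, ∑ j, l2Norm (elemMeasure K) (H i j) ^ 2)

lemma h2Semi_nonneg (K : Finset (Vec d)) (H : Fin d → Fin d → Vec d → ℝ) : 0 ≤ h2Semi K H :=
  Real.sqrt_nonneg _

lemma h2Semi_sq (K : Finset (Vec d)) (H : Fin d → Fin d → Vec d → ℝ) :
    h2Semi K H ^ 2 = ∑ i, ∑ j, l2Norm (elemMeasure K) (H i j) ^ 2 :=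
  Real.sq_sqrt (Finset.sum_nonneg fun _ _ => Finset.sum_nonneg fun _ _ => sq_nonneg _)

/-- The constant in the approximation estimates on the faces. -/
def approxConst (d : ℕ) (μ : ℝ) : ℝ := (d + 2) * (2 ^ d) ^ 4 / μ

/-- Approximation of an `H²` function on a simplex by an affine function. -/
theorem exists_affine_approx (hK : IsSimplex K) (hd : 1 ≤ d) {μ : ℝ} (hμ : 0 < μ)
    (hshape : ∀ a, μ * simplexDiam K ≤ hK.height a) {z : Vec d → ℝ} {G : Vec d → Vec d}
    {H : Fin d → Fin d → Vec d → ℝ} {φ : ℕ → Vec d → ℝ} {ψ : Fin d → ℕ → Vec d → ℝ}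
    (hz : H1Limit K φ z G)
    (hG : ∀ i, H1Limit K (ψ i) (fun x => G x i) (fun x => WithLp.toLp 2 fun j => H i j x)) :
    ∃ (α : ℝ) (m : Vec d),
      l2Norm (elemMeasure K) (fun x => z x - (α + inner ℝ m x)) ≤
        (2 ^ d) ^ 2 * simplexDiam K ^ 2 * h2Semi K H ∧
      ∀ (a : K) (Z : Vec d → ℝ) (Γ : Vec d → Vec d),
        TraceLimit (Mesh.faceMeasure (K.erase (a : Vec d))) φ Z →
        (∀ i, TraceLimit (Mesh.faceMeasure (K.erase (a : Vec d))) (ψ i) fun x => Γ x i) →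
        l2Norm (Mesh.faceMeasure (K.erase (a : Vec d))) (fun x => Z x - (α + inner ℝ m x)) ^ 2 ≤
          approxConst d μ * simplexDiam K ^ 3 * h2Semi K H ^ 2 ∧
        l2Norm (Mesh.faceMeasure (K.erase (a : Vec d))) (fun x => Γ x - m) ^ 2 ≤
          approxConst d μ * simplexDiam K * h2Semi K H ^ 2 := by
  set V := volume.real (openSimplex K) with hVdef
  have hV : V ≠ 0 := by
    rw [hVdef, measureReal_def]
    exact (ENNReal.toReal_pos ((isOpen_openSimplex K).measure_pos _ hK.nonempty_openSimplex).ne'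
      (isBounded_openSimplex K).measure_lt_top.ne).ne'
  have hmean : ∀ (f : Vec d → ℝ) (c : ℝ), Integrable f (elemMeasure K) →
      c = V⁻¹ * ∫ x in openSimplex K, f x → ∫ x in openSimplex K, (f x - c) = 0 := by
    intro f c hf hc
    rw [integral_sub hf (integrable_const c), setIntegral_const, ← hVdef, hc, smul_eq_mul,
      mul_inv_cancel_left₀ hV, sub_self]
  -- With `m` the mean of `G` and `α` the mean of `z - m · x`, both `G - m` and `z - (α + m · x)`
  -- have mean zero, and the Poincaré inequality can be used twice.
  set m : Vec d := WithLp.toLp 2 fun i => V⁻¹ * ∫ x in openSimplex K, G x i with hm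
  set α : ℝ := V⁻¹ * ∫ x in openSimplex K, (z x - inner ℝ m x) with hα
  set D := simplexDiam K with hD
  have hD0 : 0 < D := hK.simplexDiam_pos hd
  set P : ℝ := 2 ^ d with hP
  have hP1 : 1 ≤ P := one_le_pow₀ (by norm_num)
  set S := h2Semi K H with hS
  have hS0 : 0 ≤ S := h2Semi_nonneg _ _
  set R : Fin d → ℝ := fun i => l2Norm (elemMeasure K) fun x => WithLp.toLp 2 fun j => H i j x
  have hR0 : ∀ i, 0 ≤ R i := fun i => l2Norm_nonneg _
  have hRS : ∑ i, R i ^ 2 = S ^ 2 := by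
    rw [hS, h2Semi_sq]
    exact Finset.sum_congr rfl fun i _ => l2Norm_sq_eq_sum (hG i).memLp_grad
  have hGi : ∀ i, H1Limit K (fun n x => ψ i n x - m i) (fun x => G x i - m i)
      (fun x => WithLp.toLp 2 fun j => H i j x) := by
    intro i
    have := (hG i).sub (contDiff_const (c := m i))
    simpa [gradient_fun_const] using this
  have hGest : ∀ i, l2Norm (elemMeasure K) (fun x => G x i - m i) ≤ P * D * R i := fun i =>
    (hGi i).poincare hK (hmean _ _ ((hG i).memLp.integrable (by norm_num)) rfl)
  have hI : ContDiff ℝ 1 fun x : Vec d => α + inner ℝ m x :=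
    contDiff_const.add (contDiff_const.inner ℝ contDiff_id)
  have hη := hz.sub hI
  simp only [gradient_affine] at hη
  have hGvec : l2Norm (elemMeasure K) (fun x => G x - m) ≤ P * D * S := by
    refine (sq_le_sq₀ (l2Norm_nonneg _) (by positivity)).1 ?_
    rw [l2Norm_sq_eq_sum hη.memLp_grad, mul_pow, ← hRS, Finset.mul_sum]
    refine Finset.sum_le_sum fun i _ => ?_
    rw [← mul_pow]
    have := hGest i
    have := l2Norm_nonneg (ν := elemMeasure K) fun x => (G x - m) i
    gcongr
    simpa using hGest i
  have hη0 : ∫ x in openSimplex K, (z x - (α + inner ℝ m x)) = 0 := by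
    have hint : Integrable (fun x => z x - inner ℝ m x) (elemMeasure K) :=
      (hz.memLp.sub (memLp_openSimplex K (g := fun x : Vec d => inner ℝ m x)
        (by fun_prop))).integrable (by norm_num)
    have := hmean _ α hint hα
    rw [← this]
    refine integral_congr_ae (Eventually.of_forall fun x => ?_)
    simp only; ring
  have hηest : l2Norm (elemMeasure K) (fun x => z x - (α + inner ℝ m x)) ≤ P ^ 2 * D ^ 2 * S := by
    calc _ ≤ P * D * l2Norm (elemMeasure K) (fun x => G x - m) := hη.poincare hK hη0
      _ ≤ P * D * (P * D * S) := by gcongr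
      _ = _ := by ring
  refine ⟨α, m, hηest, fun a Z Γ hZ hΓ => ?_⟩
  have hht := hshape a
  have hht0 : 0 < μ * D := by positivity
  constructor
  · have hZ' := hZ.sub (memLp_faceMeasure hK hd a hI.continuous)
    have ht := hη.trace_le hK hd a hZ'
    set X := l2Norm (Mesh.faceMeasure (K.erase (a : Vec d))) (fun x => Z x - (α + inner ℝ m x))
    set A := l2Norm (elemMeasure K) (fun x => z x - (α + inner ℝ m x))
    set B := l2Norm (elemMeasure K) (fun x => G x - m)
    have hA0 : 0 ≤ A := l2Norm_nonneg _
    have hB0 : 0 ≤ B := l2Norm_nonneg _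
    have h1 : μ * D * X ^ 2 ≤ d * (P ^ 2 * D ^ 2 * S) ^ 2 +
        2 * D * ((P ^ 2 * D ^ 2 * S) * (P * D * S)) := by
      calc μ * D * X ^ 2 ≤ hK.height a * X ^ 2 := by gcongr
        _ ≤ d * A ^ 2 + 2 * D * (A * B) := ht
        _ ≤ _ := by gcongr
    -- Since `P ≥ 1`, all powers of `P` are raised to the fourth, so that one constant serves for
    -- the function and for its gradient.
    have h2 : d * (P ^ 2 * D ^ 2 * S) ^ 2 + 2 * D * ((P ^ 2 * D ^ 2 * S) * (P * D * S)) ≤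
        (d + 2) * P ^ 4 * (D ^ 4 * S ^ 2) := by
      have h3 : P ^ 3 ≤ P ^ 4 := pow_le_pow_right₀ hP1 (by norm_num)
      have h4 : 0 ≤ D ^ 4 * S ^ 2 := by positivity
      have := mul_le_mul_of_nonneg_right h3 h4
      calc _ = d * P ^ 4 * (D ^ 4 * S ^ 2) + 2 * (P ^ 3 * (D ^ 4 * S ^ 2)) := by ring
        _ ≤ d * P ^ 4 * (D ^ 4 * S ^ 2) + 2 * (P ^ 4 * (D ^ 4 * S ^ 2)) := by gcongr
        _ = _ := by ring
    have h3 := h1.trans h2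
    refine le_of_mul_le_mul_left (h3.trans (le_of_eq ?_)) hht0
    rw [approxConst, ← hP]; field_simp
  · have hmem : MemLp (fun x => Γ x - m) 2 (Mesh.faceMeasure (K.erase (a : Vec d))) := by
      have := hK.isFiniteMeasure_faceMeasure hd a
      exact (MemLp.of_eval_piLp fun i => (hΓ i).memLp).sub (memLp_const m)
    rw [l2Norm_sq_eq_sum hmem, ← hRS, Finset.mul_sum]
    refine Finset.sum_le_sum fun i _ => ?_
    have := hK.isFiniteMeasure_faceMeasure hd a
    have ht := (hGi i).trace_le hK hd a ((hΓ i).sub (memLp_const (m i)))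
    have hG2 := hGest i
    have hR0i := hR0 i
    change l2Norm (Mesh.faceMeasure (K.erase (a : Vec d))) (fun x => Γ x i - m i) ^ 2 ≤ _
    set X := l2Norm (Mesh.faceMeasure (K.erase (a : Vec d))) (fun x => Γ x i - m i)
    set A := l2Norm (elemMeasure K) (fun x => G x i - m i)
    have hA0 : 0 ≤ A := l2Norm_nonneg _
    have h1 : μ * D * X ^ 2 ≤ d * (P * D * R i) ^ 2 + 2 * D * ((P * D * R i) * R i) := by
      calc μ * D * X ^ 2 ≤ hK.height a * X ^ 2 := by gcongr
        _ ≤ d * A ^ 2 + 2 * D * (A * R i) := ht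
        _ ≤ _ := by gcongr
    have h2 : d * (P * D * R i) ^ 2 + 2 * D * ((P * D * R i) * R i) ≤
        (d + 2) * P ^ 4 * (D ^ 2 * R i ^ 2) := by
      have h3 : P ^ 1 ≤ P ^ 4 := pow_le_pow_right₀ hP1 (by norm_num)
      have h3' : P ^ 2 ≤ P ^ 4 := pow_le_pow_right₀ hP1 (by norm_num)
      have h4 : 0 ≤ D ^ 2 * R i ^ 2 := by positivity
      calc _ = d * P ^ 2 * (D ^ 2 * R i ^ 2) + 2 * (P ^ 1 * (D ^ 2 * R i ^ 2)) := by ring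
        _ ≤ d * P ^ 4 * (D ^ 2 * R i ^ 2) + 2 * (P ^ 4 * (D ^ 2 * R i ^ 2)) := by gcongr
        _ = _ := by ring
    have h3 := h1.trans h2
    refine le_of_mul_le_mul_left (h3.trans (le_of_eq ?_)) hht0
    rw [approxConst, ← hP]; field_simp

end Local

/-! ### Faces of a conforming mesh -/

section MeshTopology

variable {d : ℕ}

/-- The relative interior of the simplex spanned by `F`. -/
def faceInterior (F : Finset (Vec d)) : Set (Vec d) :=
  {x | x ∈ closedSimplex F ∧ ∀ b ∈ F, x ∉ closedSimplex (F.erase b)}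

namespace IsSimplex

variable {K : Finset (Vec d)}

lemma mem_faceInterior (hK : IsSimplex K) {a : K} {x : Vec d} :
    x ∈ faceInterior (K.erase a) ↔ hK.coord a x = 0 ∧ ∀ b, b ≠ a → 0 < hK.coord b x := by
  have hmem : ∀ b : K, b ≠ a → (b : Vec d) ∈ K.erase (a : Vec d) := fun b hb =>
    Finset.mem_erase.2 ⟨fun h => hb (Subtype.ext h), b.2⟩
  constructor
  · rintro ⟨hx, hb⟩
    have hx' := hK.mem_face.1 hx
    refine ⟨hx'.2, fun b hba => lt_of_le_of_ne (hK.mem_closedSimplex.1 hx'.1 b) fun h0 => ?_⟩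
    refine hb b (hmem b hba) ?_
    rw [hK.mem_closedSimplex_subset ((Finset.erase_subset _ _).trans (Finset.erase_subset _ _))]
    refine ⟨hx'.1, fun c hc => ?_⟩
    by_cases hca : c = a
    · rw [hca, hx'.2]
    · by_cases hcb : c = b
      · rw [hcb, ← h0]
      · exact absurd (Finset.mem_erase.2 ⟨fun h => hcb (Subtype.ext h), hmem c hca⟩) hc
  · rintro ⟨h0, hpos⟩
    have hxK : x ∈ closedSimplex K := hK.mem_closedSimplex.2 fun b => by
      by_cases hb : b = a
      · rw [hb, h0]
      · exact (hpos b hb).le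
    refine ⟨hK.mem_face.2 ⟨hxK, h0⟩, fun b hb hxb => ?_⟩
    rw [hK.mem_closedSimplex_subset ((Finset.erase_subset _ _).trans (Finset.erase_subset _ _))]
      at hxb
    have hbK := Finset.mem_erase.1 hb
    have := hxb.2 ⟨b, hbK.2⟩ (by simp)
    exact (hpos ⟨b, hbK.2⟩ (fun h => hbK.1 (congrArg Subtype.val h))).ne' this

/-- An interior point of the simplex is projected from `a` onto the opposite face. -/
lemma exists_mem_faceInterior (hK : IsSimplex K) (hd : 1 ≤ d) (a : K) :
    ∃ x, x ∈ faceInterior (K.erase (a : Vec d)) := by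
  obtain ⟨y, hy⟩ := hK.nonempty_openSimplex
  have hpos := hK.mem_openSimplex.1 hy
  have hlt : hK.coord a y < 1 := by
    have : 1 < K.card := by rw [hK.card_eq]; omega
    obtain ⟨b, hb, hba⟩ := Finset.exists_mem_ne this (a : Vec d)
    rw [← hK.sum_coord y]
    exact Finset.single_lt_sum (f := fun b => hK.coord b y) (i := a) (j := ⟨b, hb⟩)
      (fun h => hba (congrArg Subtype.val h)) (Finset.mem_univ _) (Finset.mem_univ _) (hpos _)
      fun c _ _ => (hpos c).le
  refine ⟨AffineMap.homothety (a : Vec d) (1 - hK.coord a y)⁻¹ y, hK.mem_faceInterior.2 ⟨?_, ?_⟩⟩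
  · rw [coord_homothety, hK.coord_self]
    have : 1 - hK.coord a y ≠ 0 := by linarith
    field_simp; ring
  · intro b hb
    rw [coord_homothety, hK.coord_ne hb, mul_zero, zero_add]
    have := hpos b
    have : 0 < 1 - hK.coord a y := by linarith
    positivity

/-- The relative boundary of the face is cut out by the zero sets of the other coordinates, which
are null on it. -/
lemma faceInterior_ae (hK : IsSimplex K) (hd : 1 ≤ d) (a : K) :
    ∀ᵐ x ∂(Mesh.faceMeasure (K.erase (a : Vec d))), x ∈ faceInterior (K.erase (a : Vec d)) := by
  have h : ∀ᵐ x ∂(Mesh.faceMeasure (K.erase (a : Vec d))), ∀ b, b ≠ a → hK.coord b x ≠ 0 := by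
    rw [ae_all_iff]
    intro b
    by_cases hb : b = a
    · exact Eventually.of_forall fun x h => absurd hb h
    · filter_upwards [hK.face_ae_notMem_hyperplane hd a b hb] with x hx _ using hx
  filter_upwards [h, ae_mem_faceMeasure _] with x hx hxF
  have hxF' := hK.mem_face.1 hxF
  exact hK.mem_faceInterior.2 ⟨hxF'.2, fun b hb =>
    lt_of_le_of_ne (hK.mem_closedSimplex.1 hxF'.1 b) (hx b hb).symm⟩

end IsSimplex

namespace Mesh

variable (T : Mesh d) {Ω : Set (Vec d)}

lemma mem_closedSimplex_inter {K J : Finset (Vec d)} (hK : K ∈ T.elems) (hJ : J ∈ T.elems)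
    {x : Vec d} (hxK : x ∈ closedSimplex K) (hxJ : x ∈ closedSimplex J) :
    x ∈ closedSimplex (K ∩ J) := by
  have : x ∈ closedSimplex K ∩ closedSimplex J := ⟨hxK, hxJ⟩
  rw [T.inter_eq K hK J hJ] at this
  rw [closedSimplex, Finset.coe_inter]
  exact this

/-- This is the form in which conformity of the mesh is used: on the overlap of two elements only
the coordinates of common vertices survive. -/
lemma coord_eq_zero {K J : Finset (Vec d)} (hK : K ∈ T.elems) (hJ : J ∈ T.elems)
    {x : Vec d} (hxK : x ∈ closedSimplex K) (hxJ : x ∈ closedSimplex J) (a : K)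
    (ha : (a : Vec d) ∉ J) : (T.isSimplex hK).coord a x = 0 := by
  have h := T.mem_closedSimplex_inter hK hJ hxK hxJ
  rw [(T.isSimplex hK).mem_closedSimplex_subset Finset.inter_subset_left] at h
  exact h.2 a fun h' => ha (Finset.mem_inter.1 h').2

lemma exists_mem_notMem {K J : Finset (Vec d)} (hK : K ∈ T.elems) (hJ : J ∈ T.elems)
    (hne : K ≠ J) : ∃ a ∈ K, a ∉ J := by
  by_contra h
  push Not at h
  exact hne (Finset.eq_of_subset_of_card_le h (by rw [T.card_eq K hK, T.card_eq J hJ]))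

lemma disjoint_openSimplex {K J : Finset (Vec d)} (hK : K ∈ T.elems) (hJ : J ∈ T.elems)
    (hne : K ≠ J) : Disjoint (openSimplex K) (openSimplex J) := by
  rw [Set.disjoint_left]
  intro x hxK hxJ
  obtain ⟨a, ha, haJ⟩ := T.exists_mem_notMem hK hJ hne
  have h0 := T.coord_eq_zero hK hJ (openSimplex_subset K hxK) (openSimplex_subset J hxJ) ⟨a, ha⟩ haJ
  exact ((T.isSimplex hK).mem_openSimplex.1 hxK ⟨a, ha⟩).ne' h0

variable {T}

lemma closedSimplex_subset_closure (hT : T.Triangulates Ω) {K : Finset (Vec d)} (hK : K ∈ T.elems) :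
    closedSimplex K ⊆ closure Ω := by
  rw [← hT]; exact Set.subset_biUnion_of_mem (u := fun K => closedSimplex K) hK

lemma openSimplex_subset_domain (hT : T.Triangulates Ω) (hΩ : interior (closure Ω) = Ω)
    {K : Finset (Vec d)} (hK : K ∈ T.elems) : openSimplex K ⊆ Ω := by
  rw [← hΩ]; exact interior_mono (closedSimplex_subset_closure hT hK)

/-- `Ω` lies between the union of the open elements and that of the closed ones, which differ by a
null set. That open elements lie in `Ω` uses `interior (closure Ω) = Ω`. -/
lemma domain_ae_eq (hT : T.Triangulates Ω) (hΩ : interior (closure Ω) = Ω) :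
    Ω =ᵐ[volume] ⋃ K : T.elems, openSimplex K.1 := by
  have h1 : (⋃ K : T.elems, openSimplex K.1) =ᵐ[volume] ⋃ K : T.elems, closedSimplex K.1 :=
    Filter.EventuallyEq.countable_iUnion fun K => openSimplex_ae_eq K.1
  have h2 : (⋃ K : T.elems, openSimplex K.1) ⊆ Ω :=
    Set.iUnion_subset fun K => openSimplex_subset_domain hT hΩ K.2
  have h3 : Ω ⊆ ⋃ K : T.elems, closedSimplex K.1 := by
    refine subset_closure.trans ?_
    rw [← hT]
    intro x hx
    simp only [Set.mem_iUnion] at hx ⊢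
    obtain ⟨K, hK, hx⟩ := hx
    exact ⟨⟨K, hK⟩, hx⟩
  exact (h3.eventuallyLE.trans h1.symm.le).antisymm h2.eventuallyLE

lemma integral_domain (hT : T.Triangulates Ω) (hΩ : interior (closure Ω) = Ω) {f : Vec d → ℝ}
    (hf : IntegrableOn f Ω) : ∫ x in Ω, f x = ∑ K : T.elems, ∫ x in openSimplex K.1, f x := by
  rw [setIntegral_congr_set (domain_ae_eq hT hΩ), integral_iUnion_fintype]
  · exact fun K => (isOpen_openSimplex K.1).measurableSet
  · intro K J hne
    exact T.disjoint_openSimplex K.2 J.2 fun h => hne (Subtype.ext h)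
  · exact fun K => hf.mono_set (openSimplex_subset_domain hT hΩ K.2)

lemma glue_eq (v : T.Broken ℝ) (K : T.elems) {x : Vec d} (hx : x ∈ openSimplex K.1) :
    glue v x = v K x := by
  rw [glue, Finset.sum_eq_single K]
  · rw [Set.indicator_of_mem hx]
  · intro J _ hne
    refine Set.indicator_of_notMem (fun hxJ => ?_) _
    exact Set.disjoint_left.1 (T.disjoint_openSimplex J.2 K.2 fun h => hne (Subtype.ext h)) hxJ hx
  · simp

lemma restrict_openSimplex_le (hT : T.Triangulates Ω) (hΩ : interior (closure Ω) = Ω)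
    (K : T.elems) : elemMeasure K.1 ≤ volume.restrict Ω :=
  Measure.restrict_mono_set _ (openSimplex_subset_domain hT hΩ K.2)

/-- An element adjacent to a face arises from it by adding a vertex. -/
lemma exists_eq_erase {F : Finset (Vec d)} (hF : F ∈ T.faces) {K : T.elems}
    (hK : K ∈ T.neighbours F) : ∃ a : K.1, F = K.1.erase a := by
  have hsub : F ⊆ K.1 := (Finset.mem_filter.1 hK).2
  have hcard : F.card = d := by
    obtain ⟨J, -, hJ⟩ := Finset.mem_biUnion.1 hF
    exact (Finset.mem_powersetCard.1 hJ).2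
  obtain ⟨a, ha⟩ : ∃ a, K.1 \ F = {a} := by
    rw [← Finset.card_eq_one, Finset.card_sdiff_of_subset hsub, T.card_eq _ K.2, hcard]; simp
  have haK : a ∈ K.1 \ F := by rw [ha]; simp
  refine ⟨⟨a, (Finset.mem_sdiff.1 haK).1⟩, ?_⟩
  simp only
  rw [← Finset.sdiff_singleton_eq_erase, ← ha, Finset.sdiff_sdiff_eq_self hsub]

lemma mem_neighbours {F : Finset (Vec d)} {K : T.elems} : K ∈ T.neighbours F ↔ F ⊆ K.1 := by
  simp [neighbours]

lemma erase_mem_faces (K : T.elems) (a : K.1) : K.1.erase (a : Vec d) ∈ T.faces := by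
  refine Finset.mem_biUnion.2 ⟨K.1, K.2, Finset.mem_powersetCard.2 ⟨Finset.erase_subset _ _, ?_⟩⟩
  rw [Finset.card_erase_of_mem a.2, T.card_eq _ K.2]; simp

lemma mem_neighbours_erase (K : T.elems) (a : K.1) : K ∈ T.neighbours (K.1.erase (a : Vec d)) :=
  mem_neighbours.2 (Finset.erase_subset _ _)

/-- Exchanging sums over elements and over faces. -/
lemma sum_elems_faces (f : T.elems → Finset (Vec d) → ℝ) :
    ∑ K : T.elems, ∑ a : K.1, f K (K.1.erase a) = ∑ F ∈ T.faces, ∑ K ∈ T.neighbours F, f K F := by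
  have h1 : ∀ K : T.elems, ∑ a : K.1, f K (K.1.erase a) = ∑ F ∈ K.1.powersetCard d, f K F := by
    intro K
    refine Finset.sum_bij (fun (a : K.1) _ => K.1.erase (a : Vec d)) ?_ ?_ ?_ ?_
    · intro a _
      refine Finset.mem_powersetCard.2 ⟨Finset.erase_subset _ _, ?_⟩
      rw [Finset.card_erase_of_mem a.2, T.card_eq _ K.2]; simp
    · intro a _ b _ hab
      by_contra hne
      have : (a : Vec d) ∈ K.1.erase (b : Vec d) :=
        Finset.mem_erase.2 ⟨fun h => hne (Subtype.ext h), a.2⟩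
      rw [← hab] at this
      simp at this
    · intro F hF
      have hF' := Finset.mem_powersetCard.1 hF
      obtain ⟨a, ha⟩ := exists_eq_erase (T := T) (F := F) (K := K)
        (Finset.mem_biUnion.2 ⟨K.1, K.2, hF⟩) (mem_neighbours.2 hF'.1)
      exact ⟨a, Finset.mem_univ _, ha.symm⟩
    · intro a _; rfl
  simp only [h1]
  refine Finset.sum_comm' ?_
  intro K F
  simp only [Finset.mem_univ, true_and]
  constructor
  · intro hF
    exact ⟨mem_neighbours.2 (Finset.mem_powersetCard.1 hF).1, Finset.mem_biUnion.2 ⟨K.1, K.2, hF⟩⟩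
  · rintro ⟨hK, hF⟩
    obtain ⟨J, -, hJ⟩ := Finset.mem_biUnion.1 hF
    exact Finset.mem_powersetCard.2 ⟨mem_neighbours.1 hK, (Finset.mem_powersetCard.1 hJ).2⟩

lemma neighbours_nonempty {F : Finset (Vec d)} (hF : F ∈ T.faces) : (T.neighbours F).Nonempty := by
  obtain ⟨J, hJ, hFJ⟩ := Finset.mem_biUnion.1 hF
  exact ⟨⟨J, hJ⟩, mem_neighbours.2 (Finset.mem_powersetCard.1 hFJ).1⟩

/-- An element containing an inner point of a face contains the face. -/
lemma subset_of_mem_faceInterior (K : T.elems) (a : K.1) {J : Finset (Vec d)} (hJ : J ∈ T.elems)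
    {x : Vec d} (hx : x ∈ faceInterior (K.1.erase (a : Vec d))) (hxJ : x ∈ closedSimplex J) :
    K.1.erase (a : Vec d) ⊆ J := by
  have hK := T.isSimplex K.2
  intro b hb
  by_contra hbJ
  have hbK := Finset.mem_erase.1 hb
  have h0 := T.coord_eq_zero K.2 hJ (hK.mem_face.1 hx.1).1 hxJ ⟨b, hbK.2⟩ hbJ
  exact ((hK.mem_faceInterior.1 hx).2 ⟨b, hbK.2⟩ fun h => hbK.1 (congrArg Subtype.val h)).ne' h0

/-- Two elements with a common face lie on different sides of it. -/
lemma exists_coord_eq_neg_mul (hd : 1 ≤ d) {K J : T.elems} (hne : K ≠ J) {a : K.1} {b : J.1}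
    (hF : K.1.erase (a : Vec d) = J.1.erase (b : Vec d)) : ∃ c : ℝ, c < 0 ∧
      ∀ x, (T.isSimplex K.2).coord a x = c * (T.isSimplex J.2).coord b x := by
  have hK := T.isSimplex K.2
  have hJ := T.isSimplex J.2
  -- Both coordinates are affine and vanish on the common face, so they are proportional; the factor
  -- is read off at `b`.
  set c := hK.coord a b with hc
  have hcoord : ∀ x, hK.coord a x = c * hJ.coord b x := by
    intro x
    have := hJ.affineMap_ext (f := hK.coord a) (g := c • hJ.coord b) (fun e => by
      simp only [AffineMap.coe_smul, Pi.smul_apply, smul_eq_mul]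
      by_cases he : b = e
      · subst he; simp [hc]
      · rw [hJ.coord_ne he, mul_zero]
        have : (e : Vec d) ∈ K.1.erase (a : Vec d) := by
          rw [hF]; exact Finset.mem_erase.2 ⟨fun h => he (Subtype.ext h.symm), e.2⟩
        exact (hK.mem_face.1 (vertex_mem_closedSimplex this)).2) x
    simpa using this
  refine ⟨c, ?_, hcoord⟩
  by_contra hcn
  push Not at hcn
  have haJ : (a : Vec d) ∉ J.1 := by
    intro haJ
    refine hne (Subtype.ext (Finset.eq_of_subset_of_card_le ?_ ?_))
    · intro e he
      by_cases hea : e = a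
      · rw [hea]; exact haJ
      · have : e ∈ K.1.erase (a : Vec d) := Finset.mem_erase.2 ⟨hea, he⟩
        rw [hF] at this
        exact (Finset.mem_erase.1 this).2
    · rw [T.card_eq _ K.2, T.card_eq _ J.2]
  have hc0 : 0 < c := by
    refine lt_of_le_of_ne hcn fun h0 => ?_
    have := hcoord a
    rw [← h0, zero_mul, hK.coord_self] at this
    exact one_ne_zero this
  obtain ⟨x, hx⟩ := hK.exists_mem_faceInterior hd a
  have hxpos := (hK.mem_faceInterior.1 hx)
  have hxJ : x ∈ closedSimplex J.1 := by
    have := hx.1; rw [hF] at this; exact (hJ.mem_face.1 this).1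
  -- If `c` were positive, a short step from an inner point of the face towards `b` would stay in
  -- both elements; but there the coordinate of `a`, which is not a vertex of `J`, must vanish.
  have hev : ∀ᶠ t in 𝓝 (0 : ℝ), ∀ e : K.1, e ≠ a → 0 < hK.coord e (AffineMap.lineMap x (b : Vec d) t) := by
    rw [eventually_all]
    intro e
    by_cases he : e = a
    · exact Eventually.of_forall fun t h => absurd he h
    · have hcont : Continuous fun t : ℝ => hK.coord e (AffineMap.lineMap x (b : Vec d) t) :=
        (hK.continuous_coord e).comp AffineMap.lineMap_continuous
      have h0 : 0 < hK.coord e (AffineMap.lineMap x (b : Vec d) (0 : ℝ)) := by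
        simpa using hxpos.2 e he
      filter_upwards [hcont.continuousAt.eventually (lt_mem_nhds h0)] with t ht _ using ht
  obtain ⟨ε, hε, hball⟩ := Metric.eventually_nhds_iff.1 hev
  set t := min (ε / 2) 1 with ht
  have ht0 : 0 < t := lt_min (by positivity) one_pos
  have ht1 : t ≤ 1 := min_le_right _ _
  have htε : dist t 0 < ε := by
    rw [Real.dist_eq, sub_zero, abs_of_pos ht0]
    exact (min_le_left _ _).trans_lt (by linarith)
  set y := AffineMap.lineMap x (b : Vec d) t with hy
  have hya : hK.coord a y = t * c := by
    rw [hy, AffineMap.apply_lineMap, AffineMap.lineMap_apply_ring', hxpos.1, ← hc]; ring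
  have hyK : y ∈ closedSimplex K.1 := hK.mem_closedSimplex.2 fun e => by
    by_cases he : e = a
    · rw [he, hya]; positivity
    · exact (hball htε e he).le
  have hyJ : y ∈ closedSimplex J.1 := by
    have := (convex_closedSimplex J.1).lineMap_mem hxJ (vertex_mem_closedSimplex b.2)
      (t := t) ⟨ht0.le, ht1⟩
    exact this
  have h0 := T.coord_eq_zero K.2 J.2 hyK hyJ a haJ
  have : hK.coord a y = 0 := h0
  rw [hya] at this
  exact (mul_pos ht0 hc0).ne' this

/-- Each normal is a negative multiple of the gradient of the coordinate that vanishes on the face.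
The two coordinates are negative multiples of each other, and the unit lengths fix the factor as
`-1`. -/
lemma outerNormal_eq_neg (hd : 1 ≤ d) {F : Finset (Vec d)} (hF : F ∈ T.faces) {K J : T.elems}
    (hne : K ≠ J) (hKF : K ∈ T.neighbours F) (hJF : J ∈ T.neighbours F) :
    outerNormal K.1 F = -outerNormal J.1 F := by
  obtain ⟨a, ha⟩ := exists_eq_erase hF hKF
  obtain ⟨b, hb⟩ := exists_eq_erase hF hJF
  have hK := T.isSimplex K.2
  have hJ := T.isSimplex J.2
  obtain ⟨c, hc, hcoord⟩ := exists_coord_eq_neg_mul hd hne (ha.symm.trans hb)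
  have hn1 := hK.norm_outerNormal hd a
  have hn2 := hJ.norm_outerNormal hd b
  have hh1 := hK.height_pos hd a
  have hh2 := hJ.height_pos hd b
  have hlin : ∀ ξ, inner ℝ (outerNormal K.1 (K.1.erase a)) ξ =
      inner ℝ ((hK.height a * c / hJ.height b) • outerNormal J.1 (J.1.erase b)) ξ := by
    intro ξ
    have e1 := hK.inner_outerNormal_sub hd a ξ 0
    have e2 := hJ.inner_outerNormal_sub hd b ξ 0
    rw [hcoord, hcoord] at e1
    rw [sub_zero] at e1 e2
    rw [inner_smul_left, e1, e2]
    simp only [conj_trivial]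
    field_simp
  have heq := ext_inner_right ℝ hlin
  rw [← ha, ← hb] at heq
  rw [← ha] at hn1
  rw [← hb] at hn2
  set κ := hK.height a * c / hJ.height b
  have hκ : κ < 0 := div_neg_of_neg_of_pos (mul_neg_of_pos_of_neg hh1 hc) hh2
  have : |κ| = 1 := by
    rw [heq, norm_smul, hn2, mul_one] at hn1
    exact hn1
  rw [abs_of_neg hκ] at this
  rw [heq, show κ = -1 by linarith, neg_one_smul]

/-- Three elements at one face would have pairwise opposite unit normals, which is impossible. -/
lemma card_neighbours (hd : 1 ≤ d) {F : Finset (Vec d)} (hF : F ∈ T.faces) :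
    (T.neighbours F).card = 1 ∨ (T.neighbours F).card = 2 := by
  have h1 := (neighbours_nonempty hF).card_pos
  have h2 : ¬ 2 < (T.neighbours F).card := by
    intro h
    obtain ⟨K, hK, J, hJ, L, hL, hKJ, hKL, hJL⟩ := Finset.two_lt_card.1 h
    have e1 := outerNormal_eq_neg hd hF hKJ hK hJ
    have e2 := outerNormal_eq_neg hd hF hKL hK hL
    have e3 := outerNormal_eq_neg hd hF hJL hJ hL
    obtain ⟨a, ha⟩ := exists_eq_erase hF hK
    have hn := (T.isSimplex K.2).norm_outerNormal hd a
    rw [← ha] at hn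
    have : outerNormal K.1 F = 0 := by
      rw [e3, ← e2] at e1
      have h2 : (2 : ℝ) • outerNormal K.1 F = 0 := by
        rw [two_smul]; nth_rewrite 1 [e1]; exact neg_add_cancel _
      simpa using h2
    rw [this, norm_zero] at hn
    exact zero_ne_one hn
  omega

/-- Points close to `x` lie only in elements that contain `x`. -/
lemma eventually_mem_of_mem (T : Mesh d) (x : Vec d) :
    ∀ᶠ y in 𝓝 x, ∀ J ∈ T.elems, y ∈ closedSimplex J → x ∈ closedSimplex J := by
  rw [eventually_all_finset]
  intro J _
  by_cases hx : x ∈ closedSimplex J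
  · exact Eventually.of_forall fun _ _ => hx
  · filter_upwards [(isCompact_closedSimplex J).isClosed.isOpen_compl.mem_nhds hx] with y hy h
    exact absurd h hy

/-- If `x` were in `Ω`, a short step along the outer normal would end in some element, which for
small steps contains `x` too and hence the whole face. The only such element is `K`, but the step
has left `K`. -/
lemma faceInterior_disjoint_of_boundary (hd : 1 ≤ d) (hT : T.Triangulates Ω)
    (hΩ : interior (closure Ω) = Ω) {F : Finset (Vec d)} (hF : F ∈ T.faces)
    (h1 : (T.neighbours F).card = 1) {x : Vec d} (hx : x ∈ faceInterior F) : x ∉ Ω := by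
  intro hxΩ
  obtain ⟨K, hKs⟩ := Finset.card_eq_one.1 h1
  have hKF : K ∈ T.neighbours F := by rw [hKs]; simp
  obtain ⟨a, ha⟩ := exists_eq_erase hF hKF
  have hK := T.isSimplex K.2
  set n := outerNormal K.1 (K.1.erase a) with hn
  have hn1 := hK.norm_outerNormal hd a
  have hnhds : closure Ω ∈ 𝓝 x := by
    rw [← hΩ] at hxΩ; exact mem_interior_iff_mem_nhds.1 hxΩ
  have hcont : Tendsto (fun t : ℝ => x + t • n) (𝓝[>] 0) (𝓝 x) := by
    have : Continuous fun t : ℝ => x + t • n := by fun_prop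
    have h := this.tendsto 0
    simp only [zero_smul, add_zero] at h
    exact h.mono_left nhdsWithin_le_nhds
  obtain ⟨t, ⟨ht1, ht2⟩, ht0⟩ := ((hcont.eventually ((eventually_mem_of_mem T x).and
    (show ∀ᶠ y in 𝓝 x, y ∈ closure Ω from hnhds))).and self_mem_nhdsWithin).exists
  have ht0 : 0 < t := ht0
  rw [← hT] at ht2
  simp only [Set.mem_iUnion] at ht2
  obtain ⟨J, hJ, hyJ⟩ := ht2
  have hxJ := ht1 J hJ hyJ
  rw [ha] at hx
  have hsub := subset_of_mem_faceInterior K a hJ hx hxJ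
  rw [← ha] at hsub
  have hJF : (⟨J, hJ⟩ : T.elems) ∈ T.neighbours F := mem_neighbours.2 hsub
  rw [hKs, Finset.mem_singleton] at hJF
  have hyK : x + t • n ∈ closedSimplex K.1 := by rw [← hJF]; exact hyJ
  have h2 := hK.inner_outerNormal_sub hd a (x + t • n) x
  rw [add_sub_cancel_left, inner_smul_right, ← hn, real_inner_self_eq_norm_sq, hn1,
    (hK.mem_faceInterior.1 hx).1] at h2
  have h3 := hK.mem_closedSimplex.1 hyK a
  have h4 := hK.height_pos hd a
  nlinarith

/-- Boundary faces do not meet the domain. -/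
lemma disjoint_of_boundary (hd : 1 ≤ d) (hT : T.Triangulates Ω) (hΩ : interior (closure Ω) = Ω)
    {F : Finset (Vec d)} (hF : F ∈ T.faces) (h1 : (T.neighbours F).card = 1) {x : Vec d}
    (hx : x ∈ closedSimplex F) : x ∉ Ω := by
  intro hxΩ
  obtain ⟨K, hKF⟩ := neighbours_nonempty hF
  obtain ⟨a, ha⟩ := exists_eq_erase hF hKF
  have hK := T.isSimplex K.2
  obtain ⟨y, hy⟩ := hK.exists_mem_faceInterior hd a
  have hopen : IsOpen Ω := by rw [← hΩ]; exact isOpen_interior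
  have hcont : Tendsto (fun t : ℝ => AffineMap.lineMap x y t) (𝓝[>] 0) (𝓝 x) := by
    have h : Continuous fun t : ℝ => (AffineMap.lineMap x y t : Vec d) := AffineMap.lineMap_continuous
    have h2 := h.tendsto 0
    simp only [AffineMap.lineMap_apply_zero] at h2
    exact h2.mono_left nhdsWithin_le_nhds
  -- As `Ω` is open, it would also contain inner points of the face on the segment from `x` to `y`.
  obtain ⟨t, ht, ht0, ht1⟩ := ((hcont.eventually (hopen.mem_nhds hxΩ)).and
    (Ioo_mem_nhdsGT (one_pos : (0 : ℝ) < 1))).exists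
  refine faceInterior_disjoint_of_boundary hd hT hΩ hF h1 ?_ ht
  rw [ha] at hx ⊢
  have hx' := hK.mem_face.1 hx
  have hy' := hK.mem_faceInterior.1 hy
  refine hK.mem_faceInterior.2 ⟨?_, fun b hb => ?_⟩
  · rw [AffineMap.apply_lineMap, hx'.2, hy'.1]; simp
  · rw [AffineMap.apply_lineMap, AffineMap.lineMap_apply_ring]
    have p1 := hK.mem_closedSimplex.1 hx'.1 b
    have p2 := hy'.2 b hb
    have : 0 < 1 - t := by linarith
    positivity

/-- Near an inner point of the face all other coordinates are positive, so the sign of the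
coordinate of `a` decides whether a point lies in `K` or in `J`. A full neighbourhood thus lies in
`closure Ω`. -/
lemma faceInterior_subset_of_interior (hd : 1 ≤ d) (hT : T.Triangulates Ω)
    (hΩ : interior (closure Ω) = Ω) {F : Finset (Vec d)} (hF : F ∈ T.faces)
    {K J : T.elems} (hne : K ≠ J) (hKF : K ∈ T.neighbours F) (hJF : J ∈ T.neighbours F) :
    faceInterior F ⊆ Ω := by
  intro x hx
  obtain ⟨a, ha⟩ := exists_eq_erase hF hKF
  obtain ⟨b, hb⟩ := exists_eq_erase hF hJF
  obtain ⟨c, hc, hcoord⟩ := exists_coord_eq_neg_mul hd hne (ha.symm.trans hb)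
  have key : ∀ (L : T.elems) (e : L.1), F = L.1.erase (e : Vec d) →
      ∀ᶠ y in 𝓝 x, 0 ≤ (T.isSimplex L.2).coord e y → y ∈ closedSimplex L.1 := by
    intro L e he
    have hL := T.isSimplex L.2
    rw [he] at hx
    have hx' := hL.mem_faceInterior.1 hx
    have hev : ∀ᶠ y in 𝓝 x, ∀ i : L.1, i ≠ e → 0 < hL.coord i y := by
      rw [eventually_all]
      intro i
      by_cases hi : i = e
      · exact Eventually.of_forall fun _ h => absurd hi h
      · filter_upwards [(hL.continuous_coord i).continuousAt.eventually
          (lt_mem_nhds (hx'.2 i hi))] with y hy _ using hy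
    filter_upwards [hev] with y hy h0
    refine hL.mem_closedSimplex.2 fun i => ?_
    by_cases hi : i = e
    · rw [hi]; exact h0
    · exact (hy i hi).le
  rw [← hΩ, mem_interior_iff_mem_nhds]
  filter_upwards [key K a ha, key J b hb] with y hyK hyJ
  rcases le_total 0 ((T.isSimplex K.2).coord a y) with h | h
  · exact closedSimplex_subset_closure hT K.2 (hyK h)
  · refine closedSimplex_subset_closure hT J.2 (hyJ ?_)
    rw [hcoord] at h
    nlinarith

lemma faceInterior_notMem_of_ne {F F' : Finset (Vec d)} (hF : F ∈ T.faces) (hF' : F' ∈ T.faces)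
    (hne : F' ≠ F) {x : Vec d} (hx : x ∈ faceInterior F) : x ∉ closedSimplex F' := by
  intro hxF'
  obtain ⟨K, hKF⟩ := neighbours_nonempty hF
  obtain ⟨a, ha⟩ := exists_eq_erase hF hKF
  obtain ⟨J, hJF'⟩ := neighbours_nonempty hF'
  obtain ⟨c, hc⟩ := exists_eq_erase hF' hJF'
  have hJ := T.isSimplex J.2
  have hxJ : x ∈ closedSimplex J.1 :=
    convexHull_mono (Finset.coe_subset.2 (mem_neighbours.1 hJF')) hxF'
  have hx1 := hx
  rw [ha] at hx1
  have hsub := subset_of_mem_faceInterior K a J.2 hx1 hxJ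
  rw [← ha] at hsub
  obtain ⟨b, hb⟩ := exists_eq_erase hF (mem_neighbours.2 hsub : J ∈ T.neighbours F)
  have hbc : c ≠ b := by rintro rfl; exact hne (hc.trans hb.symm)
  rw [hb] at hx
  rw [hc] at hxF'
  exact ((hJ.mem_faceInterior.1 hx).2 c hbc).ne' (hJ.mem_face.1 hxF').2

/-! ### Shape regularity -/

lemma shapeRegularity_le (K : T.elems) :
    T.shapeRegularity ≤ inradius K.1 / simplexDiam K.1 :=
  ciInf_le (Set.finite_range _).bddBelow K

lemma mul_diam_le_height (hd : 1 ≤ d) {μ : ℝ} (hμ : 0 < μ) (h : μ ≤ T.shapeRegularity)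
    (K : T.elems) (a : K.1) : μ * simplexDiam K.1 ≤ (T.isSimplex K.2).height a := by
  have hK := T.isSimplex K.2
  have hD := hK.simplexDiam_pos hd
  have h1 := h.trans (shapeRegularity_le K)
  rw [le_div_iff₀ hD] at h1
  have h2 := hK.two_mul_inradius_le_height hd a
  have : 0 < μ * simplexDiam K.1 := by positivity
  linarith

/-- For `d ≥ 2` the distance of two vertices of the face is at least a height of `K`, hence at least
`μ` times the diameter. For `d = 1` the face size is a maximum of diameters and the factor `1`
suffices; `min μ 1` covers both. -/
lemma mul_diam_le_faceSize (hd : 1 ≤ d) {μ : ℝ} (hμ : 0 < μ) (h : μ ≤ T.shapeRegularity)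
    {F : Finset (Vec d)} (hF : F ∈ T.faces) {K : T.elems} (hKF : K ∈ T.neighbours F) :
    min μ 1 * simplexDiam K.1 ≤ T.faceSize F := by
  have hK := T.isSimplex K.2
  have hD := hK.simplexDiam_pos hd
  rw [faceSize]
  split_ifs with hd1
  · calc min μ 1 * simplexDiam K.1 ≤ 1 * simplexDiam K.1 := by gcongr; exact min_le_right _ _
      _ = simplexDiam K.1 := one_mul _
      _ ≤ _ := le_ciSup (f := fun K : T.neighbours F => simplexDiam K.1.1)
          (Set.finite_range _).bddAbove ⟨K, hKF⟩
  · obtain ⟨a, ha⟩ := exists_eq_erase hF hKF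
    have hcard : 1 < F.card := by
      rw [ha, Finset.card_erase_of_mem a.2, hK.card_eq]; omega
    obtain ⟨b, hb, c, hc, hbc⟩ := Finset.one_lt_card.1 hcard
    have hbK : b ∈ K.1 := mem_neighbours.1 hKF hb
    have hcK : c ∈ K.1 := mem_neighbours.1 hKF hc
    have h1 : hK.coord ⟨b, hbK⟩ c ≤ 0 := by
      have := hK.coord_ne (a := ⟨b, hbK⟩) (b := ⟨c, hcK⟩) fun h => hbc (congrArg Subtype.val h)
      exact this.le
    have h2 := hK.height_le_dist hd ⟨b, hbK⟩ h1
    have h3 : dist c b ≤ Metric.diam (closedSimplex F) :=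
      Metric.dist_le_diam_of_mem (isCompact_closedSimplex F).isBounded
        (vertex_mem_closedSimplex hc) (vertex_mem_closedSimplex hb)
    have h4 := mul_diam_le_height hd hμ h K ⟨b, hbK⟩
    calc min μ 1 * simplexDiam K.1 ≤ μ * simplexDiam K.1 := by gcongr; exact min_le_left _ _
      _ ≤ _ := h4.trans (h2.trans h3)

lemma simplexDiam_le_meshsize {x : Vec d} (K : T.elems) (hx : x ∈ closedSimplex K.1) :
    simplexDiam K.1 ≤ T.meshsize x := by
  have : Finite {K : Finset (Vec d) // K ∈ T.elems ∧ x ∈ closedSimplex K} :=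
    Finite.of_injective (β := T.elems) (fun K => ⟨K.1, K.2.1⟩) fun a b h => by
      simpa [Subtype.ext_iff] using h
  exact le_ciSup (f := fun K : {K : Finset (Vec d) // K ∈ T.elems ∧ x ∈ closedSimplex K} =>
    simplexDiam K.1) (Set.finite_range _).bddAbove ⟨K.1, K.2, hx⟩

/-- The value depends on `x` only through the finite set of closed elements that contain `x`. -/
lemma measurable_meshsize (T : Mesh d) : Measurable T.meshsize := by
  let p : Vec d → T.elems → Prop := fun x K => x ∈ closedSimplex K.1
  have hp : Measurable p := measurable_pi_iff.2 fun K =>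
    (isCompact_closedSimplex K.1).measurableSet.mem
  let g : (T.elems → Prop) → ℝ := fun P =>
    ⨆ K : {K : Finset (Vec d) // ∃ h : K ∈ T.elems, P ⟨K, h⟩}, simplexDiam K.1
  have hg : Measurable g := measurable_of_countable g
  have : T.meshsize = g ∘ p := by
    ext x
    have e : (fun K : Finset (Vec d) => K ∈ T.elems ∧ x ∈ closedSimplex K) =
        fun K => ∃ h : K ∈ T.elems, p x ⟨K, h⟩ := by
      ext K; simp [p]
    exact congrArg (fun P : Finset (Vec d) → Prop => ⨆ K : Subtype P, simplexDiam K.1) e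
  rw [this]
  exact hg.comp hp

end Mesh

end MeshTopology

/-! ### Traces of globally defined functions on the faces of a mesh -/

section MeshTraces

variable {d : ℕ} {T : Mesh d} {Ω : Set (Vec d)}

lemma gradient_eq_zero_of_notMem_tsupport {φ : Vec d → ℝ} {x : Vec d} (hx : x ∉ tsupport φ) :
    ∇ φ x = 0 := by
  have : fderiv ℝ φ x = 0 := by
    by_contra h
    exact hx (support_fderiv_subset ℝ h)
  rw [gradient, this, map_zero]

lemma HasWeakPartial.mono {U : Set (Vec d)} (hΩm : MeasurableSet Ω) (hU : U ⊆ Ω) {i : Fin d}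
    {w w' : Vec d → ℝ} (h : HasWeakPartial Ω i w w') : HasWeakPartial U i w w' := by
  intro φ hφ
  have h1 : ∫ x in Ω, w x * (∇ φ x) i = ∫ x in U, w x * (∇ φ x) i :=
    setIntegral_eq_of_subset_of_forall_sdiff_eq_zero hΩm hU fun x hx => by
      rw [gradient_eq_zero_of_notMem_tsupport fun h' => hx.2 (hφ.2.2 h')]; simp
  have h2 : ∫ x in Ω, w' x * φ x = ∫ x in U, w' x * φ x :=
    setIntegral_eq_of_subset_of_forall_sdiff_eq_zero hΩm hU fun x hx => by
      rw [image_eq_zero_of_notMem_tsupport fun h' => hx.2 (hφ.2.2 h')]; simp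
  rw [← h1, ← h2]
  exact h φ ⟨hφ.1, hφ.2.1, hφ.2.2.trans hU⟩

lemma isOpen_domain (hΩ : interior (closure Ω) = Ω) : IsOpen Ω := by
  rw [← hΩ]; exact isOpen_interior

/-- A weakly differentiable function is on each element a limit of smooth functions. -/
lemma exists_h1Limit (hT : T.Triangulates Ω) (hΩ : interior (closure Ω) = Ω) {w : Vec d → ℝ}
    {G : Vec d → Vec d} (hw : MemLp w 2 (volume.restrict Ω)) (hG : MemLp G 2 (volume.restrict Ω))
    (hweak : ∀ i, HasWeakPartial Ω i w fun x => G x i) (K : T.elems) :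
    ∃ φ, H1Limit K.1 φ w G := by
  have hle := Mesh.restrict_openSimplex_le hT hΩ K
  obtain ⟨φ, h1, h2, h3⟩ := exists_contDiff_tendsto (isOpen_openSimplex K.1)
    (convex_openSimplex K.1) (isBounded_openSimplex K.1) (T.isSimplex K.2).nonempty_openSimplex
    (hw.mono_measure hle) (hG.mono_measure hle) fun i =>
      (hweak i).mono (isOpen_domain hΩ).measurableSet (Mesh.openSimplex_subset_domain hT hΩ K.2)
  exact ⟨φ, fun n => (h1 n).of_le (by norm_num), hw.mono_measure hle, hG.mono_measure hle,
    tendsto_l2Norm_of_eLpNorm h2, tendsto_l2Norm_of_eLpNorm h3⟩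

/-- One sequence of test functions serves all elements. The traces of an `H¹₀` function therefore
agree from both sides automatically and vanish on the boundary. -/
lemma MemH10.exists_h1Limit (hT : T.Triangulates Ω) (hΩ : interior (closure Ω) = Ω)
    {v : Vec d → ℝ} {G : Vec d → Vec d} (h : MemH10 Ω v G) :
    ∃ φ : ℕ → Vec d → ℝ, (∀ n, IsTest Ω (φ n)) ∧ ∀ K : T.elems, H1Limit K.1 φ v G := by
  obtain ⟨hv, hG, φ, hφ, h1, h2⟩ := h
  refine ⟨φ, hφ, fun K => ?_⟩
  have hle := Mesh.restrict_openSimplex_le hT hΩ K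
  refine ⟨fun n => (hφ n).1.of_le (by norm_num), hv.mono_measure hle, hG.mono_measure hle, ?_, ?_⟩
  · refine tendsto_l2Norm_of_eLpNorm (tendsto_of_tendsto_of_tendsto_of_le_of_le tendsto_const_nhds h1
      (fun n => zero_le) fun n => eLpNorm_mono_measure _ hle)
  · refine tendsto_l2Norm_of_eLpNorm (tendsto_of_tendsto_of_tendsto_of_le_of_le tendsto_const_nhds h2
      (fun n => zero_le) fun n => eLpNorm_mono_measure _ hle)

namespace Mesh

lemma exists_trace (hd : 1 ≤ d) {F : Finset (Vec d)} (hF : F ∈ T.faces) {K : T.elems}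
    (hK : K ∈ T.neighbours F) {φ : ℕ → Vec d → ℝ} {w : Vec d → ℝ} {G : Vec d → Vec d}
    (h : H1Limit K.1 φ w G) : ∃ τ, TraceLimit (faceMeasure F) φ τ := by
  obtain ⟨a, rfl⟩ := exists_eq_erase hF hK
  exact h.exists_trace (T.isSimplex K.2) hd a

/-- The trace of an `H¹₀` function vanishes on the boundary. -/
lemma trace_eq_zero (hd : 1 ≤ d) (hT : T.Triangulates Ω) (hΩ : interior (closure Ω) = Ω)
    {F : Finset (Vec d)} (hF : F ∈ T.faces) (h1 : (T.neighbours F).card = 1)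
    {φ : ℕ → Vec d → ℝ} (hφ : ∀ n, IsTest Ω (φ n)) {τ : Vec d → ℝ}
    (hτ : TraceLimit (faceMeasure F) φ τ) : ∀ᵐ x ∂(faceMeasure F), τ x = 0 := by
  -- Test functions vanish on boundary faces, so the distances to the trace form a constant
  -- sequence, which tends to zero.
  have h0 : ∀ n, l2Norm (faceMeasure F) (fun x => φ n x - τ x) = l2Norm (faceMeasure F) τ := by
    intro n
    rw [l2Norm_sub_comm]
    refine l2Norm_congr ?_
    filter_upwards [ae_mem_faceMeasure F] with x hx
    have hxΩ := disjoint_of_boundary hd hT hΩ hF h1 hx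
    rw [image_eq_zero_of_notMem_tsupport fun h' => hxΩ ((hφ n).2.2 h'), sub_zero]
  have h2 := hτ.tendsto
  simp only [h0] at h2
  have h3 : l2Norm (faceMeasure F) τ = 0 := tendsto_nhds_unique tendsto_const_nhds h2
  rw [l2Norm, ENNReal.toReal_eq_zero_iff] at h3
  rcases h3 with h3 | h3
  · rw [eLpNorm_eq_zero_iff hτ.memLp.1 (by norm_num)] at h3
    exact h3
  · exact absurd h3 hτ.memLp.eLpNorm_ne_top

/-- The two traces of a weakly differentiable function on an interior face agree. -/
lemma trace_eq_trace (hd : 1 ≤ d) (hT : T.Triangulates Ω) (hΩ : interior (closure Ω) = Ω)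
    {w : Vec d → ℝ} {G : Vec d → Vec d} (hw : MemLp w 2 (volume.restrict Ω))
    (hG : MemLp G 2 (volume.restrict Ω)) (hweak : ∀ i, HasWeakPartial Ω i w fun x => G x i)
    {ψ : T.elems → ℕ → Vec d → ℝ} (hψ : ∀ K, H1Limit K.1 (ψ K) w G)
    {τ : T.elems → Finset (Vec d) → Vec d → ℝ}
    (hτ : ∀ K, ∀ F ∈ T.faces, K ∈ T.neighbours F → TraceLimit (faceMeasure F) (ψ K) (τ K F))
    {F : Finset (Vec d)} (hF : F ∈ T.faces) {K J : T.elems} (hne : K ≠ J)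
    (hFKJ : T.neighbours F = {K, J}) :
    τ K F =ᵐ[faceMeasure F] τ J F := by
  have hKF : K ∈ T.neighbours F := by rw [hFKJ]; simp
  have hJF : J ∈ T.neighbours F := by rw [hFKJ]; simp
  obtain ⟨a, ha⟩ := exists_eq_erase hF hKF
  have hK := T.isSimplex K.2
  have hfin : IsFiniteMeasure (faceMeasure F) := by
    rw [ha]; exact hK.isFiniteMeasure_faceMeasure hd a
  -- Test functions supported in `U` see no face other than `F`.
  set U := Ω \ ⋃ F' ∈ T.faces.erase F, closedSimplex F' with hU
  have hclosed : IsClosed (⋃ F' ∈ T.faces.erase F, closedSimplex F') :=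
    (T.faces.erase F).finite_toSet.isClosed_biUnion fun F' _ => (isCompact_closedSimplex F').isClosed
  have hUo : IsOpen U := (isOpen_domain hΩ).sdiff hclosed
  have hFU : faceInterior F ⊆ U := by
    intro x hx
    refine ⟨faceInterior_subset_of_interior hd hT hΩ hF hne hKF hJF hx, ?_⟩
    simp only [Set.mem_iUnion, not_exists]
    intro F' hF'
    have := Finset.mem_erase.1 hF'
    exact faceInterior_notMem_of_ne hF this.2 this.1 hx
  have hmK := (hτ K F hF hKF).memLp
  have hmJ := (hτ J F hF hJF).memLp
  have hdiff : Integrable (fun x => τ K F x - τ J F x) (faceMeasure F) :=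
    (hmK.sub hmJ).integrable (by norm_num)
  have hz : ∀ g : Vec d → ℝ, ContDiff ℝ ∞ g → HasCompactSupport g → tsupport g ⊆ U →
      ∫ x, g x • (τ K F x - τ J F x) ∂(faceMeasure F) = 0 := by
    intro g hg hgc hgU
    have hg1 : ContDiff ℝ 1 g := hg.of_le (by norm_num)
    have htest : IsTest Ω g := ⟨hg, hgc, hgU.trans Set.sdiff_subset⟩
    have hgL : MemLp g 2 (volume.restrict Ω) :=
      (hg.continuous.memLp_of_hasCompactSupport hgc).restrict Ω
    have hggL : MemLp (∇ g) 2 (volume.restrict Ω) := by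
      refine ((continuous_gradient hg1).memLp_of_hasCompactSupport ?_).restrict Ω
      refine HasCompactSupport.of_support_subset_isCompact hgc fun x hx => ?_
      by_contra h
      exact hx (gradient_eq_zero_of_notMem_tsupport h)
    have hcomp : ∀ i, outerNormal K.1 F i *
        ∫ x, g x • (τ K F x - τ J F x) ∂(faceMeasure F) = 0 := by
      intro i
      -- By the definition of the weak derivative the volume terms cancel in total. Integrating by
      -- parts on each element then leaves only `F`, where the opposite normals produce the
      -- difference of the traces.
      have hsum : ∑ L : T.elems, ((∫ x in openSimplex L.1, G x i * g x) +
          ∫ x in openSimplex L.1, w x * (∇ g x) i) = 0 := by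
        rw [Finset.sum_add_distrib,
          ← integral_domain hT hΩ (integrable_mul_of_memLp (H1Limit.memLp_apply hG i) hgL),
          ← integral_domain hT hΩ (integrable_mul_of_memLp hw (H1Limit.memLp_apply hggL i)),
          hweak i g htest]
        ring
      have hparts : ∀ L : T.elems, (∫ x in openSimplex L.1, G x i * g x) +
          ∫ x in openSimplex L.1, w x * (∇ g x) i =
          ∑ e : L.1, outerNormal L.1 (L.1.erase e) i *
            ∫ x, τ L (L.1.erase e) x * g x ∂(faceMeasure (L.1.erase (e : Vec d))) := fun L =>
        (hψ L).integral_by_parts (T.isSimplex L.2) hd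
          (τ := fun e => τ L (L.1.erase e))
          (fun e => hτ L _ (erase_mem_faces L e) (mem_neighbours_erase L e)) hg1 i
      simp only [hparts] at hsum
      rw [sum_elems_faces fun L F' => outerNormal L.1 F' i *
        ∫ x, τ L F' x * g x ∂(faceMeasure F')] at hsum
      rw [Finset.sum_eq_single_of_mem F hF, hFKJ, Finset.sum_pair hne,
        outerNormal_eq_neg hd hF hne.symm hJF hKF] at hsum
      · rw [← hsum]
        have e : ∀ x, g x • (τ K F x - τ J F x) = τ K F x * g x - τ J F x * g x := fun x => by
          rw [smul_eq_mul]; ring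
        have hgF : MemLp g 2 (faceMeasure F) := by
          rw [ha]; exact memLp_faceMeasure hK hd a hg.continuous
        simp only [e]
        rw [integral_sub (integrable_mul_of_memLp hmK hgF) (integrable_mul_of_memLp hmJ hgF)]
        simp only [PiLp.neg_apply]
        ring
      · intro F' hF' hne'
        refine Finset.sum_eq_zero fun L _ => ?_
        have : ∫ x, τ L F' x * g x ∂(faceMeasure F') = 0 := by
          rw [integral_eq_zero_of_ae]
          filter_upwards [ae_mem_faceMeasure F'] with x hx
          have : g x = 0 := by
            refine image_eq_zero_of_notMem_tsupport fun h' => (hgU h').2 ?_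
            exact Set.mem_biUnion (Finset.mem_erase.2 ⟨hne', hF'⟩) hx
          simp [this]
        rw [this, mul_zero]
    have hn0 : outerNormal K.1 F ≠ 0 := by
      intro h0
      have := hK.norm_outerNormal hd a
      rw [← ha, h0, norm_zero] at this
      exact zero_ne_one this
    obtain ⟨i, hi⟩ : ∃ i, outerNormal K.1 F i ≠ 0 := by
      by_contra hcon
      push Not at hcon
      exact hn0 (by ext i; simpa using hcon i)
    exact (mul_eq_zero.1 (hcomp i)).resolve_left hi
  have hae := hUo.ae_eq_zero_of_integral_contDiff_smul_eq_zero
    (hdiff.locallyIntegrable.locallyIntegrableOn U) hz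
  have hint : ∀ᵐ x ∂(faceMeasure F), x ∈ faceInterior F := by
    rw [ha]; exact hK.faceInterior_ae hd a
  filter_upwards [hae, hint] with x hx hxF
  exact sub_eq_zero.1 (hx (hFU hxF))

/-- Needed for the components of `∇z`, which are approximated by a different sequence on each
element; the trace from one side is a limit for the other side as well, because the two agree almost
everywhere. -/
lemma exists_common_trace (hd : 1 ≤ d) (hT : T.Triangulates Ω) (hΩ : interior (closure Ω) = Ω)
    {w : Vec d → ℝ} {G : Vec d → Vec d} (hw : MemLp w 2 (volume.restrict Ω))
    (hG : MemLp G 2 (volume.restrict Ω)) (hweak : ∀ i, HasWeakPartial Ω i w fun x => G x i)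
    {ψ : T.elems → ℕ → Vec d → ℝ} (hψ : ∀ K, H1Limit K.1 (ψ K) w G)
    {F : Finset (Vec d)} (hF : F ∈ T.faces) :
    ∃ τ, ∀ K ∈ T.neighbours F, TraceLimit (faceMeasure F) (ψ K) τ := by
  have hex : ∀ (K : T.elems) (F : Finset (Vec d)), ∃ τ, F ∈ T.faces → K ∈ T.neighbours F →
      TraceLimit (faceMeasure F) (ψ K) τ := by
    intro K F
    by_cases h : F ∈ T.faces ∧ K ∈ T.neighbours F
    · obtain ⟨τ, hτ⟩ := exists_trace hd h.1 h.2 (hψ K)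
      exact ⟨τ, fun _ _ => hτ⟩
    · exact ⟨0, fun h1 h2 => absurd ⟨h1, h2⟩ h⟩
  choose τ hτ using hex
  rcases card_neighbours hd hF with h1 | h2
  · obtain ⟨K, hK⟩ := Finset.card_eq_one.1 h1
    refine ⟨τ K F, fun J hJ => ?_⟩
    have : J = K := by rw [hK] at hJ; simpa using hJ
    rw [this]
    exact hτ K F hF (by rw [hK]; simp)
  · obtain ⟨K, J, hne, hKJ⟩ := Finset.card_eq_two.1 h2
    have heq := trace_eq_trace hd hT hΩ hw hG hweak hψ hτ hF hne hKJ
    have hKt := hτ K F hF (by rw [hKJ]; simp)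
    have hJt := hτ J F hF (by rw [hKJ]; simp)
    refine ⟨τ K F, fun L hL => ?_⟩
    rw [hKJ] at hL
    rcases Finset.mem_insert.1 hL with rfl | hL
    · exact hKt
    · rw [Finset.mem_singleton.1 hL]
      refine ⟨hKt.memLp, hJt.tendsto.congr fun n => l2Norm_congr ?_⟩
      filter_upwards [heq] with x hx
      rw [hx]

end Mesh

end MeshTraces

/-! ### Piecewise polynomials -/

section Polynomials

variable {d : ℕ}

lemma hasFDerivAt_eval (q : MvPolynomial (Fin d) ℝ) (x : Vec d) :
    HasFDerivAt (fun y : Vec d => MvPolynomial.eval (fun i => y i) q)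
      (∑ i, MvPolynomial.eval (fun j => x j) (MvPolynomial.pderiv i q) •
        (EuclideanSpace.proj i : Vec d →L[ℝ] ℝ)) x := by
  induction q using MvPolynomial.induction_on with
  | C a => simpa using hasFDerivAt_const a x
  | add p q hp hq =>
    simp only [map_add, add_smul, Finset.sum_add_distrib]
    exact hp.add hq
  | mul_X p n hp =>
    simp only [map_mul, MvPolynomial.eval_X]
    have hX : HasFDerivAt (fun y : Vec d => y n) (EuclideanSpace.proj n : Vec d →L[ℝ] ℝ) x :=
      (EuclideanSpace.proj n : Vec d →L[ℝ] ℝ).hasFDerivAt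
    refine (hp.mul hX).congr_fderiv ?_
    ext y
    simp [MvPolynomial.pderiv_X, Pi.single_apply, add_mul, Finset.sum_add_distrib, Finset.mul_sum,
      apply_ite]
    ring_nf

lemma contDiff_eval (q : MvPolynomial (Fin d) ℝ) :
    ContDiff ℝ 1 fun y : Vec d => MvPolynomial.eval (fun i => y i) q := by
  induction q using MvPolynomial.induction_on with
  | C a => simpa using contDiff_const
  | add p q hp hq => simpa using hp.add hq
  | mul_X p n hp =>
    simp only [map_mul, MvPolynomial.eval_X]
    exact hp.mul (EuclideanSpace.proj n : Vec d →L[ℝ] ℝ).contDiff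

lemma gradient_eval (q : MvPolynomial (Fin d) ℝ) (x : Vec d) (i : Fin d) :
    (∇ (fun y : Vec d => MvPolynomial.eval (fun i => y i) q) x) i =
      MvPolynomial.eval (fun j => x j) (MvPolynomial.pderiv i q) := by
  rw [gradient_apply, (hasFDerivAt_eval q x).fderiv]
  simp

/-- The affine function `x ↦ α + m · x` as a polynomial. -/
def affinePoly (α : ℝ) (m : Vec d) : MvPolynomial (Fin d) ℝ :=
  MvPolynomial.C α + ∑ i, MvPolynomial.C (m i) * MvPolynomial.X i

lemma eval_affinePoly (α : ℝ) (m x : Vec d) :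
    MvPolynomial.eval (fun i => x i) (affinePoly α m) = α + inner ℝ m x := by
  simp [affinePoly, PiLp.inner_apply, mul_comm]

lemma pderiv_affinePoly (α : ℝ) (m : Vec d) (i : Fin d) :
    MvPolynomial.pderiv i (affinePoly α m) = MvPolynomial.C (m i) := by
  simp [affinePoly, MvPolynomial.pderiv_X, Pi.single_apply]

lemma totalDegree_affinePoly_le (α : ℝ) (m : Vec d) : (affinePoly α m).totalDegree ≤ 1 := by
  refine (MvPolynomial.totalDegree_add _ _).trans (max_le (by simp) ?_)
  refine MvPolynomial.totalDegree_finsetSum_le fun i _ => ?_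
  refine (MvPolynomial.totalDegree_mul _ _).trans ?_
  simp

namespace Mesh

variable {T : Mesh d}

lemma contDiff_val (p : T.elems → MvPolynomial (Fin d) ℝ) (K : T.elems) :
    ContDiff ℝ 1 (val p K) := contDiff_eval (p K)

lemma continuous_val (p : T.elems → MvPolynomial (Fin d) ℝ) (K : T.elems) :
    Continuous (val p K) := (contDiff_val p K).continuous

lemma gradient_val (p : T.elems → MvPolynomial (Fin d) ℝ) (K : T.elems) (x : Vec d) :
    ∇ (val p K) x = grad p K x := by
  ext i
  exact gradient_eval (p K) x i

lemma continuous_grad (p : T.elems → MvPolynomial (Fin d) ℝ) (K : T.elems) :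
    Continuous (grad p K) := by
  have := continuous_gradient (contDiff_val p K)
  exact this.congr (gradient_val p K)

lemma contDiff_grad_apply (p : T.elems → MvPolynomial (Fin d) ℝ) (K : T.elems) (i : Fin d) :
    ContDiff ℝ 1 fun x => grad p K x i := contDiff_eval _

lemma lap_eq (p : T.elems → MvPolynomial (Fin d) ℝ) (K : T.elems) (x : Vec d) :
    lap p K x = ∑ i, (∇ (fun y => grad p K y i) x) i := by
  refine Finset.sum_congr rfl fun i _ => ?_
  exact (gradient_eval _ x i).symm

lemma continuous_lap (p : T.elems → MvPolynomial (Fin d) ℝ) (K : T.elems) :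
    Continuous (lap p K) :=
  continuous_finsetSum _ fun _ _ => (contDiff_eval _).continuous

lemma val_affinePoly (α : T.elems → ℝ) (m : T.elems → Vec d) (K : T.elems) (x : Vec d) :
    val (fun K => affinePoly (α K) (m K)) K x = α K + inner ℝ (m K) x := eval_affinePoly _ _ _

lemma grad_affinePoly (α : T.elems → ℝ) (m : T.elems → Vec d) (K : T.elems) (x : Vec d) :
    grad (fun K => affinePoly (α K) (m K)) K x = m K := by
  ext i
  simp [grad, pderiv_affinePoly]

lemma affinePoly_mem_dgSpace {k : ℕ} (hk : 1 ≤ k) (α : T.elems → ℝ) (m : T.elems → Vec d) :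
    (fun K => affinePoly (α K) (m K)) ∈ T.dgSpace k := by
  intro K _
  rw [SetLike.mem_coe, MvPolynomial.mem_restrictTotalDegree]
  exact (totalDegree_affinePoly_le _ _).trans hk

lemma memLp_glue (p : T.elems → MvPolynomial (Fin d) ℝ) (Ω : Set (Vec d)) :
    MemLp (glue (val p)) 2 (volume.restrict Ω) := by
  have : MemLp (glue (val p)) 2 volume := by
    refine memLp_finsetSum Finset.univ
      (f := fun (K : T.elems) x => (openSimplex K.1).indicator (val p K) x) fun K _ => ?_
    rw [memLp_indicator_iff_restrict (isOpen_openSimplex K.1).measurableSet]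
    exact memLp_openSimplex K.1 (continuous_val p K)
  exact this.restrict Ω

/-- The pointwise estimate of the consistency term on a face. -/
lemma abs_faceTerm_le (hd : 1 ≤ d) {F : Finset (Vec d)} (hF : F ∈ T.faces)
    {σ : ℝ} (hσ : 0 ≤ σ) (v w : T.Broken ℝ) (q m : T.Broken (Vec d)) {x : Vec d}
    (hx : x ∈ closedSimplex F) {Z : ℝ} (Γ : Vec d) (hZ : (T.neighbours F).card = 1 → Z = 0) :
    |(∑ K ∈ T.neighbours F, (inner ℝ Γ (outerNormal K.1 F) * v K x -
          (Z - w K x) * inner ℝ (q K x) (outerNormal K.1 F))) -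
        (inner ℝ (jump v F x) (avg m F x) + inner ℝ (jump w F x) (avg q F x) -
          σ / T.meshsize x * inner ℝ (jump v F x) (jump w F x))| ≤
      ∑ K ∈ T.neighbours F, (‖jump v F x‖ * ‖Γ - m K x‖ +
        (if (T.neighbours F).card = 2 then 1 else 0) * (|vecJump q F x| * |Z - w K x|) +
        σ / simplexDiam K.1 * (‖jump v F x‖ * |Z - w K x|)) := by
  have hmesh : ∀ K ∈ T.neighbours F, σ / T.meshsize x ≤ σ / simplexDiam K.1 := by
    intro K hK
    have := (T.isSimplex K.2).simplexDiam_pos hd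
    refine div_le_div_of_nonneg_left hσ this (simplexDiam_le_meshsize K ?_)
    exact convexHull_mono (by exact_mod_cast mem_neighbours.1 hK) hx
  have hmesh0 : ∀ K ∈ T.neighbours F, 0 ≤ σ / T.meshsize x := by
    intro K hK
    have := (T.isSimplex K.2).simplexDiam_pos hd
    refine div_nonneg hσ (this.le.trans (simplexDiam_le_meshsize K ?_))
    exact convexHull_mono (by exact_mod_cast mem_neighbours.1 hK) hx
  have hnorm : ∀ K ∈ T.neighbours F, ‖outerNormal K.1 F‖ = 1 := by
    intro K hK
    obtain ⟨a, rfl⟩ := exists_eq_erase hF hK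
    exact (T.isSimplex K.2).norm_outerNormal hd a
  rcases card_neighbours hd hF with h1 | h2
  · obtain ⟨K, hK⟩ := Finset.card_eq_one.1 h1
    have hKF : K ∈ T.neighbours F := by rw [hK]; simp
    have hn := hnorm K hKF
    have hle := hmesh K hKF
    have hs0 := hmesh0 K hKF
    have hZ0 := hZ h1
    simp only [avg, jump, vecJump, hK, Finset.sum_singleton, Finset.card_singleton]
    set n := outerNormal K.1 F
    set s := σ / T.meshsize x
    have hnn : inner ℝ n n = (1 : ℝ) := by rw [real_inner_self_eq_norm_sq, hn]; norm_num
    simp only [inner_smul_left, inner_smul_right, norm_smul, hn, hnn, hZ0, conj_trivial,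
      Nat.cast_one, inv_one, one_smul, mul_one]
    have h1 : |inner ℝ n (Γ - m K x)| ≤ ‖Γ - m K x‖ := by
      simpa [hn] using abs_real_inner_le_norm n (Γ - m K x)
    rw [real_inner_comm, real_inner_comm n (q K x)]
    -- On a boundary face `Z = 0`, and the two terms with `q` cancel: no gradient jump enters there.
    have e : inner ℝ n Γ * v K x - (0 - w K x) * inner ℝ n (q K x) -
        (v K x * inner ℝ n (m K x) + w K x * inner ℝ n (q K x) - s * (w K x * v K x)) =
        v K x * inner ℝ n (Γ - m K x) + s * (v K x * w K x) := by
      rw [inner_sub_right]; ring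
    have e2 : |v K x * inner ℝ n (Γ - m K x)| ≤ |v K x| * ‖Γ - m K x‖ := by
      rw [abs_mul]; gcongr
    have e3 : |s * (v K x * w K x)| ≤ σ / simplexDiam K.1 * (|v K x| * |0 - w K x|) := by
      rw [abs_mul, abs_mul, abs_of_nonneg hs0, zero_sub, abs_neg]; gcongr
    rw [e]
    refine (abs_add_le _ _).trans ((add_le_add e2 e3).trans (le_of_eq ?_))
    norm_num
  · obtain ⟨K, J, hne, hKJ⟩ := Finset.card_eq_two.1 h2
    have hKF : K ∈ T.neighbours F := by rw [hKJ]; simp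
    have hJF : J ∈ T.neighbours F := by rw [hKJ]; simp
    have hn := hnorm K hKF
    have hs0 := hmesh0 K hKF
    have hleK := hmesh K hKF
    have hleJ := hmesh J hJF
    simp only [avg, jump, vecJump, hKJ, Finset.sum_pair hne, Finset.card_pair hne,
      outerNormal_eq_neg hd hF hne.symm hJF hKF]
    set n := outerNormal K.1 F
    set s := σ / T.meshsize x
    have hnn : inner ℝ n n = (1 : ℝ) := by rw [real_inner_self_eq_norm_sq, hn]; norm_num
    have ej : ∀ y : T.Broken ℝ, y K x • n + y J x • -n = (y K x - y J x) • n := fun y => by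
      module
    simp only [ej, inner_smul_left, inner_smul_right, norm_smul, hn, hnn, conj_trivial, mul_one,
      inner_neg_right, inner_add_right]
    have bK : |inner ℝ n (Γ - m K x)| ≤ ‖Γ - m K x‖ := by
      simpa [hn] using abs_real_inner_le_norm n (Γ - m K x)
    have bJ : |inner ℝ n (Γ - m J x)| ≤ ‖Γ - m J x‖ := by
      simpa [hn] using abs_real_inner_le_norm n (Γ - m J x)
    rw [inner_sub_right] at bK bJ
    simp only [real_inner_comm n, Real.norm_eq_abs, if_true, Nat.cast_ofNat, one_mul]
    set D := v K x - v J x with hD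
    set Q := inner ℝ n (q K x) + -inner ℝ n (q J x) with hQ
    -- Since `Γ` and `Z` are single-valued, `w K x - w J x` is the difference of `Z - w J x` and `Z
    -- - w K x`. Everything then regroups into the jump `D` of `v` and the normal jump `Q` of `q`,
    -- each times an approximation error.
    have e : inner ℝ n Γ * v K x - (Z - w K x) * inner ℝ n (q K x) +
        (-inner ℝ n Γ * v J x - (Z - w J x) * -inner ℝ n (q J x)) -
        (2⁻¹ * (D * inner ℝ n (m K x) + D * inner ℝ n (m J x)) +
          2⁻¹ * ((w K x - w J x) * inner ℝ n (q K x) + (w K x - w J x) * inner ℝ n (q J x)) -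
          s * ((w K x - w J x) * D)) =
        D * (2⁻¹ * (inner ℝ n Γ - inner ℝ n (m K x))) +
          D * (2⁻¹ * (inner ℝ n Γ - inner ℝ n (m J x))) -
          2⁻¹ * (Q * (Z - w K x)) - 2⁻¹ * (Q * (Z - w J x)) - s * (D * (Z - w K x)) +
          s * (D * (Z - w J x)) := by
      rw [hD, hQ]; ring
    have b1 : ∀ g G : ℝ, |g| ≤ G → |D * (2⁻¹ * g)| ≤ |D| * G := by
      intro g G h
      rw [abs_mul, abs_mul]
      gcongr
      rw [abs_of_pos (by norm_num : (0 : ℝ) < 2⁻¹)]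
      linarith [abs_nonneg g]
    have b2 : ∀ ζ : ℝ, |2⁻¹ * (Q * ζ)| ≤ |Q| * |ζ| := by
      intro ζ
      rw [abs_mul, abs_mul, abs_of_pos (by norm_num : (0 : ℝ) < 2⁻¹)]
      linarith [mul_nonneg (abs_nonneg Q) (abs_nonneg ζ)]
    have b3 : ∀ ζ r : ℝ, s ≤ r → |s * (D * ζ)| ≤ r * (|D| * |ζ|) := by
      intro ζ r h
      rw [abs_mul, abs_mul, abs_of_nonneg hs0]
      gcongr
    rw [e]
    have c1 := b1 _ _ bK
    have c2 := b1 _ _ bJ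
    have c3 := b2 (Z - w K x)
    have c4 := b2 (Z - w J x)
    have c5 := b3 (Z - w K x) _ hleK
    have c6 := b3 (Z - w J x) _ hleJ
    rw [abs_le] at c1 c2 c3 c4 c5 c6 ⊢
    constructor <;> linarith [c1.1, c1.2, c2.1, c2.2, c3.1, c3.2, c4.1, c4.2, c5.1, c5.2, c6.1, c6.2]

end Mesh

end Polynomials

/-! ### The residual representation of the error -/

section Residual

variable {d : ℕ}

/-- The divergence theorem for a weakly differentiable vector field, tested with smooth functions. -/
lemma H1Limit.sum_integral_by_parts {K : Finset (Vec d)} (hK : IsSimplex K) (hd : 1 ≤ d)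
    {φ : Fin d → ℕ → Vec d → ℝ} {w : Fin d → Vec d → ℝ} {G : Fin d → Vec d → Vec d}
    (h : ∀ i, H1Limit K (φ i) (w i) (G i)) {τ : K → Vec d → Vec d}
    (hτ : ∀ (a : K) i, TraceLimit (Mesh.faceMeasure (K.erase (a : Vec d))) (φ i) fun x => τ a x i)
    {q : Fin d → Vec d → ℝ} (hq : ∀ i, ContDiff ℝ 1 (q i)) :
    (∫ x in openSimplex K, ∑ i, G i x i * q i x) +
        ∫ x in openSimplex K, ∑ i, w i x * (∇ (q i) x) i =
      ∑ a : K, ∫ x, ∑ i, outerNormal K (K.erase a) i * (τ a x i * q i x)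
        ∂(Mesh.faceMeasure (K.erase (a : Vec d))) := by
  have h1 : ∀ i, Integrable (fun x => G i x i * q i x) (elemMeasure K) := fun i =>
    integrable_mul_of_memLp (memLp_apply (h i).memLp_grad i) (memLp_openSimplex K (hq i).continuous)
  have h2 : ∀ i, Integrable (fun x => w i x * (∇ (q i) x) i) (elemMeasure K) := fun i =>
    integrable_mul_of_memLp (h i).memLp
      (memLp_apply (memLp_openSimplex K (continuous_gradient (hq i))) i)
  have h3 : ∀ (a : K) i, Integrable (fun x => τ a x i * q i x)
      (Mesh.faceMeasure (K.erase (a : Vec d))) := fun a i =>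
    integrable_mul_of_memLp (hτ a i).memLp (memLp_faceMeasure hK hd a (hq i).continuous)
  rw [integral_finsetSum _ fun i _ => h1 i, integral_finsetSum _ fun i _ => h2 i,
    ← Finset.sum_add_distrib]
  simp only [fun i => (h i).integral_by_parts hK hd (τ := fun a x => τ a x i)
    (fun a => hτ a i) (hq i) i]
  rw [Finset.sum_comm]
  refine Finset.sum_congr rfl fun a _ => ?_
  rw [integral_finsetSum _ fun i _ => (h3 a i).const_mul _]
  simp only [integral_const_mul]

namespace Mesh

variable {T : Mesh d} {Ω : Set (Vec d)}

lemma isFiniteMeasure_face (hd : 1 ≤ d) {F : Finset (Vec d)} (hF : F ∈ T.faces) :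
    IsFiniteMeasure (faceMeasure F) := by
  obtain ⟨K, hK⟩ := neighbours_nonempty hF
  obtain ⟨a, rfl⟩ := exists_eq_erase hF hK
  exact (T.isSimplex K.2).isFiniteMeasure_faceMeasure hd a

lemma memLp_face (hd : 1 ≤ d) {F : Finset (Vec d)} (hF : F ∈ T.faces) {E : Type*}
    [NormedAddCommGroup E] {g : Vec d → E} (hg : Continuous g) : MemLp g 2 (faceMeasure F) := by
  obtain ⟨K, hK⟩ := neighbours_nonempty hF
  obtain ⟨a, rfl⟩ := exists_eq_erase hF hK
  exact memLp_faceMeasure (T.isSimplex K.2) hd a hg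

/-- A function `z` with weak gradient `G` and weak second derivatives `H`, whose trace and whose
gradient's trace on the face `F` are `Z F` and `Γ F`; the former vanishes on the boundary. -/
structure HasTraces (T : Mesh d) (z : Vec d → ℝ) (G : Vec d → Vec d)
    (H : Fin d → Fin d → Vec d → ℝ) (φ : ℕ → Vec d → ℝ) (ψ : T.elems → Fin d → ℕ → Vec d → ℝ)
    (Z : Finset (Vec d) → Vec d → ℝ) (Γ : Finset (Vec d) → Vec d → Vec d) : Prop where
  h1Limit : ∀ K : T.elems, H1Limit K.1 φ z G
  h1Limit_grad : ∀ (K : T.elems) i, H1Limit K.1 (ψ K i) (fun x => G x i)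
    (fun x => WithLp.toLp 2 fun j => H i j x)
  trace : ∀ F ∈ T.faces, TraceLimit (faceMeasure F) φ (Z F)
  trace_grad : ∀ F ∈ T.faces, ∀ K ∈ T.neighbours F, ∀ i,
    TraceLimit (faceMeasure F) (ψ K i) fun x => Γ F x i
  trace_boundary : ∀ F ∈ T.faces, (T.neighbours F).card = 1 → ∀ᵐ x ∂(faceMeasure F), Z F x = 0

/-- The function `z` is approximated by its global test functions, the components of its gradient by
mollification on each element, with traces matched across faces by `exists_common_trace`. -/
lemma exists_hasTraces (hd : 1 ≤ d) (hT : T.Triangulates Ω) (hΩ : interior (closure Ω) = Ω)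
    {z : Vec d → ℝ} {G : Vec d → Vec d} {H : Fin d → Fin d → Vec d → ℝ} (h10 : MemH10 Ω z G)
    (h2 : MemH2 Ω z G H) : ∃ φ ψ Z Γ, T.HasTraces z G H φ ψ Z Γ := by
  obtain ⟨-, hG, hH, -, hweak⟩ := h2
  obtain ⟨φ, hφ, hlim⟩ := h10.exists_h1Limit hT hΩ
  have hGi : ∀ i, MemLp (fun x => G x i) 2 (volume.restrict Ω) := H1Limit.memLp_apply hG
  have hHi : ∀ i, MemLp (fun x => (WithLp.toLp 2 fun j => H i j x : Vec d)) 2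
      (volume.restrict Ω) := fun i => MemLp.of_eval_piLp fun j => hH i j
  have hψ : ∀ (K : T.elems) i, ∃ ψ, H1Limit K.1 ψ (fun x => G x i)
      (fun x => WithLp.toLp 2 fun j => H i j x) := fun K i =>
    exists_h1Limit hT hΩ (hGi i) (hHi i) (fun j => hweak i j) K
  choose ψ hψ using hψ
  have hZ : ∀ F, ∃ Z, F ∈ T.faces → TraceLimit (faceMeasure F) φ Z := by
    intro F
    by_cases hF : F ∈ T.faces
    · obtain ⟨K, hK⟩ := neighbours_nonempty hF
      obtain ⟨Z, hZ⟩ := exists_trace hd hF hK (hlim K)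
      exact ⟨Z, fun _ => hZ⟩
    · exact ⟨0, fun h => absurd h hF⟩
  choose Z hZ using hZ
  have hΓ : ∀ F i, ∃ τ, F ∈ T.faces → ∀ K ∈ T.neighbours F,
      TraceLimit (faceMeasure F) (ψ K i) τ := by
    intro F i
    by_cases hF : F ∈ T.faces
    · obtain ⟨τ, hτ⟩ := exists_common_trace hd hT hΩ (hGi i) (hHi i) (fun j => hweak i j)
        (ψ := fun K => ψ K i) (fun K => hψ K i) hF
      exact ⟨τ, fun _ => hτ⟩
    · exact ⟨0, fun h => absurd h hF⟩
  choose τ hτ using hΓ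
  exact ⟨φ, ψ, Z, fun F x => WithLp.toLp 2 fun i => τ F i x, hlim, hψ, hZ,
    fun F hF K hK i => hτ F i hF K hK, fun F hF h1 => trace_eq_zero hd hT hΩ hF h1 hφ (hZ F hF)⟩

namespace HasTraces

variable {z : Vec d → ℝ} {G : Vec d → Vec d} {H : Fin d → Fin d → Vec d → ℝ} {φ : ℕ → Vec d → ℝ}
  {ψ : T.elems → Fin d → ℕ → Vec d → ℝ} {Z : Finset (Vec d) → Vec d → ℝ}
  {Γ : Finset (Vec d) → Vec d → Vec d}

lemma memLp_trace_grad (h : T.HasTraces z G H φ ψ Z Γ) {F : Finset (Vec d)} (hF : F ∈ T.faces) :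
    MemLp (Γ F) 2 (faceMeasure F) := by
  obtain ⟨K, hK⟩ := neighbours_nonempty hF
  exact MemLp.of_eval_piLp fun i => (h.trace_grad F hF K hK i).memLp

/-- Integration by parts of the vector field `∇z` against the polynomial: the source of the normal
fluxes of `z` on the faces. -/
lemma integral_lap_mul (h : T.HasTraces z G H φ ψ Z Γ) (hd : 1 ≤ d)
    (p : T.elems → MvPolynomial (Fin d) ℝ) (K : T.elems) :
    (∫ x in openSimplex K.1, (∑ i, H i i x) * val p K x) +
        ∫ x in openSimplex K.1, inner ℝ (grad p K x) (G x) =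
      ∑ a : K.1, ∫ x, inner ℝ (Γ (K.1.erase a) x) (outerNormal K.1 (K.1.erase a)) * val p K x
        ∂(faceMeasure (K.1.erase (a : Vec d))) := by
  have := H1Limit.sum_integral_by_parts (T.isSimplex K.2) hd (h.h1Limit_grad K)
    (τ := fun a x => Γ (K.1.erase a) x)
    (fun a i => h.trace_grad _ (erase_mem_faces K a) K (mem_neighbours_erase K a) i)
    (q := fun _ => val p K) fun _ => contDiff_val p K
  simp only [gradient_val] at this
  convert this using 2
  · simp only [Finset.sum_mul]
  · simp only [PiLp.inner_apply, RCLike.inner_apply, conj_trivial]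
  · refine integral_congr_ae (Eventually.of_forall fun x => ?_)
    simp only [PiLp.inner_apply, RCLike.inner_apply, conj_trivial, Finset.sum_mul]
    exact Finset.sum_congr rfl fun i _ => by ring

/-- The opposite integration by parts, which moves the derivative from `z - r` onto the polynomial
gradient and creates the Laplacian of the element residual. -/
lemma integral_sub_mul_lap (h : T.HasTraces z G H φ ψ Z Γ) (hd : 1 ≤ d)
    (p r : T.elems → MvPolynomial (Fin d) ℝ) (K : T.elems) :
    (∫ x in openSimplex K.1, inner ℝ (grad p K x) (G x - grad r K x)) +
        ∫ x in openSimplex K.1, (z x - val r K x) * lap p K x =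
      ∑ a : K.1, ∫ x, (Z (K.1.erase a) x - val r K x) *
          inner ℝ (grad p K x) (outerNormal K.1 (K.1.erase a))
        ∂(faceMeasure (K.1.erase (a : Vec d))) := by
  have := H1Limit.sum_integral_by_parts (T.isSimplex K.2) hd
    (fun _ => (h.h1Limit K).sub (contDiff_val r K))
    (τ := fun a x => WithLp.toLp 2 fun _ => Z (K.1.erase a) x - val r K x)
    (fun a i => (h.trace _ (erase_mem_faces K a)).sub
      (memLp_face hd (erase_mem_faces K a) (continuous_val r K)))
    (q := fun i x => grad p K x i) fun i => contDiff_grad_apply p K i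
  simp only [gradient_val] at this
  convert this using 2
  · simp only [PiLp.inner_apply, RCLike.inner_apply, conj_trivial]
  · refine integral_congr_ae (Eventually.of_forall fun x => ?_)
    simp only [lap_eq, Finset.mul_sum]
  · refine integral_congr_ae (Eventually.of_forall fun x => ?_)
    simp only [PiLp.inner_apply, RCLike.inner_apply, conj_trivial, Finset.mul_sum]
    exact Finset.sum_congr rfl fun i _ => by ring

end HasTraces

end Mesh

end Residual

/-! ### Error representation by duality -/

section ErrorIdentity

variable {d : ℕ} {Ω : Set (Vec d)}

lemma IsTest.memH10 {φ : Vec d → ℝ} (hφ : IsTest Ω φ) : MemH10 Ω φ (∇ φ) := by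
  have hφ1 : ContDiff ℝ 1 φ := hφ.1.of_le (by norm_num)
  refine ⟨(hφ.1.continuous.memLp_of_hasCompactSupport hφ.2.1).restrict Ω, ?_,
    fun _ => φ, fun _ => hφ, by simp, by simp⟩
  refine ((continuous_gradient hφ1).memLp_of_hasCompactSupport ?_).restrict Ω
  refine HasCompactSupport.of_support_subset_isCompact hφ.2.1 fun x hx => ?_
  by_contra h
  exact hx (gradient_eq_zero_of_notMem_tsupport h)

lemma integrable_inner_of_memLp {X : Type*} [MeasurableSpace X] {ν : Measure X}
    {v w : X → Vec d} (hv : MemLp v 2 ν) (hw : MemLp w 2 ν) :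
    Integrable (fun x => inner ℝ (v x) (w x)) ν := by
  simp only [PiLp.inner_apply, RCLike.inner_apply, conj_trivial]
  exact integrable_finsetSum _ fun i _ =>
    integrable_mul_of_memLp (H1Limit.memLp_apply hw i) (H1Limit.memLp_apply hv i)

/-- A weak solution in `H²` satisfies the equation almost everywhere. -/
lemma IsWeakSolutionWith.ae_eq (hΩ : IsOpen Ω) {g z : Vec d → ℝ} {G : Vec d → Vec d}
    {H : Fin d → Fin d → Vec d → ℝ} (hg : MemLp g 2 (volume.restrict Ω))
    (hz : IsWeakSolutionWith Ω g z G) (h2 : MemH2 Ω z G H) :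
    ∀ᵐ x ∂(volume.restrict Ω), g x = -∑ i, H i i x := by
  obtain ⟨-, hG, hH, -, hweak⟩ := h2
  have hHs : MemLp (fun x => ∑ i, H i i x) 2 (volume.restrict Ω) :=
    memLp_finsetSum _ fun i _ => hH i i
  -- The weak equation and the weak derivatives of `G`, tested with the same function, are compared
  -- by the fundamental lemma of the calculus of variations.
  have hae := hΩ.ae_eq_zero_of_integral_contDiff_smul_eq_zero (μ := volume.restrict Ω)
    (f := fun x => g x + ∑ i, H i i x)
    (((hg.add hHs).locallyIntegrable (by norm_num)).locallyIntegrableOn Ω) ?_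
  · filter_upwards [hae, ae_restrict_mem hΩ.measurableSet] with x hx hxΩ
    linarith [hx hxΩ]
  · intro φ hφ hφc hφΩ
    have htest : IsTest Ω φ := ⟨hφ, hφc, hφΩ⟩
    have h10 := htest.memH10
    have h1 := hz.2 φ (∇ φ) h10
    have h2 : ∫ x in Ω, inner ℝ (G x) (∇ φ x) = -∫ x in Ω, (∑ i, H i i x) * φ x := by
      have e : ∀ x, inner ℝ (G x) (∇ φ x) = ∑ i, G x i * (∇ φ x) i := fun x => by
        simp only [PiLp.inner_apply, RCLike.inner_apply, conj_trivial, mul_comm]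
      simp only [e, Finset.sum_mul]
      rw [integral_finsetSum _ fun i _ => integrable_mul_of_memLp (H1Limit.memLp_apply hG i)
          (H1Limit.memLp_apply h10.2.1 i),
        integral_finsetSum _ fun i _ => integrable_mul_of_memLp (hH i i) h10.1,
        ← Finset.sum_neg_distrib]
      exact Finset.sum_congr rfl fun i _ => hweak i i φ htest
    have e : ∀ x, φ x • (g x + ∑ i, H i i x) = g x * φ x + (∑ i, H i i x) * φ x := fun x => by
      rw [smul_eq_mul]; ring
    simp only [e]
    rw [integral_add (integrable_mul_of_memLp hg h10.1) (integrable_mul_of_memLp hHs h10.1),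
      ← h1, h2]
    ring

namespace Mesh

variable {T : Mesh d}

lemma continuous_jump (p : T.elems → MvPolynomial (Fin d) ℝ) (F : Finset (Vec d)) :
    Continuous (jump (val p) F) :=
  continuous_finsetSum _ fun K _ => (continuous_val p K).smul continuous_const

lemma continuous_avg (p : T.elems → MvPolynomial (Fin d) ℝ) (F : Finset (Vec d)) :
    Continuous (avg (grad p) F) := by
  have : Continuous fun x => ∑ K ∈ T.neighbours F, grad p K x :=
    continuous_finsetSum _ fun K _ => continuous_grad p K
  exact this.const_smul ((T.neighbours F).card : ℝ)⁻¹

lemma continuous_vecJump (p : T.elems → MvPolynomial (Fin d) ℝ) (F : Finset (Vec d)) :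
    Continuous (vecJump (grad p) F) :=
  continuous_finsetSum _ fun K _ => (continuous_grad p K).inner continuous_const

/-- The penalty weight is measurable and bounded on the face, since the meshsize there is at least
the diameter of an adjacent element. -/
lemma integrable_ipForm_face (hd : 1 ≤ d) {F : Finset (Vec d)} (hF : F ∈ T.faces) {σ : ℝ}
    (hσ : 0 ≤ σ) (p r : T.elems → MvPolynomial (Fin d) ℝ) :
    Integrable (fun x => inner ℝ (jump (val p) F x) (avg (grad r) F x) +
        inner ℝ (jump (val r) F x) (avg (grad p) F x) -
        σ / T.meshsize x * inner ℝ (jump (val p) F x) (jump (val r) F x)) (faceMeasure F) := by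
  have hj := fun p : T.elems → MvPolynomial (Fin d) ℝ => memLp_face hd hF (continuous_jump p F)
  have ha := fun p : T.elems → MvPolynomial (Fin d) ℝ => memLp_face hd hF (continuous_avg p F)
  refine ((integrable_inner_of_memLp (hj p) (ha r)).add
    (integrable_inner_of_memLp (hj r) (ha p))).sub ?_
  obtain ⟨K, hK⟩ := neighbours_nonempty hF
  refine (integrable_inner_of_memLp (hj p) (hj r)).bdd_mul (c := σ / simplexDiam K.1)
    (measurable_const.div (measurable_meshsize T)).aestronglyMeasurable ?_
  filter_upwards [ae_mem_faceMeasure F] with x hx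
  have h0 := (T.isSimplex K.2).simplexDiam_pos hd
  have h1 := simplexDiam_le_meshsize K (convexHull_mono (by exact_mod_cast mem_neighbours.1 hK) hx)
  rw [Real.norm_of_nonneg (div_nonneg hσ (h0.le.trans h1))]
  exact div_le_div_of_nonneg_left hσ h0 h1

/-- The contribution of the face `F` to the error representation. -/
def faceResidual (σ : ℝ) (p r : T.elems → MvPolynomial (Fin d) ℝ) (Z : Vec d → ℝ)
    (Γ : Vec d → Vec d) (F : Finset (Vec d)) : ℝ :=
  (∑ K ∈ T.neighbours F, ((∫ x, inner ℝ (Γ x) (outerNormal K.1 F) * val p K x ∂(faceMeasure F)) -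
      ∫ x, (Z x - val r K x) * inner ℝ (grad p K x) (outerNormal K.1 F) ∂(faceMeasure F))) -
    ∫ x, (inner ℝ (jump (val p) F x) (avg (grad r) F x) +
        inner ℝ (jump (val r) F x) (avg (grad p) F x) -
        σ / T.meshsize x * inner ℝ (jump (val p) F x) (jump (val r) F x)) ∂(faceMeasure F)

namespace HasTraces

variable {z : Vec d → ℝ} {G : Vec d → Vec d} {H : Fin d → Fin d → Vec d → ℝ} {φ : ℕ → Vec d → ℝ}
  {ψ : T.elems → Fin d → ℕ → Vec d → ℝ} {Z : Finset (Vec d) → Vec d → ℝ}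
  {Γ : Finset (Vec d) → Vec d → Vec d}

/-- The pointwise bound `abs_faceTerm_le` is integrated over the face and Cauchy–Schwarz applied to
each product. -/
lemma abs_faceResidual_le (h : T.HasTraces z G H φ ψ Z Γ) (hd : 1 ≤ d) {σ : ℝ} (hσ : 0 ≤ σ)
    (p r : T.elems → MvPolynomial (Fin d) ℝ) {F : Finset (Vec d)} (hF : F ∈ T.faces) :
    |faceResidual σ p r (Z F) (Γ F) F| ≤ ∑ K ∈ T.neighbours F,
      (l2Norm (faceMeasure F) (jump (val p) F) *
          l2Norm (faceMeasure F) (fun x => Γ F x - grad r K x) +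
        (if (T.neighbours F).card = 2 then 1 else 0) *
          (l2Norm (faceMeasure F) (vecJump (grad p) F) *
            l2Norm (faceMeasure F) (fun x => Z F x - val r K x)) +
        σ / simplexDiam K.1 * (l2Norm (faceMeasure F) (jump (val p) F) *
          l2Norm (faceMeasure F) (fun x => Z F x - val r K x))) := by
  have hfin := isFiniteMeasure_face hd hF
  have hZ := (h.trace F hF).memLp
  have hΓ := h.memLp_trace_grad hF
  have hZr : ∀ K, MemLp (fun x => Z F x - val r K x) 2 (faceMeasure F) := fun K =>
    hZ.sub (memLp_face hd hF (continuous_val r K))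
  have hΓr : ∀ K, MemLp (fun x => Γ F x - grad r K x) 2 (faceMeasure F) := fun K =>
    hΓ.sub (memLp_face hd hF (continuous_grad r K))
  have hj := memLp_face hd hF (continuous_jump p F)
  have hvj := memLp_face hd hF (continuous_vecJump p F)
  have i1 : ∀ K : T.elems, Integrable
      (fun x => inner ℝ (Γ F x) (outerNormal K.1 F) * val p K x) (faceMeasure F) := fun K =>
    integrable_mul_of_memLp (hΓ.inner_const _) (memLp_face hd hF (continuous_val p K))
  have i2 : ∀ K : T.elems, Integrable
      (fun x => (Z F x - val r K x) * inner ℝ (grad p K x) (outerNormal K.1 F)) (faceMeasure F) :=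
    fun K => integrable_mul_of_memLp (hZr K)
      (memLp_face hd hF ((continuous_grad p K).inner continuous_const))
  have i12 : ∀ K : T.elems, Integrable (fun x =>
      inner ℝ (Γ F x) (outerNormal K.1 F) * val p K x -
        (Z F x - val r K x) * inner ℝ (grad p K x) (outerNormal K.1 F)) (faceMeasure F) :=
    fun K => (i1 K).sub (i2 K)
  have i3 := integrable_ipForm_face hd hF hσ p r
  have e : faceResidual σ p r (Z F) (Γ F) F = ∫ x,
      ((∑ K ∈ T.neighbours F, (inner ℝ (Γ F x) (outerNormal K.1 F) * val p K x -
          (Z F x - val r K x) * inner ℝ (grad p K x) (outerNormal K.1 F))) -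
        (inner ℝ (jump (val p) F x) (avg (grad r) F x) +
          inner ℝ (jump (val r) F x) (avg (grad p) F x) -
          σ / T.meshsize x * inner ℝ (jump (val p) F x) (jump (val r) F x))) ∂(faceMeasure F) := by
    rw [integral_sub (integrable_finsetSum _ fun K _ => i12 K) i3,
      integral_finsetSum _ fun K _ => i12 K, faceResidual]
    congr 1
    exact Finset.sum_congr rfl fun K _ => (integral_sub (i1 K) (i2 K)).symm
  have j1 : ∀ K, Integrable (fun x => ‖jump (val p) F x‖ * ‖Γ F x - grad r K x‖)
      (faceMeasure F) := fun K => integrable_mul_of_memLp hj.norm (hΓr K).norm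
  have j2 : ∀ K, Integrable (fun x => (if (T.neighbours F).card = 2 then (1 : ℝ) else 0) *
      (|vecJump (grad p) F x| * |Z F x - val r K x|)) (faceMeasure F) := fun K =>
    (integrable_mul_of_memLp hvj.norm (hZr K).norm).const_mul _
  have j3 : ∀ K : T.elems, Integrable (fun x => σ / simplexDiam K.1 *
      (‖jump (val p) F x‖ * |Z F x - val r K x|)) (faceMeasure F) := fun K =>
    (integrable_mul_of_memLp hj.norm (hZr K).norm).const_mul _
  have j : ∀ K : T.elems, Integrable (fun x => ‖jump (val p) F x‖ * ‖Γ F x - grad r K x‖ +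
      (if (T.neighbours F).card = 2 then (1 : ℝ) else 0) *
        (|vecJump (grad p) F x| * |Z F x - val r K x|) +
      σ / simplexDiam K.1 * (‖jump (val p) F x‖ * |Z F x - val r K x|)) (faceMeasure F) :=
    fun K => ((j1 K).add (j2 K)).add (j3 K)
  rw [e]
  refine (abs_integral_le_integral_abs).trans ((integral_mono_ae ?_
    (integrable_finsetSum (T.neighbours F) fun K _ => j K) ?_).trans ?_)
  · exact ((integrable_finsetSum _ fun K _ => i12 K).sub i3).abs
  · have hZ0 : ∀ᵐ x ∂(faceMeasure F), (T.neighbours F).card = 1 → Z F x = 0 := by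
      by_cases h1 : (T.neighbours F).card = 1
      · filter_upwards [h.trace_boundary F hF h1] with x hx _ using hx
      · exact Eventually.of_forall fun x hx => absurd hx h1
    filter_upwards [hZ0, ae_mem_faceMeasure F] with x hx hxF
    exact abs_faceTerm_le hd hF hσ (val p) (val r) (grad p) (grad r) hxF (Γ F x) hx
  · rw [integral_finsetSum _ fun K _ => j K]
    refine Finset.sum_le_sum fun K _ => ?_
    have h0 := (T.isSimplex K.2).simplexDiam_pos hd
    have j12 : Integrable (fun x => ‖jump (val p) F x‖ * ‖Γ F x - grad r K x‖ +
        (if (T.neighbours F).card = 2 then (1 : ℝ) else 0) *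
          (|vecJump (grad p) F x| * |Z F x - val r K x|)) (faceMeasure F) := (j1 K).add (j2 K)
    rw [integral_add j12 (j3 K), integral_add (j1 K) (j2 K), integral_const_mul,
      integral_const_mul]
    gcongr
    · exact integral_norm_mul_norm_le hj (hΓr K)
    · exact integral_norm_mul_norm_le hvj (hZr K)
    · exact integral_norm_mul_norm_le hj (hZr K)

/-- The error representation: the squared error in terms of the element and face residuals. -/
theorem error_sq_eq (h : T.HasTraces z G H φ ψ Z Γ) (hd : 1 ≤ d) (hT : T.Triangulates Ω)
    (hΩ : interior (closure Ω) = Ω) {f u : Vec d → ℝ} (hf : MemLp f 2 (volume.restrict Ω))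
    (hu : IsWeakSolution Ω f u) {σ : ℝ} {k : ℕ}
    {p : T.elems → MvPolynomial (Fin d) ℝ} (hp : IsIPSolution Ω f σ k p)
    {r : T.elems → MvPolynomial (Fin d) ℝ} (hr : r ∈ T.dgSpace k)
    (hz : IsWeakSolutionWith Ω (fun x => u x - glue (val p) x) z G) (h2 : MemH2 Ω z G H) :
    l2Norm (volume.restrict Ω) (fun x => u x - glue (val p) x) ^ 2 =
      (∑ K : T.elems, ∫ x in openSimplex K.1, (f x + lap p K x) * (z x - val r K x)) +
        ∑ F ∈ T.faces, faceResidual σ p r (Z F) (Γ F) F := by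
  obtain ⟨Gu, hGu⟩ := hu
  have huL := hGu.1.1
  have hpL : MemLp (glue (val p)) 2 (volume.restrict Ω) := memLp_glue p Ω
  have hg : MemLp (fun x => u x - glue (val p) x) 2 (volume.restrict Ω) := huL.sub hpL
  have hzL := hz.1.1
  have hle := fun K : T.elems => restrict_openSimplex_le hT hΩ K
  have hfK : ∀ K : T.elems, MemLp f 2 (elemMeasure K.1) := fun K => hf.mono_measure (hle K)
  have hzK : ∀ K : T.elems, MemLp z 2 (elemMeasure K.1) := fun K => hzL.mono_measure (hle K)
  have hGK : ∀ K : T.elems, MemLp G 2 (elemMeasure K.1) := fun K => hz.1.2.1.mono_measure (hle K)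
  have hrK : ∀ K : T.elems, MemLp (val r K) 2 (elemMeasure K.1) := fun K =>
    memLp_openSimplex K.1 (continuous_val r K)
  have hgpK : ∀ K : T.elems, MemLp (grad p K) 2 (elemMeasure K.1) := fun K =>
    memLp_openSimplex K.1 (continuous_grad p K)
  have hgrK : ∀ K : T.elems, MemLp (grad r K) 2 (elemMeasure K.1) := fun K =>
    memLp_openSimplex K.1 (continuous_grad r K)
  have hlK : ∀ K : T.elems, MemLp (lap p K) 2 (elemMeasure K.1) := fun K =>
    memLp_openSimplex K.1 (continuous_lap p K)
  have hglue : ∀ (q : T.elems → MvPolynomial (Fin d) ℝ) (K : T.elems) (w : Vec d → ℝ),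
      ∫ x in openSimplex K.1, w x * glue (val q) x = ∫ x in openSimplex K.1, w x * val q K x :=
    fun q K w => setIntegral_congr_fun (isOpen_openSimplex K.1).measurableSet fun x hx => by
      simp only [glue_eq (val q) K hx]
  -- `u` is a test function for the equation of `z`, and `z` for that of `u`; symmetry of the
  -- Dirichlet form gives the claim.
  have hdual : ∫ x in Ω, (u x - glue (val p) x) * u x =
      ∑ K : T.elems, ∫ x in openSimplex K.1, f x * z x := by
    rw [← hz.2 u Gu hGu.1, ← integral_domain hT hΩ (integrable_mul_of_memLp hf hzL),
      ← hGu.2 z G hz.1]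
    simp only [real_inner_comm]
  -- The discontinuous `glue (val p)` is no admissible test function, so the strong form of the dual
  -- equation is integrated by parts on each element.
  have hstrong : ∫ x in Ω, (u x - glue (val p) x) * glue (val p) x =
      ∑ K : T.elems, ((∫ x in openSimplex K.1, inner ℝ (grad p K x) (G x)) -
        ∑ a : K.1, ∫ x, inner ℝ (Γ (K.1.erase a) x) (outerNormal K.1 (K.1.erase a)) * val p K x
          ∂(faceMeasure (K.1.erase (a : Vec d)))) := by
    rw [integral_domain hT hΩ (integrable_mul_of_memLp hg hpL)]
    refine Finset.sum_congr rfl fun K _ => ?_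
    rw [hglue, ← h.integral_lap_mul hd p K]
    have : ∫ x in openSimplex K.1, (u x - glue (val p) x) * val p K x =
        ∫ x in openSimplex K.1, -((∑ i, H i i x) * val p K x) := by
      refine integral_congr_ae ?_
      filter_upwards [(hle K).absolutelyContinuous.ae_le
        (hz.ae_eq (isOpen_domain hΩ) hg h2)] with x hx
      rw [hx, neg_mul]
    rw [this, integral_neg]
    ring
  have hgal := hp.2 r hr
  rw [ipForm, integral_domain hT hΩ (integrable_mul_of_memLp hf (memLp_glue r Ω))] at hgal
  simp only [hglue] at hgal
  have hsplit : l2Norm (volume.restrict Ω) (fun x => u x - glue (val p) x) ^ 2 =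
      (∫ x in Ω, (u x - glue (val p) x) * u x) -
        ∫ x in Ω, (u x - glue (val p) x) * glue (val p) x := by
    rw [l2Norm_sq_real hg, ← integral_sub (integrable_mul_of_memLp hg huL)
      (integrable_mul_of_memLp hg hpL)]
    congr 1
    ext x
    ring
  have hE : ∀ K : T.elems, ∫ x in openSimplex K.1, (f x + lap p K x) * (z x - val r K x) =
      (∫ x in openSimplex K.1, f x * z x) - (∫ x in openSimplex K.1, f x * val r K x) +
        ∫ x in openSimplex K.1, (z x - val r K x) * lap p K x := by
    intro K
    have hη : MemLp (fun x => z x - val r K x) 2 (elemMeasure K.1) := (hzK K).sub (hrK K)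
    have e : ∀ x, (f x + lap p K x) * (z x - val r K x) =
        f x * (z x - val r K x) + (z x - val r K x) * lap p K x := fun x => by ring
    simp only [e]
    rw [integral_add (integrable_mul_of_memLp (hfK K) hη) (integrable_mul_of_memLp hη (hlK K)),
      ← integral_sub (integrable_mul_of_memLp (hfK K) (hzK K))
        (integrable_mul_of_memLp (hfK K) (hrK K))]
    simp only [mul_sub]
  have hI : ∀ K : T.elems, ∫ x in openSimplex K.1, inner ℝ (grad p K x) (G x - grad r K x) =
      (∫ x in openSimplex K.1, inner ℝ (grad p K x) (G x)) -
        ∫ x in openSimplex K.1, inner ℝ (grad p K x) (grad r K x) := by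
    intro K
    rw [← integral_sub (integrable_inner_of_memLp (hgpK K) (hGK K))
      (integrable_inner_of_memLp (hgpK K) (hgrK K))]
    simp only [inner_sub_right]
  have hface : ∑ F ∈ T.faces, faceResidual σ p r (Z F) (Γ F) F =
      (∑ K : T.elems, ∑ a : K.1,
        ∫ x, inner ℝ (Γ (K.1.erase a) x) (outerNormal K.1 (K.1.erase a)) * val p K x
          ∂(faceMeasure (K.1.erase (a : Vec d)))) -
      (∑ K : T.elems, ∑ a : K.1, ∫ x, (Z (K.1.erase a) x - val r K x) *
          inner ℝ (grad p K x) (outerNormal K.1 (K.1.erase a))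
        ∂(faceMeasure (K.1.erase (a : Vec d)))) -
      ∑ F ∈ T.faces, ∫ x, (inner ℝ (jump (val p) F x) (avg (grad r) F x) +
        inner ℝ (jump (val r) F x) (avg (grad p) F x) -
        σ / T.meshsize x * inner ℝ (jump (val p) F x) (jump (val r) F x)) ∂(faceMeasure F) := by
    rw [sum_elems_faces fun K F => ∫ x, inner ℝ (Γ F x) (outerNormal K.1 F) * val p K x
        ∂(faceMeasure F),
      sum_elems_faces fun K F => ∫ x, (Z F x - val r K x) *
        inner ℝ (grad p K x) (outerNormal K.1 F) ∂(faceMeasure F)]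
    simp only [faceResidual, Finset.sum_sub_distrib]
  -- Summed over the elements, this replaces `∇p · (∇z - ∇r)` by the Laplacian of `p` and face
  -- terms; what remains is linear arithmetic.
  have hs := Finset.sum_congr rfl fun (K : T.elems) (_ : K ∈ Finset.univ) =>
    h.integral_sub_mul_lap hd p r K
  simp only [hI, Finset.sum_add_distrib, Finset.sum_sub_distrib] at hs
  rw [hsplit, hdual, hstrong, hface]
  simp only [hE, Finset.sum_add_distrib, Finset.sum_sub_distrib]
  linarith

end HasTraces

end Mesh

end ErrorIdentity

/-! ### The a posteriori estimate -/

section Estimate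

variable {d : ℕ} {Ω : Set (Vec d)}

/-- The constant in the estimate of the residual on a face. -/
def faceConst (d : ℕ) (σ μ : ℝ) : ℝ :=
  Real.sqrt (3 * approxConst d μ * ((1 + σ ^ 2) / (min μ 1 * σ) + 1 / min μ 1 ^ 3))

/-- Here `L` and `J` stand for the norms of the value and gradient jumps, `ζ` and `g` for the errors
of `z` and `∇z` on the face, and `δ` is `1` on interior faces and `0` on the boundary. The powers of
`D` in the error bounds match the weights of the estimator once `κ * D ≤ h` is used. -/
lemma face_term_le {C σ κ D h s L J g ζ δ : ℝ} (hC : 0 ≤ C) (hσ : 0 < σ) (hκ : 0 < κ) (hD : 0 < D)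
    (hDh : κ * D ≤ h) (hs : 0 ≤ s) (hδ0 : 0 ≤ δ) (hδ1 : δ ^ 2 = δ)
    (hζ : ζ ^ 2 ≤ C * D ^ 3 * s ^ 2) (hg : g ^ 2 ≤ C * D * s ^ 2) :
    L * g + δ * (J * ζ) + σ / D * (L * ζ) ≤
      Real.sqrt (3 * C * ((1 + σ ^ 2) / (κ * σ) + 1 / κ ^ 3)) *
        (s * Real.sqrt (σ * h * L ^ 2 + δ * (h ^ 3 * J ^ 2))) := by
  have hh : 0 < h := lt_of_lt_of_le (by positivity) hDh
  have hE : 0 ≤ σ * h * L ^ 2 + δ * (h ^ 3 * J ^ 2) := by positivity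
  rw [← Real.sqrt_sq hs, ← Real.sqrt_mul (sq_nonneg s), ← Real.sqrt_mul (by positivity)]
  refine Real.le_sqrt_of_sq_le ?_
  have h1 : (L * g + δ * (J * ζ) + σ / D * (L * ζ)) ^ 2 ≤
      3 * (L ^ 2 * g ^ 2 + δ ^ 2 * (J ^ 2 * ζ ^ 2) + (σ / D) ^ 2 * (L ^ 2 * ζ ^ 2)) := by
    nlinarith [sq_nonneg (L * g - δ * (J * ζ)), sq_nonneg (L * g - σ / D * (L * ζ)),
      sq_nonneg (δ * (J * ζ) - σ / D * (L * ζ))]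
  rw [hδ1] at h1
  have h2 : L ^ 2 * g ^ 2 + δ * (J ^ 2 * ζ ^ 2) + (σ / D) ^ 2 * (L ^ 2 * ζ ^ 2) ≤
      L ^ 2 * (C * D * s ^ 2) + δ * (J ^ 2 * (C * D ^ 3 * s ^ 2)) +
        (σ / D) ^ 2 * (L ^ 2 * (C * D ^ 3 * s ^ 2)) := by gcongr
  -- The first and third terms share the weight `σ * (κ * D)`, which produces the coefficients `1 /
  -- (κ * σ)` and `σ ^ 2 / (κ * σ)`; the gradient jump produces `1 / κ ^ 3`.
  have h3 : L ^ 2 * (C * D * s ^ 2) + δ * (J ^ 2 * (C * D ^ 3 * s ^ 2)) +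
        (σ / D) ^ 2 * (L ^ 2 * (C * D ^ 3 * s ^ 2)) =
      C * s ^ 2 * (((1 + σ ^ 2) / (κ * σ)) * (σ * (κ * D) * L ^ 2) +
        1 / κ ^ 3 * (δ * ((κ * D) ^ 3 * J ^ 2))) := by
    field_simp
    ring
  have h4 : ((1 + σ ^ 2) / (κ * σ)) * (σ * (κ * D) * L ^ 2) +
        1 / κ ^ 3 * (δ * ((κ * D) ^ 3 * J ^ 2)) ≤
      ((1 + σ ^ 2) / (κ * σ)) * (σ * h * L ^ 2) + 1 / κ ^ 3 * (δ * (h ^ 3 * J ^ 2)) := by gcongr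
  have h5 : ((1 + σ ^ 2) / (κ * σ)) * (σ * h * L ^ 2) + 1 / κ ^ 3 * (δ * (h ^ 3 * J ^ 2)) ≤
      ((1 + σ ^ 2) / (κ * σ) + 1 / κ ^ 3) * (σ * h * L ^ 2 + δ * (h ^ 3 * J ^ 2)) := by
    have a1 : 0 ≤ (1 + σ ^ 2) / (κ * σ) * (δ * (h ^ 3 * J ^ 2)) := by positivity
    have a2 : 0 ≤ 1 / κ ^ 3 * (σ * h * L ^ 2) := by positivity
    linarith [add_mul ((1 + σ ^ 2) / (κ * σ)) (1 / κ ^ 3) (σ * h * L ^ 2 + δ * (h ^ 3 * J ^ 2)),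
      mul_add ((1 + σ ^ 2) / (κ * σ)) (σ * h * L ^ 2) (δ * (h ^ 3 * J ^ 2)),
      mul_add (1 / κ ^ 3) (σ * h * L ^ 2) (δ * (h ^ 3 * J ^ 2))]
  have h6 := mul_le_mul_of_nonneg_left (h4.trans h5) (by positivity : 0 ≤ C * s ^ 2)
  calc _ ≤ _ := h1
    _ ≤ 3 * (C * s ^ 2 * (((1 + σ ^ 2) / (κ * σ) + 1 / κ ^ 3) *
        (σ * h * L ^ 2 + δ * (h ^ 3 * J ^ 2)))) := by linarith
    _ = _ := by ring

namespace Mesh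

variable {T : Mesh d}

/-- The local indicator on a face. -/
def faceIndicatorSq (σ : ℝ) (p : T.elems → MvPolynomial (Fin d) ℝ) (F : Finset (Vec d)) : ℝ :=
  σ * T.faceSize F * l2Norm (faceMeasure F) (jump (val p) F) ^ 2 +
    (if (T.neighbours F).card = 2 then 1 else 0) *
      (T.faceSize F ^ 3 * l2Norm (faceMeasure F) (vecJump (grad p) F) ^ 2)

lemma faceSize_nonneg (T : Mesh d) (F : Finset (Vec d)) : 0 ≤ T.faceSize F := by
  rw [faceSize]
  split_ifs
  · exact Real.iSup_nonneg fun K => Metric.diam_nonneg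
  · exact Metric.diam_nonneg

lemma faceIndicatorSq_nonneg {σ : ℝ} (hσ : 0 ≤ σ) (p : T.elems → MvPolynomial (Fin d) ℝ)
    (F : Finset (Vec d)) : 0 ≤ faceIndicatorSq σ p F := by
  have := T.faceSize_nonneg F
  rw [faceIndicatorSq]
  split_ifs <;> positivity

lemma elemIndicatorSq_nonneg (f : Vec d → ℝ) (p : T.elems → MvPolynomial (Fin d) ℝ)
    (K : T.elems) : 0 ≤ elemIndicatorSq f p K := by
  rw [elemIndicatorSq]; positivity

lemma estimator_eq (f : Vec d → ℝ) (σ : ℝ) (p : T.elems → MvPolynomial (Fin d) ℝ) :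
    estimator f σ p = Real.sqrt ((∑ K : T.elems, elemIndicatorSq f p K) +
      ∑ F ∈ T.faces, faceIndicatorSq σ p F) := by
  simp only [estimator, interiorFaces, faceIndicatorSq, Finset.sum_filter, Finset.sum_add_distrib,
    ite_mul, one_mul, zero_mul]
  congr 1
  ring

lemma sum_h2Semi_sq_le (hT : T.Triangulates Ω) (hΩ : interior (closure Ω) = Ω) {z : Vec d → ℝ}
    {G : Vec d → Vec d} {H : Fin d → Fin d → Vec d → ℝ} (h2 : MemH2 Ω z G H) :
    ∑ K : T.elems, h2Semi K.1 H ^ 2 ≤ h2Norm Ω z G H ^ 2 := by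
  have hH := h2.2.2.1
  have e : ∑ K : T.elems, h2Semi K.1 H ^ 2 =
      ∑ i, ∑ j, l2Norm (volume.restrict Ω) (H i j) ^ 2 := by
    simp only [h2Semi_sq]
    rw [Finset.sum_comm]
    refine Finset.sum_congr rfl fun i _ => ?_
    rw [Finset.sum_comm]
    refine Finset.sum_congr rfl fun j _ => ?_
    rw [l2Norm_sq_real (hH i j), integral_domain hT hΩ (hH i j).integrable_sq]
    exact Finset.sum_congr rfl fun K _ =>
      l2Norm_sq_real ((hH i j).mono_measure (restrict_openSimplex_le hT hΩ K))
  have h0 : 0 ≤ ∑ i, ∑ j, l2Norm (volume.restrict Ω) (H i j) ^ 2 :=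
    Finset.sum_nonneg fun _ _ => Finset.sum_nonneg fun _ _ => sq_nonneg _
  rw [e, h2Norm, Real.sq_sqrt (by positivity)]
  linarith [sq_nonneg (l2Norm (volume.restrict Ω) z), sq_nonneg (l2Norm (volume.restrict Ω) G)]

/-- Cauchy–Schwarz over the pairs of a face and an adjacent element: every element occurs `d + 1`
times and every face at most twice. -/
lemma sum_faces_mul_le (hd : 1 ≤ d) (s : T.elems → ℝ) {E : Finset (Vec d) → ℝ}
    (hE : ∀ F, 0 ≤ E F) :
    ∑ F ∈ T.faces, ∑ K ∈ T.neighbours F, s K * Real.sqrt (E F) ≤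
      Real.sqrt (2 * (d + 1)) *
        (Real.sqrt (∑ K, s K ^ 2) * Real.sqrt (∑ F ∈ T.faces, E F)) := by
  have h1 : ∑ F ∈ T.faces, ∑ K ∈ T.neighbours F, s K ^ 2 = (d + 1) * ∑ K, s K ^ 2 := by
    rw [← sum_elems_faces fun K _ => s K ^ 2, Finset.mul_sum]
    refine Finset.sum_congr rfl fun K _ => ?_
    simp [T.card_eq K.1 K.2]
  have h2 : ∑ F ∈ T.faces, ∑ K ∈ T.neighbours F, Real.sqrt (E F) ^ 2 ≤ 2 * ∑ F ∈ T.faces, E F := by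
    rw [Finset.mul_sum]
    refine Finset.sum_le_sum fun F hF => ?_
    rw [Finset.sum_const, Real.sq_sqrt (hE F), nsmul_eq_mul]
    refine mul_le_mul_of_nonneg_right ?_ (hE F)
    rcases card_neighbours hd hF with h | h <;> rw [h] <;> norm_num
  rw [Finset.sum_sigma'] at h1 h2 ⊢
  refine (Real.sum_mul_le_sqrt_mul_sqrt _ _ _).trans ?_
  rw [h1]
  calc _ ≤ Real.sqrt ((d + 1) * ∑ K, s K ^ 2) * Real.sqrt (2 * ∑ F ∈ T.faces, E F) := by gcongr
    _ = _ := by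
      rw [Real.sqrt_mul (by positivity), Real.sqrt_mul (by positivity),
        Real.sqrt_mul (by positivity)]
      ring

/-- The constant in the a posteriori estimate. -/
def errorConst (d : ℕ) (γ σ μ : ℝ) : ℝ :=
  ((2 ^ d) ^ 2 + Real.sqrt (2 * (d + 1)) * faceConst d σ μ) / γ

lemma errorConst_pos (d : ℕ) {γ : ℝ} (hγ : 0 < γ) (σ μ : ℝ) : 0 < errorConst d γ σ μ := by
  have : 0 ≤ faceConst d σ μ := Real.sqrt_nonneg _
  rw [errorConst]
  positivity

/-- The a posteriori `L²` error estimate for the interior penalty method. -/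
theorem l2Norm_error_le (hd : 1 ≤ d) (hΩ : interior (closure Ω) = Ω) {γ : ℝ} (hγ : 0 < γ)
    (hdual : DualStable Ω γ) {k : ℕ} (hk : 1 ≤ k) {σ : ℝ} (hσ : 0 < σ) {μ : ℝ} (hμ : 0 < μ)
    (hT : T.Triangulates Ω) (hreg : μ ≤ T.shapeRegularity) {f : Vec d → ℝ}
    (hf : MemLp f 2 (volume.restrict Ω)) {u : Vec d → ℝ} (hu : IsWeakSolution Ω f u)
    {p : T.elems → MvPolynomial (Fin d) ℝ} (hp : IsIPSolution Ω f σ k p) :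
    l2Norm (volume.restrict Ω) (fun x => u x - glue (val p) x) ≤
      errorConst d γ σ μ * estimator f σ p := by
  have hg : MemLp (fun x => u x - glue (val p) x) 2 (volume.restrict Ω) := by
    obtain ⟨Gu, hGu⟩ := hu
    exact hGu.1.1.sub (memLp_glue p Ω)
  -- The dual problem is solved with the error itself as right-hand side.
  obtain ⟨z, G, H, hz, h2, hstab⟩ := hdual _ hg
  obtain ⟨φ, ψ, Z, Γ, h⟩ := exists_hasTraces hd hT hΩ hz.1 h2
  have happrox := fun K : T.elems => exists_affine_approx (T.isSimplex K.2) hd hμ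
    (mul_diam_le_height hd hμ hreg K) (h.h1Limit K) (h.h1Limit_grad K)
  choose α m hη hface using happrox
  set r : T.elems → MvPolynomial (Fin d) ℝ := fun K => affinePoly (α K) (m K) with hr
  have hid := h.error_sq_eq hd hT hΩ hf hu hp (affinePoly_mem_dgSpace hk α m) hz h2
  set N := l2Norm (volume.restrict Ω) (fun x => u x - glue (val p) x) with hN
  set s : T.elems → ℝ := fun K => h2Semi K.1 H with hs
  set S := Real.sqrt (∑ K, s K ^ 2) with hS
  set e := estimator f σ p with he
  have hIE : 0 ≤ ∑ K : T.elems, elemIndicatorSq f p K :=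
    Finset.sum_nonneg fun K _ => elemIndicatorSq_nonneg f p K
  have hIF : 0 ≤ ∑ F ∈ T.faces, faceIndicatorSq σ p F :=
    Finset.sum_nonneg fun F _ => faceIndicatorSq_nonneg hσ.le p F
  have he1 : Real.sqrt (∑ K : T.elems, elemIndicatorSq f p K) ≤ e := by
    rw [he, estimator_eq]; exact Real.sqrt_le_sqrt (by linarith)
  have he2 : Real.sqrt (∑ F ∈ T.faces, faceIndicatorSq σ p F) ≤ e := by
    rw [he, estimator_eq]; exact Real.sqrt_le_sqrt (by linarith)
  have hA : 0 ≤ faceConst d σ μ := Real.sqrt_nonneg _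
  have hC0 : 0 ≤ approxConst d μ := by rw [approxConst]; positivity
  have helem : ∑ K : T.elems, ∫ x in openSimplex K.1, (f x + lap p K x) * (z x - val r K x) ≤
      (2 ^ d) ^ 2 * (S * e) := by
    have h1 : ∀ K : T.elems, ∫ x in openSimplex K.1, (f x + lap p K x) * (z x - val r K x) ≤
        (2 ^ d) ^ 2 * (s K * Real.sqrt (elemIndicatorSq f p K)) := by
      intro K
      have hfl : MemLp (fun x => f x + lap p K x) 2 (elemMeasure K.1) :=
        (hf.mono_measure (restrict_openSimplex_le hT hΩ K)).add
          (memLp_openSimplex K.1 (continuous_lap p K))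
      have hzr : MemLp (fun x => z x - val r K x) 2 (elemMeasure K.1) :=
        (h.h1Limit K).memLp.sub (memLp_openSimplex K.1 (continuous_val r K))
      have hval : l2Norm (elemMeasure K.1) (fun x => z x - val r K x) ≤
          (2 ^ d) ^ 2 * simplexDiam K.1 ^ 2 * s K := by
        simp only [hr, val_affinePoly]; exact hη K
      have hsqrt : Real.sqrt (elemIndicatorSq f p K) =
          simplexDiam K.1 ^ 2 * l2Norm (elemMeasure K.1) (fun x => f x + lap p K x) := by
        rw [elemIndicatorSq, show simplexDiam K.1 ^ 4 * l2Norm (elemMeasure K.1)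
            (fun x => f x + lap p K x) ^ 2 = (simplexDiam K.1 ^ 2 *
            l2Norm (elemMeasure K.1) (fun x => f x + lap p K x)) ^ 2 by ring]
        exact Real.sqrt_sq (mul_nonneg (sq_nonneg _) (l2Norm_nonneg _))
      calc _ ≤ l2Norm (elemMeasure K.1) (fun x => f x + lap p K x) *
            l2Norm (elemMeasure K.1) (fun x => z x - val r K x) :=
          (le_abs_self _).trans (abs_integral_mul_le hfl hzr)
        _ ≤ l2Norm (elemMeasure K.1) (fun x => f x + lap p K x) *
            ((2 ^ d) ^ 2 * simplexDiam K.1 ^ 2 * s K) := by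
          gcongr
          exact l2Norm_nonneg _
        _ = _ := by rw [hsqrt]; ring
    calc _ ≤ ∑ K : T.elems, (2 ^ d) ^ 2 * (s K * Real.sqrt (elemIndicatorSq f p K)) :=
          Finset.sum_le_sum fun K _ => h1 K
      _ = (2 ^ d) ^ 2 * ∑ K : T.elems, s K * Real.sqrt (elemIndicatorSq f p K) :=
          (Finset.mul_sum _ _ _).symm
      _ ≤ (2 ^ d) ^ 2 * (S * Real.sqrt (∑ K : T.elems, elemIndicatorSq f p K)) := by
          gcongr
          refine (Real.sum_mul_le_sqrt_mul_sqrt _ _ _).trans (le_of_eq ?_)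
          simp only [Real.sq_sqrt (elemIndicatorSq_nonneg f p _), hS]
      _ ≤ _ := by gcongr
  have hfaces : ∑ F ∈ T.faces, faceResidual σ p r (Z F) (Γ F) F ≤
      Real.sqrt (2 * (d + 1)) * faceConst d σ μ * (S * e) := by
    have h1 : ∀ F ∈ T.faces, faceResidual σ p r (Z F) (Γ F) F ≤
        ∑ K ∈ T.neighbours F, faceConst d σ μ * (s K * Real.sqrt (faceIndicatorSq σ p F)) := by
      intro F hF
      refine (le_abs_self _).trans ((h.abs_faceResidual_le hd hσ.le p r hF).trans ?_)
      refine Finset.sum_le_sum fun K hK => ?_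
      have hDh := mul_diam_le_faceSize hd hμ hreg hF hK
      have hD := (T.isSimplex K.2).simplexDiam_pos hd
      have happ : l2Norm (faceMeasure F) (fun x => Z F x - val r K x) ^ 2 ≤
            approxConst d μ * simplexDiam K.1 ^ 3 * s K ^ 2 ∧
          l2Norm (faceMeasure F) (fun x => Γ F x - grad r K x) ^ 2 ≤
            approxConst d μ * simplexDiam K.1 * s K ^ 2 := by
        simp only [hr, val_affinePoly, grad_affinePoly]
        have t1 := h.trace F hF
        have t2 := h.trace_grad F hF K hK
        obtain ⟨a, ha⟩ := exists_eq_erase hF hK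
        rw [ha] at t1 t2 ⊢
        exact hface K a _ _ t1 t2
      refine face_term_le hC0 hσ (lt_min hμ one_pos) hD hDh (h2Semi_nonneg _ _) ?_ ?_
        happ.1 happ.2 <;> split_ifs <;> norm_num
    calc _ ≤ ∑ F ∈ T.faces, ∑ K ∈ T.neighbours F,
          faceConst d σ μ * (s K * Real.sqrt (faceIndicatorSq σ p F)) := Finset.sum_le_sum h1
      _ = faceConst d σ μ * ∑ F ∈ T.faces, ∑ K ∈ T.neighbours F,
          s K * Real.sqrt (faceIndicatorSq σ p F) := by simp only [Finset.mul_sum]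
      _ ≤ faceConst d σ μ * (Real.sqrt (2 * (d + 1)) *
          (S * Real.sqrt (∑ F ∈ T.faces, faceIndicatorSq σ p F))) := by
        gcongr
        exact sum_faces_mul_le hd s (faceIndicatorSq_nonneg hσ.le p)
      _ ≤ faceConst d σ μ * (Real.sqrt (2 * (d + 1)) * (S * e)) := by gcongr
      _ = _ := by ring
  -- Only the second derivatives of `z` occur in the bounds, and stability controls them by the
  -- error.
  have hSN : γ * S ≤ N := by
    refine (mul_le_mul_of_nonneg_left ?_ hγ.le).trans hstab
    exact Real.sqrt_le_iff.2 ⟨Real.sqrt_nonneg _, sum_h2Semi_sq_le hT hΩ h2⟩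
  have hN0 : 0 ≤ N := l2Norm_nonneg _
  have he0 : 0 ≤ e := Real.sqrt_nonneg _
  have hmain : N ^ 2 ≤ ((2 ^ d) ^ 2 + Real.sqrt (2 * (d + 1)) * faceConst d σ μ) * (S * e) := by
    rw [hid, add_mul]; exact add_le_add helem hfaces
  have hSN' : S ≤ N / γ := by rw [le_div_iff₀ hγ]; linarith
  -- The estimate so far is quadratic in `N` on the left and linear on the right; one factor is
  -- cancelled when it is nonzero.
  rcases hN0.eq_or_lt with h0 | h0
  · rw [← h0]
    exact mul_nonneg (errorConst_pos d hγ σ μ).le he0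
  · refine le_of_mul_le_mul_left ?_ h0
    calc N * N = N ^ 2 := by ring
      _ ≤ _ := hmain
      _ ≤ ((2 ^ d) ^ 2 + Real.sqrt (2 * (d + 1)) * faceConst d σ μ) * (N / γ * e) := by gcongr
      _ = _ := by rw [errorConst]; ring

end Mesh

end Estimate

end IPDG

end

theorem mainTheorem4 (d : ℕ) (hd : 1 ≤ d) (Ω : Set (IPDG.Vec d)) (hΩ : interior (closure Ω) = Ω)
    (γ : ℝ) (hγ : 0 < γ) (hdual : IPDG.DualStable Ω γ)
    (k : ℕ) (hk : 1 ≤ k) (σ : ℝ) (hσ : 0 < σ) (μ : ℝ) (hμ : 0 < μ) :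
    ∃ C : ℝ, 0 < C ∧
      ∀ T : IPDG.Mesh d, T.Triangulates Ω → μ ≤ T.shapeRegularity →
      ∀ f : IPDG.Vec d → ℝ, MeasureTheory.MemLp f 2 (MeasureTheory.volume.restrict Ω) →
      ∀ u : IPDG.Vec d → ℝ, IPDG.IsWeakSolution Ω f u →
      ∀ uh : T.elems → MvPolynomial (Fin d) ℝ, IPDG.Mesh.IsIPSolution Ω f σ k uh →
        IPDG.l2Norm (MeasureTheory.volume.restrict Ω)
            (fun x => u x - IPDG.Mesh.glue (IPDG.Mesh.val uh) x) ≤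
          C * IPDG.Mesh.estimator f σ uh := by
  -- The constant is explicit in `d`, `γ`, `σ` and `μ`; the domain enters only through `γ`, and the
  -- degree `k` not at all.
  exact ⟨IPDG.Mesh.errorConst d γ σ μ, IPDG.Mesh.errorConst_pos d hγ σ μ,
    fun _ hT hreg _ hf _ hu _ hp =>
      IPDG.Mesh.l2Norm_error_le hd hΩ hγ hdual hk hσ hμ hT hreg hf hu hp⟩
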